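/- Let $p$ be a prime, $K$ a finite extension of $\mathbb{Q}_p$, $\mathcal{O}$ its ring of integers and $k$ its residue field. Let $F\in K[x]$ be a monic square-free cubic polynomial, $E$ the elliptic curve $y^2=F(x)$ over $K$, $A_K=K[T]/(F(T))$, and $A_{\mathcal{O}}$ the ring of integers (integral closure of $\mathcal{O}$) of $A_K$. Let $(A_K^\times/(A_K^\times)^2)_\square$ be the group of classes in $A_K^\times/(A_K^\times)^2$ whose norm is a square in $K$, and let $(A_{\mathcal{O}}^\times/(A_{\mathcal{O}}^\times)^2)_\square$ be the group of classes in $A_{\mathcal{O}}^\times/(A_{\mathcal{O}}^\times)^2$ with square norm, regarded as a subgroup of $(A_K^\times/(A_K^\times)^2)_\square$ through the natural inclusion. Let $$\delta_K:E(K)/2E(K)\hookrightarrow H^1(\mathrm{Gal}(\bar K/K),E(\bar K)[2])\simeq (A_K^\times/(A_K^\times)^2)_\square$$ be the Kummer map: the connecting homomorphism of multiplication by $2$, followed by the identification that the Weil pairing $E[2]\to\mu_2(A_K\otimes_K\bar K)$ and the Kummer isomorphism $H^1(\mathrm{Gal}(\bar K/K),\mu_2(A_K\otimes_K\bar K))\simeq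 A_K^\times/(A_K^\times)^2$ induce (so that $\delta_K(P)$ is the class of $x(P)-T$ whenever $x(P)-T$ is invertible in $A_K$). Let $\delta_K(E)$ denote its image. Say that $E$ satisfies (†) if $F\in\mathcal{O}[x]$ and at least one of the following holds: (i) $A_K$ is a field; (ii) $A_{\mathcal{O}}=\mathcal{O}[T]/(F(T))$; (iii) $\mathrm{char}(k)>2$ and $[E(K):E_0(K)]$ is odd, where $E_0(K)$ is the subgroup of the points of $E(K)$ whose reduction, on a minimal Weierstrass equation of $E$, is non-singular; (iv) $\mathrm{char}(k)=2$, $K/\mathbb{Q}_2$ is unramified, and $E$ has good reduction. If $E$ satisfies (†) and $\mathrm{char}(k)>2$, then $$\delta_K(E)=(A_{\mathcal{O}}^\times/(A_{\mathcal{O}}^\times)^2)_\square .$$ -/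

import Mathlib

namespace LocalKummer

noncomputable section

/-! ### Finite extensions of `ℚ_p` and their rings of integers -/

section Integers

variable (p : ℕ) [Fact p.Prime] (K : Type*) [Field K] [Algebra ℚ_[p] K]
  [Algebra ℤ_[p] K] [IsScalarTower ℤ_[p] ℚ_[p] K]

/-- The ring of integers of a finite extension `K` of `ℚ_p`: the integral closure of `ℤ_p`. -/
abbrev Integers : Subalgebra ℤ_[p] K := integralClosure ℤ_[p] K

variable [FiniteDimensional ℚ_[p] K]

theorem mem_integers_iff (x : K) : x ∈ Integers p K ↔ spectralNorm ℚ_[p] K x ≤ 1 := by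
  have hx : IsIntegral ℚ_[p] x := IsIntegral.of_finite ℚ_[p] x
  rw [spectralNorm, spectralValue_le_one_iff (minpoly.monic hx)]
  constructor
  · intro h n
    have h' : IsIntegral ℤ_[p] x := h
    have hm := minpoly.isIntegrallyClosed_eq_field_fractions ℚ_[p] K h'
    rw [Algebra.algebraMap_self_apply] at hm
    rw [hm, Polynomial.coeff_map]
    exact PadicInt.norm_le_one _
  · intro h
    have hl : minpoly ℚ_[p] x ∈ Polynomial.lifts (algebraMap ℤ_[p] ℚ_[p]) := by
      rw [Polynomial.lifts_iff_coeff_lifts]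
      intro n
      exact ⟨⟨_, h n⟩, rfl⟩
    obtain ⟨g, hg, -, hm⟩ := Polynomial.lifts_and_natDegree_eq_and_monic hl (minpoly.monic hx)
    refine ⟨g, hm, ?_⟩
    have := minpoly.aeval ℚ_[p] x
    rw [← hg, Polynomial.aeval_map_algebraMap] at this
    exact this

instance : IsFractionRing (Integers p K) K :=
  integralClosure.isFractionRing_of_finite_extension ℚ_[p] K

instance : IsDedekindDomain (Integers p K) :=
  integralClosure.isDedekindDomain ℤ_[p] ℚ_[p] K

theorem isUnit_integers_iff (x : Integers p K) :
    IsUnit x ↔ spectralNorm ℚ_[p] K (x : K) = 1 := by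
  have hmul : ∀ a b : K, spectralNorm ℚ_[p] K (a * b) =
      spectralNorm ℚ_[p] K a * spectralNorm ℚ_[p] K b := spectralAlgNorm_mul
  have h1 : spectralNorm ℚ_[p] K 1 = 1 := spectralNorm_one
  constructor
  · rintro ⟨u, rfl⟩
    have ha := (mem_integers_iff p K _).mp (u : Integers p K).2
    have hb := (mem_integers_iff p K _).mp ((u⁻¹ : (Integers p K)ˣ) : Integers p K).2
    have hab : ((u : Integers p K) : K) * ((u⁻¹ : (Integers p K)ˣ) : Integers p K) = 1 := by
      rw [← MulMemClass.coe_mul, Units.mul_inv, OneMemClass.coe_one]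
    have := hmul ((u : Integers p K) : K) ((u⁻¹ : (Integers p K)ˣ) : Integers p K)
    rw [hab, h1] at this
    nlinarith [spectralNorm_nonneg (K := ℚ_[p]) ((u : Integers p K) : K),
      spectralNorm_nonneg (K := ℚ_[p]) (((u⁻¹ : (Integers p K)ˣ) : Integers p K) : K)]
  · intro h
    have hx : (x : K) ≠ 0 := by
      intro h0
      rw [h0, spectralNorm_zero] at h
      exact zero_ne_one h
    have hi : (x : K)⁻¹ ∈ Integers p K := by
      rw [mem_integers_iff]
      have := hmul (x : K) (x : K)⁻¹
      rw [mul_inv_cancel₀ hx, h1, h, one_mul] at this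
      exact this.symm.le
    exact IsUnit.of_mul_eq_one ⟨_, hi⟩ (Subtype.ext (mul_inv_cancel₀ hx))

instance : IsLocalRing (Integers p K) := by
  refine IsLocalRing.of_nonunits_add fun a b ha hb => ?_
  rw [mem_nonunits_iff, isUnit_integers_iff] at *
  have ha' := lt_of_le_of_ne ((mem_integers_iff p K _).mp a.2) ha
  have hb' := lt_of_le_of_ne ((mem_integers_iff p K _).mp b.2) hb
  refine ne_of_lt (lt_of_le_of_lt ?_ (max_lt ha' hb'))
  exact isNonarchimedean_spectralNorm (K := ℚ_[p]) (L := K) (a : K) (b : K)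

instance : IsDiscreteValuationRing (Integers p K) := by
  have hf : ¬ IsField (Integers p K) → IsDiscreteValuationRing (Integers p K) :=
    fun h => ((IsDiscreteValuationRing.TFAE (Integers p K) h).out 0 2).mpr
      (inferInstance : IsDedekindDomain (Integers p K))
  refine hf fun h => ?_
  have hp : IsUnit (p : Integers p K) := by
    refine isUnit_iff_exists_inv.mpr (h.mul_inv_cancel ?_)
    intro h0
    have h1 : (algebraMap ℚ_[p] K) (p : ℚ_[p]) = 0 := by
      have := congrArg (fun z : Integers p K => (z : K)) h0
      simpa using this
    have h2 : (p : ℚ_[p]) = 0 := (map_eq_zero _).mp h1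
    exact (Fact.out : p.Prime).ne_zero (by exact_mod_cast h2)
  rw [isUnit_integers_iff] at hp
  have h3 : (((p : Integers p K)) : K) = algebraMap ℚ_[p] K (p : ℚ_[p]) := by simp
  rw [h3, spectralNorm_extends] at hp
  exact (Padic.norm_p_lt_one (p := p)).ne hp

end Integers

/-! ### Units modulo squares -/

section ModSquares

/-- The group `M^× / (M^×)²`. -/
abbrev ModSquares (M : Type*) [CommMonoid M] : Type _ :=
  Mˣ ⧸ (powMonoidHom 2 : Mˣ →* Mˣ).range

/-- The map `M^× / (M^×)² → N^× / (N^×)²` induced by a multiplicative map `M → N`. -/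
def ModSquares.map {M N : Type*} [CommMonoid M] [CommMonoid N] (f : M →* N) :
    ModSquares M →* ModSquares N :=
  QuotientGroup.map _ _ (Units.map f) <| by
    rintro _ ⟨u, rfl⟩
    exact ⟨Units.map f u, by simp⟩

end ModSquares

/-! ### The cubic algebra `A_K = K[T]/(F(T))` and its ring of integers -/

section CubicAlgebra

variable {K : Type*} [Field K] (R : Type*) [CommRing R] [Algebra R K] (F : Polynomial K)

/-- The ring of integers of `A_K = K[T]/(F(T))`, where `R` is the ring of integers of `K`. -/
abbrev AlgIntegers : Subalgebra R (AdjoinRoot F) := integralClosure R (AdjoinRoot F)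

/-- `(A_K^× / (A_K^×)²)_□`: the classes whose norm is a square in `K`. -/
def squareNorm : Subgroup (ModSquares (AdjoinRoot F)) :=
  (ModSquares.map (Algebra.norm K : AdjoinRoot F →* K)).ker

/-- The natural map `A_O^× / (A_O^×)² → A_K^× / (A_K^×)²`. -/
def integersToAlg : ModSquares (AlgIntegers R F) →* ModSquares (AdjoinRoot F) :=
  ModSquares.map ((AlgIntegers R F).val : AlgIntegers R F →* AdjoinRoot F)

/-- The natural map `A_O^× / (A_O^×)² → A_K^× / (A_K^×)²` is an inclusion. -/
theorem integersToAlg_injective : Function.Injective (integersToAlg R F) := by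
  rw [injective_iff_map_eq_one]
  intro a
  induction a using QuotientGroup.induction_on with
  | H u =>
    intro h
    have h' : ((Units.map ((AlgIntegers R F).val : AlgIntegers R F →* AdjoinRoot F) u :
        (AdjoinRoot F)ˣ) : ModSquares (AdjoinRoot F)) = 1 := h
    rw [QuotientGroup.eq_one_iff] at h' ⊢
    obtain ⟨w, hw⟩ := h'
    have hint : ∀ (w : (AdjoinRoot F)ˣ) (u : (AlgIntegers R F)ˣ),
        w ^ 2 = Units.map ((AlgIntegers R F).val : AlgIntegers R F →* AdjoinRoot F) u →
        (w : AdjoinRoot F) ∈ AlgIntegers R F := by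
      intro w u hw
      have h2 : (w : AdjoinRoot F) ^ 2 = ((u : AlgIntegers R F) : AdjoinRoot F) := by
        simpa using congrArg Units.val hw
      exact IsIntegral.of_pow (n := 2) (by norm_num) (by rw [h2]; exact (u : AlgIntegers R F).2)
    have hw' : w ^ 2 = Units.map ((AlgIntegers R F).val : AlgIntegers R F →* AdjoinRoot F) u := hw
    have hi := hint w u hw'
    have hj := hint w⁻¹ u⁻¹ (by rw [inv_pow, hw', map_inv])
    refine ⟨⟨⟨_, hi⟩, ⟨_, hj⟩, Subtype.ext (by simp), Subtype.ext (by simp)⟩, ?_⟩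
    ext
    simpa using congrArg Units.val hw'

/-- `(A_O^× / (A_O^×)²)_□`: the classes of units of the ring of integers with square norm. -/
def integralSquareNorm : Subgroup (ModSquares (AlgIntegers R F)) :=
  (squareNorm F).comap (integersToAlg R F)

end CubicAlgebra

/-! ### The curve `y² = F(x)` and its Kummer map -/

section Kummer

variable {K : Type*} [Field K] (F : Polynomial K)

/-- The Weierstrass curve `y² = F(x)`, for a monic cubic polynomial `F`. -/
def cubicCurve : WeierstrassCurve K := ⟨0, F.coeff 2, 0, F.coeff 1, F.coeff 0⟩

/-- The group `W(L)` of points over an extension `L` of `K`. -/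
abbrev Pts (W : WeierstrassCurve K) (L : Type*) [Field L] [Algebra K L] : Type _ :=
  (WeierstrassCurve.baseChange W L).toAffine.Point

/-- The Weil pairing `e₂(S, T_φ) ∈ {±1}` of a `2`-torsion point `S` of `y² = F(x)` with the
`2`-torsion point `T_φ = (φ(T), 0)`, where `φ : K[T]/(F(T)) → L` is an embedding of `K`-algebras
(that is, a root `φ(T)` of `F` in `L`): it is trivial exactly when `S = 0` or `S = T_φ`. -/
def weilPairing {L : Type*} [Field L] [Algebra K L] (S : Pts (cubicCurve F) L)
    (φ : AdjoinRoot F →ₐ[K] L) : L :=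
  open scoped Classical in
  match S with
  | .zero => 1
  | .some x _ _ => if x = φ (AdjoinRoot.root F) then 1 else -1

open scoped Classical in
/-- The cocycle `σ ↦ σ(Q) - Q` attached to a point `Q` over the algebraic closure of `K`. If `2Q`
is a `K`-rational point `P`, this is an `E[2]`-valued cocycle representing the image of `P` under
the connecting map `E(K) → H¹(G_K, E[2])` of multiplication by `2`. -/
def kummerCocycle {W : WeierstrassCurve K} (Q : Pts W (AlgebraicClosure K))
    (σ : AlgebraicClosure K ≃ₐ[K] AlgebraicClosure K) : Pts W (AlgebraicClosure K) :=
  WeierstrassCurve.Affine.Point.map (W' := W) (σ : AlgebraicClosure K →ₐ[K] AlgebraicClosure K) Q - Q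

/-- The class of `α ∈ A_K^×` in `A_K^× / (A_K^×)²` corresponds to the class of the cocycle
`c : G_K → E[2]` under the identification `H¹(G_K, E[2]) ≃ (A_K^× / (A_K^×)²)_□`.

Write `Ā = A_K ⊗ K̄`, the algebra of `K̄`-valued functions on the set of embeddings
`φ : A_K → K̄`, on which `σ ∈ G_K` acts by `(σβ)(σ ∘ φ) = σ(β(φ))`. The identification is the
composite of `H¹(G_K, E[2]) → H¹(G_K, μ₂(Ā))` induced by `S ↦ (φ ↦ e₂(S, T_φ))`, and of the inverse
of the Kummer isomorphism `A_K^× / (A_K^×)² ≃ H¹(G_K, μ₂(Ā))`, which sends the class of `α` to that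
of `σ ↦ σ(β)/β` for a square root `β ∈ Ā^×` of `α`. (A change of `c` or `β` by a coboundary
is absorbed by the choice of `β`.) -/
def CorrespondsTo (c : (AlgebraicClosure K ≃ₐ[K] AlgebraicClosure K) →
    Pts (cubicCurve F) (AlgebraicClosure K)) (α : (AdjoinRoot F)ˣ) : Prop :=
  ∃ β : (AdjoinRoot F →ₐ[K] AlgebraicClosure K) → AlgebraicClosure K,
    (∀ φ, β φ ^ 2 = φ (α : AdjoinRoot F)) ∧
    ∀ (σ : AlgebraicClosure K ≃ₐ[K] AlgebraicClosure K) (φ : AdjoinRoot F →ₐ[K] AlgebraicClosure K),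
      σ (β φ) = weilPairing F (c σ) ((σ : AlgebraicClosure K →ₐ[K] AlgebraicClosure K).comp φ) *
        β ((σ : AlgebraicClosure K →ₐ[K] AlgebraicClosure K).comp φ)

open scoped Classical in
/-- `IsKummerValue F P a` says that `δ_K(P) = a`, where
`δ_K : E(K)/2E(K) → H¹(G_K, E[2]) ≃ (A_K^× / (A_K^×)²)_□` is the Kummer map of `E : y² = F(x)`. -/
def IsKummerValue (P : Pts (cubicCurve F) K) (a : ModSquares (AdjoinRoot F)) : Prop :=
  ∃ Q : Pts (cubicCurve F) (AlgebraicClosure K),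
    2 • Q = WeierstrassCurve.Affine.Point.baseChange (W' := cubicCurve F) K (AlgebraicClosure K) P ∧
    ∃ α : (AdjoinRoot F)ˣ, (α : ModSquares (AdjoinRoot F)) = a ∧
      CorrespondsTo F (kummerCocycle Q) α

/-- The image `δ_K(E)` of the Kummer map. -/
def kummerImage : Set (ModSquares (AdjoinRoot F)) := {a | ∃ P, IsKummerValue F P a}

end Kummer

/-! ### Nonsingular reduction and the condition on `F` -/

section Reduction

open WeierstrassCurve

variable (R : Type*) [CommRing R] [IsDomain R] [IsDiscreteValuationRing R]
variable {K : Type*} [Field K] [Algebra R K] [IsFractionRing R K]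

/-- The reduction of the point `P` of `W(K)`, computed on the minimal equation `C • W`, is
nonsingular. A point `(x, y)` of `W` is the point `(x', y')` of `C • W`, where `x = u²x' + r` and
`y = u³y' + u²sx' + t`; it reduces to the (nonsingular) point at infinity unless
`x'` and `y'` are integral. -/
def HasNonsingularReduction (W : WeierstrassCurve K) (C : VariableChange K) [IsMinimal R (C • W)] :
    Pts W K → Prop
  | .zero => True
  | .some x y _ => ∀ a b : R,
      x = (C.u : K) ^ 2 * algebraMap R K a + C.r →
      y = (C.u : K) ^ 3 * algebraMap R K b + (C.u : K) ^ 2 * C.s * algebraMap R K a + C.t →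
      ((C • W).reduction R).toAffine.Nonsingular (IsLocalRing.residue R a) (IsLocalRing.residue R b)

open scoped Classical in
/-- `E₀(K)`, the subgroup of `E(K)` of points whose reduction (on the minimal equation `C • W`) is
nonsingular. These points are closed under the group law, so that `closure` adds no points. -/
def nonsingularPart (W : WeierstrassCurve K) (C : VariableChange K) [IsMinimal R (C • W)] :
    AddSubgroup (Pts W K) :=
  AddSubgroup.closure {P | HasNonsingularReduction R W C P}

end Reduction

open WeierstrassCurve in
open scoped Classical in
/-- The condition (†) on `E : y² = F(x)` over a finite extension `K` of `ℚ_p`, with ring of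
integers `O` and residue field `k`. -/
structure Dagger (p : ℕ) [Fact p.Prime] (K : Type*) [Field K] [Algebra ℚ_[p] K]
    [FiniteDimensional ℚ_[p] K] [Algebra ℤ_[p] K] [IsScalarTower ℤ_[p] ℚ_[p] K]
    (F : Polynomial K) : Prop where
  monic : F.Monic
  natDegree_eq : F.natDegree = 3
  squarefree : Squarefree F
  integral : ∀ i, F.coeff i ∈ Integers p K
  condition :
    /- (i) `A_K` is a field. -/
    IsField (AdjoinRoot F) ∨
    /- (ii) `A_O = O[T]/(F(T))`. -/
    AlgIntegers (Integers p K) F = Algebra.adjoin (Integers p K) {AdjoinRoot.root F} ∨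
    /- (iii) `char k > 2` and `[E(K) : E₀(K)]` is odd. -/
    (2 < ringChar (IsLocalRing.ResidueField (Integers p K)) ∧
      ∃ (C : VariableChange K) (_ : IsMinimal (Integers p K) (C • cubicCurve F)),
        Odd (nonsingularPart (Integers p K) (cubicCurve F) C).index) ∨
    /- (iv) `char k = 2`, `K/ℚ_p` is unramified and `E` has good reduction. -/
    (ringChar (IsLocalRing.ResidueField (Integers p K)) = 2 ∧
      Algebra.FormallyUnramified ℤ_[p] (Integers p K) ∧
      ∃ C : VariableChange K, HasGoodReduction (Integers p K) (C • cubicCurve F))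

end

end LocalKummer

open Polynomial

set_option linter.unusedSectionVars false

/-! The equality follows from an inclusion and a count against the number of rational 2-torsion
points.

Lower bound for the image. The Kummer map is injective on E(K)/2E(K). The points with non-integral
x-coordinate form a subgroup of finite index in E(K) which has no 2-torsion and on which the Kummer
class is trivial: for |x| > 1 the factor 1 - T/x of x - T is close to 1, and elements close to 1 are
squares because the residue characteristic is odd. Comparing squaring with the Kummer map on the
finite quotient gives #δ(E) ≥ #E(K)[2] (`card_two_torsion_le_card_range`).

Upper bound for the unit classes. If N(u) = c², then u³/c² has norm 1 and the class of u. The units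
of norm 1 close to 1 have finite index and are squares of elements of the same kind, so the number
of classes is at most the number of units of norm 1 and square 1. These are triples of signs with
product 1, permuted by Galois, and the Weil pairing turns them into rational 2-torsion points
(`card_absUnitClasses_le`). Hence the equality holds as soon as every Kummer class is a class of
units (`range_kummerHom_eq`).

Inclusion. If A_K is a field, its embeddings are Galois conjugate, so an element of norm 1 has
absolute value 1 at each of them. If a point has nonsingular reduction, at most one factor of x - T
is smaller than the scale of the model, and the size of y or of F'(x) makes every factor the size of
a square (`kummer_mem_of_nonsingular`). Odd index reduces to this case, since classes modulo squares
are killed by 2. A monogenic ring of integers forces every integral point to reduce to a nonsingular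
point of y² = F(x). Condition (iv) is excluded by the residue characteristic.

Cohomology is replaced by explicit halving: square roots r_φ of x - φ(T) with product y determine a
half of (x, y), and changing two of their signs adds a 2-torsion point to it. Algebra elements are
treated as Galois equivariant functions on the three embeddings (`Emb.descent`). -/

namespace LocalKummer

/-! ### Embeddings of the cubic algebra and Galois descent -/

/-- `F` is a monic squarefree cubic polynomial. -/
class IsSquarefreeCubic {K : Type*} [Field K] (F : K[X]) : Prop where
  monic : F.Monic
  natDegree_eq : F.natDegree = 3
  squarefree : Squarefree F

/-- The embeddings of `K[T]/(F(T))` into an algebraic closure of `K`. -/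
abbrev Emb {K : Type*} [Field K] (F : K[X]) : Type _ := AdjoinRoot F →ₐ[K] AlgebraicClosure K

/-- The root of `F` attached to an embedding. -/
noncomputable abbrev Emb.rt {K : Type*} [Field K] {F : K[X]} (φ : Emb F) : AlgebraicClosure K :=
  φ (AdjoinRoot.root F)

/-- The action of the Galois group on embeddings. -/
noncomputable abbrev Emb.act {K : Type*} [Field K] {F : K[X]}
    (σ : AlgebraicClosure K ≃ₐ[K] AlgebraicClosure K) (φ : Emb F) : Emb F :=
  (σ : AlgebraicClosure K →ₐ[K] AlgebraicClosure K).comp φ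

section Embeddings

variable {K : Type*} [Field K] {F : K[X]}

theorem Emb.act_apply (σ : AlgebraicClosure K ≃ₐ[K] AlgebraicClosure K) (φ : Emb F)
    (a : AdjoinRoot F) : Emb.act σ φ a = σ (φ a) := rfl

theorem Emb.ext_rt {φ ψ : Emb F} (h : φ.rt = ψ.rt) : φ = ψ :=
  AdjoinRoot.algHom_ext h

/-- The action of `σ` as a permutation of the embeddings. -/
noncomputable def Emb.actEquiv (σ : AlgebraicClosure K ≃ₐ[K] AlgebraicClosure K) :
    Emb F ≃ Emb F where
  toFun := Emb.act σ
  invFun := Emb.act σ.symm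
  left_inv φ := by ext; simp
  right_inv φ := by ext; simp

theorem Emb.aeval_rt (φ : Emb F) : aeval φ.rt F = 0 := by
  rw [Emb.rt, aeval_algHom_apply, AdjoinRoot.aeval_eq, AdjoinRoot.mk_self, map_zero]

theorem Emb.rt_injective : Function.Injective (Emb.rt : Emb F → AlgebraicClosure K) :=
  fun _ _ h => Emb.ext_rt h

variable [hF : IsSquarefreeCubic F]

theorem IsSquarefreeCubic.ne_zero : F ≠ 0 := hF.squarefree.ne_zero

noncomputable instance : Fintype (Emb F) :=
  haveI : Module.Finite K (AdjoinRoot F) := hF.monic.finite_adjoinRoot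
  Fintype.ofFinite _

variable [CharZero K]

theorem card_emb : Fintype.card (Emb F) = 3 := by
  classical
  have hsep : F.Separable := (PerfectField.separable_iff_squarefree).mpr hF.squarefree
  have hspl : (F.map (algebraMap K (AlgebraicClosure K))).Splits := IsAlgClosed.splits _
  have h1 := (nodup_aroots_iff_of_splits (K := AlgebraicClosure K) hF.ne_zero hspl).mpr hsep
  have h2 := hspl.natDegree_eq_card_roots
  rw [natDegree_map, hF.natDegree_eq] at h2
  rw [Fintype.card_congr (AdjoinRoot.equiv (AlgebraicClosure K) K F hF.ne_zero),
    Fintype.card_congr (Equiv.subtypeEquivRight (q := fun x => x ∈ (F.aroots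
      (AlgebraicClosure K)).toFinset) (fun x => by rw [Multiset.mem_toFinset])),
    Fintype.card_coe, Multiset.toFinset_card_of_nodup h1, aroots, ← h2]

/-- An element of the cubic algebra is determined by its images under the embeddings. -/
theorem Emb.ext_elem {a b : AdjoinRoot F} (h : ∀ φ : Emb F, φ a = φ b) : a = b := by
  classical
  rw [← sub_eq_zero]
  -- The remainder modulo F of a lift of a - b has degree below three and vanishes at the three
  -- distinct roots.
  obtain ⟨q, hq⟩ := AdjoinRoot.mk_surjective (a - b)
  have hmod : AdjoinRoot.mk F (q %ₘ F) = a - b := by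
    rw [← hq, AdjoinRoot.mk_eq_mk]
    exact ⟨-(q /ₘ F), by rw [modByMonic_eq_sub_mul_div q F]; ring⟩
  have hz : ∀ φ : Emb F, aeval φ.rt (q %ₘ F) = 0 := fun φ => by
    rw [Emb.rt, aeval_algHom_apply, AdjoinRoot.aeval_eq, hmod, map_sub, h, sub_self]
  have hdeg : ((q %ₘ F).map (algebraMap K (AlgebraicClosure K))).degree <
      (Finset.univ : Finset (Emb F)).card := by
    rw [Finset.card_univ, card_emb, degree_map]
    refine (degree_modByMonic_lt q hF.monic).trans_le ?_
    rw [degree_eq_natDegree hF.ne_zero, hF.natDegree_eq]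
  have h0 := eq_of_degrees_lt_of_eval_index_eq (v := fun φ : Emb F => φ.rt) (g := 0)
    Finset.univ Emb.rt_injective.injOn hdeg (by rw [degree_zero]; exact WithBot.bot_lt_coe _)
    (fun φ _ => by rw [eval_map_algebraMap, hz, eval_zero])
  rw [Polynomial.map_eq_zero] at h0
  rw [← hmod, h0, map_zero]

/-- Galois descent: an equivariant function on the embeddings comes from an element. -/
theorem Emb.descent (g : Emb F → AlgebraicClosure K)
    (hg : ∀ (σ : AlgebraicClosure K ≃ₐ[K] AlgebraicClosure K) φ, σ (g φ) = g (Emb.act σ φ)) :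
    ∃ a : AdjoinRoot F, ∀ φ : Emb F, φ a = g φ := by
  classical
  set P := Lagrange.interpolate Finset.univ (fun φ : Emb F => φ.rt) g with hP
  have hinj : Set.InjOn (fun φ : Emb F => φ.rt) (Finset.univ : Finset (Emb F)) :=
    Emb.rt_injective.injOn
  have hev : ∀ φ : Emb F, P.eval φ.rt = g φ := fun φ =>
    Lagrange.eval_interpolate_at_node (v := fun φ : Emb F => φ.rt) g hinj (Finset.mem_univ φ)
  have hdeg := Lagrange.degree_interpolate_lt (v := fun φ : Emb F => φ.rt) g hinj
  -- Since g is equivariant, applying σ to the coefficients of P gives an interpolant of the same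
  -- data; uniqueness of interpolation then shows that P is fixed.
  have hfix : ∀ σ : AlgebraicClosure K ≃ₐ[K] AlgebraicClosure K,
      P.map (σ : AlgebraicClosure K →+* AlgebraicClosure K) = P := fun σ => by
    refine Lagrange.eq_interpolate_of_eval_eq (v := fun φ : Emb F => φ.rt) g hinj
      (by rw [degree_map]; exact hdeg) fun φ _ => ?_
    obtain ⟨ψ, rfl⟩ := (Emb.actEquiv σ).surjective φ
    have : (Emb.actEquiv σ ψ).rt = (σ : AlgebraicClosure K →+* AlgebraicClosure K) ψ.rt := rfl
    rw [this, eval_map_apply, hev]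
    exact hg σ ψ
  have hl : P ∈ lifts (algebraMap K (AlgebraicClosure K)) := by
    rw [lifts_iff_coeff_lifts]
    intro n
    rw [InfiniteGalois.mem_range_algebraMap_iff_fixed]
    intro σ
    conv_rhs => rw [← hfix σ]
    rw [coeff_map]; rfl
  obtain ⟨q, hq⟩ := hl
  refine ⟨AdjoinRoot.mk F q, fun φ => ?_⟩
  rw [← hev, ← hq, ← AdjoinRoot.aeval_eq, ← aeval_algHom_apply]
  simp [eval_map_algebraMap]

/-- An equivariant nowhere vanishing function on the embeddings comes from a unit. -/
theorem Emb.descent_units (g : Emb F → AlgebraicClosure K)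
    (hg : ∀ (σ : AlgebraicClosure K ≃ₐ[K] AlgebraicClosure K) φ, σ (g φ) = g (Emb.act σ φ))
    (h0 : ∀ φ, g φ ≠ 0) :
    ∃ a : (AdjoinRoot F)ˣ, ∀ φ : Emb F, φ (a : AdjoinRoot F) = g φ := by
  obtain ⟨a, ha⟩ := Emb.descent g hg
  obtain ⟨b, hb⟩ := Emb.descent (fun φ => (g φ)⁻¹) (fun σ φ => by rw [map_inv₀, hg])
  have hab : a * b = 1 := Emb.ext_elem fun φ => by
    rw [map_mul, ha, hb, map_one, mul_inv_cancel₀ (h0 φ)]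
  exact ⟨⟨a, b, hab, by rw [mul_comm, hab]⟩, ha⟩

/-- The norm is the product over the embeddings. -/
theorem Emb.norm_eq_prod (a : AdjoinRoot F) :
    algebraMap K (AlgebraicClosure K) (Algebra.norm K a) = ∏ φ : Emb F, φ a := by
  classical
  let pb := AdjoinRoot.powerBasis' hF.monic
  have hdim : Fintype.card (Emb F) = pb.dim := by
    rw [card_emb, AdjoinRoot.powerBasis'_dim, hF.natDegree_eq]
  let e : Emb F ≃ Fin pb.dim := Fintype.equivFinOfCardEq hdim
  -- The Vandermonde matrix of the roots conjugates multiplication by a, written in the power basis,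
  -- to the diagonal matrix of the values φ a.
  let B : Matrix (Fin pb.dim) (Fin pb.dim) (AlgebraicClosure K) :=
    Matrix.vandermonde fun i => (e.symm i).rt
  have hB : B.det ≠ 0 := Matrix.det_vandermonde_ne_zero_iff.mpr
    (Emb.rt_injective.comp e.symm.injective)
  have hBij : ∀ i j, B i j = e.symm i (pb.basis j) := fun i j => by
    rw [pb.basis_eq_pow, map_pow]; rfl
  let M := (Algebra.leftMulMatrix pb.basis a).map (algebraMap K (AlgebraicClosure K))
  have hmul : Matrix.diagonal (fun i => e.symm i a) * B = B * M := by
    ext i j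
    rw [Matrix.diagonal_mul, Matrix.mul_apply, hBij, ← map_mul]
    have : a * pb.basis j = ∑ k, Algebra.leftMulMatrix pb.basis a k j • pb.basis k := by
      conv_lhs => rw [← pb.basis.sum_repr (a * pb.basis j)]
      simp only [Algebra.leftMulMatrix_eq_repr_mul]
    rw [this, map_sum]
    refine Finset.sum_congr rfl fun k _ => ?_
    rw [map_smul, hBij, Algebra.smul_def, mul_comm]; rfl
  have hdet := congrArg Matrix.det hmul
  rw [Matrix.det_mul, Matrix.det_mul, Matrix.det_diagonal, mul_comm] at hdet
  have := mul_left_cancel₀ hB hdet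
  rw [Algebra.norm_eq_matrix_det pb.basis, RingHom.map_det, ← Equiv.prod_comp e.symm, this]
  rfl

/-- `φ₁`, `φ₂`, `φ₃` are the three embeddings of the cubic algebra. -/
structure IsTriple (φ₁ φ₂ φ₃ : Emb F) : Prop where
  ne₁₂ : φ₁ ≠ φ₂
  ne₁₃ : φ₁ ≠ φ₃
  ne₂₃ : φ₂ ≠ φ₃
  cases : ∀ φ, φ = φ₁ ∨ φ = φ₂ ∨ φ = φ₃

variable (F) in
theorem exists_triple : ∃ φ₁ φ₂ φ₃ : Emb F, IsTriple φ₁ φ₂ φ₃ := by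
  classical
  have := card_emb (F := F)
  rw [← Finset.card_univ, Finset.card_eq_three] at this
  obtain ⟨a, b, c, hab, hac, hbc, h⟩ := this
  refine ⟨a, b, c, hab, hac, hbc, fun φ => ?_⟩
  have h1 : φ ∈ (Finset.univ : Finset (Emb F)) := Finset.mem_univ _
  rw [h] at h1
  simpa using h1

theorem exists_triple_of (φ₁ : Emb F) : ∃ φ₂ φ₃ : Emb F, IsTriple φ₁ φ₂ φ₃ := by
  obtain ⟨a, b, c, h⟩ := exists_triple F
  rcases h.cases φ₁ with rfl | rfl | rfl
  · exact ⟨b, c, h⟩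
  · exact ⟨a, c, h.ne₁₂.symm, h.ne₂₃, h.ne₁₃, fun φ => by have := h.cases φ; tauto⟩
  · exact ⟨a, b, h.ne₁₃.symm, h.ne₂₃.symm, h.ne₁₂, fun φ => by have := h.cases φ; tauto⟩

theorem exists_triple_of_ne {φ₁ φ₂ : Emb F} (hne : φ₁ ≠ φ₂) : ∃ φ₃ : Emb F, IsTriple φ₁ φ₂ φ₃ := by
  obtain ⟨b, c, h⟩ := exists_triple_of φ₁
  rcases h.cases φ₂ with rfl | rfl | rfl
  · exact absurd rfl hne
  · exact ⟨c, h⟩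
  · exact ⟨b, h.ne₁₃, h.ne₁₂, h.ne₂₃.symm, fun φ => by have := h.cases φ; tauto⟩

theorem IsTriple.prod {φ₁ φ₂ φ₃ : Emb F} (h : IsTriple φ₁ φ₂ φ₃) {M : Type*} [CommMonoid M]
    (g : Emb F → M) : ∏ φ, g φ = g φ₁ * g φ₂ * g φ₃ := by
  classical
  have hu : (Finset.univ : Finset (Emb F)) = insert φ₁ (insert φ₂ {φ₃}) := by
    ext φ; simpa using h.cases φ
  rw [hu, Finset.prod_insert (by simp [h.ne₁₂, h.ne₁₃]), Finset.prod_insert (by simp [h.ne₂₃]),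
    Finset.prod_singleton, mul_assoc]

theorem IsTriple.sum {φ₁ φ₂ φ₃ : Emb F} (h : IsTriple φ₁ φ₂ φ₃) {M : Type*} [AddCommMonoid M]
    (g : Emb F → M) : ∑ φ, g φ = g φ₁ + g φ₂ + g φ₃ := by
  classical
  have hu : (Finset.univ : Finset (Emb F)) = insert φ₁ (insert φ₂ {φ₃}) := by
    ext φ; simpa using h.cases φ
  rw [hu, Finset.sum_insert (by simp [h.ne₁₂, h.ne₁₃]), Finset.sum_insert (by simp [h.ne₂₃]),
    Finset.sum_singleton, add_assoc]

/-- The factorization of `F` over the algebraic closure. -/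
theorem map_eq_prod_emb :
    F.map (algebraMap K (AlgebraicClosure K)) = ∏ φ : Emb F, (X - C φ.rt) := by
  have hmon : (∏ φ : Emb F, (X - C φ.rt)).Monic := monic_prod_of_monic _ _ fun φ _ => monic_X_sub_C _
  have hdvd : ∏ φ : Emb F, (X - C φ.rt) ∣ F.map (algebraMap K (AlgebraicClosure K)) := by
    refine Finset.prod_dvd_of_coprime (fun φ _ ψ _ h => ?_) fun φ _ => ?_
    · exact isCoprime_X_sub_C_of_isUnit_sub (sub_ne_zero.mpr (Emb.rt_injective.ne h)).isUnit
    · rw [dvd_iff_isRoot, IsRoot, eval_map_algebraMap, Emb.aeval_rt]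
  refine (eq_of_monic_of_dvd_of_natDegree_le hmon (hF.monic.map _) hdvd ?_)
  rw [natDegree_map, hF.natDegree_eq, natDegree_prod_of_monic _ _ fun φ _ => monic_X_sub_C _]
  simp [card_emb]

theorem eval_eq_prod_emb (x : AlgebraicClosure K) :
    aeval x F = ∏ φ : Emb F, (x - φ.rt) := by
  rw [← eval_map_algebraMap, map_eq_prod_emb, eval_prod]
  simp

theorem coeff_three : F.coeff 3 = 1 := by
  have := hF.monic.coeff_natDegree
  rwa [hF.natDegree_eq] at this

theorem aeval_cubic (x : AlgebraicClosure K) :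
    aeval x F = x ^ 3 + algebraMap K _ (F.coeff 2) * x ^ 2 + algebraMap K _ (F.coeff 1) * x +
      algebraMap K _ (F.coeff 0) := by
  rw [aeval_eq_sum_range, hF.natDegree_eq]
  simp [Finset.sum_range_succ, coeff_three, Algebra.smul_def]
  ring

/-- The coefficients of `F` in terms of its roots. -/
theorem IsTriple.coeff {φ₁ φ₂ φ₃ : Emb F} (h : IsTriple φ₁ φ₂ φ₃) :
    algebraMap K (AlgebraicClosure K) (F.coeff 2) = -(φ₁.rt + φ₂.rt + φ₃.rt) ∧
    algebraMap K (AlgebraicClosure K) (F.coeff 1) =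
      φ₁.rt * φ₂.rt + φ₁.rt * φ₃.rt + φ₂.rt * φ₃.rt ∧
    algebraMap K (AlgebraicClosure K) (F.coeff 0) = -(φ₁.rt * φ₂.rt * φ₃.rt) := by
  have key : ∀ x, _ := fun x => (aeval_cubic (F := F) x).symm.trans (eval_eq_prod_emb x)
  simp only [h.prod] at key
  -- Evaluation at 0, 1 and -1 suffices to separate the three lower coefficients.
  have h0 := key 0
  have h1 := key 1
  have h2 := key (-1)
  refine ⟨?_, ?_, ?_⟩
  · linear_combination (h1 + h2 - 2 * h0) / 2
  · linear_combination (h1 - h2) / 2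
  · linear_combination h0

end Embeddings

section CurvePoints

open scoped Classical

open WeierstrassCurve.Affine

/-! ### The group law on `y² = F(x)` -/

variable {K : Type*} [Field K] {F : K[X]} {L : Type*} [Field L] [Algebra K L]

theorem cubicCurve_equation_iff (x y : L) :
    (WeierstrassCurve.baseChange (cubicCurve F) L).toAffine.Equation x y ↔
      y ^ 2 = x ^ 3 + algebraMap K L (F.coeff 2) * x ^ 2 + algebraMap K L (F.coeff 1) * x +
        algebraMap K L (F.coeff 0) := by
  rw [equation_iff]
  simp [cubicCurve, WeierstrassCurve.baseChange]

theorem cubicCurve_nonsingular_iff (x y : L) :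
    (WeierstrassCurve.baseChange (cubicCurve F) L).toAffine.Nonsingular x y ↔
      y ^ 2 = x ^ 3 + algebraMap K L (F.coeff 2) * x ^ 2 + algebraMap K L (F.coeff 1) * x +
        algebraMap K L (F.coeff 0) ∧
      (3 * x ^ 2 + 2 * algebraMap K L (F.coeff 2) * x + algebraMap K L (F.coeff 1) ≠ 0 ∨
        y ≠ -y) := by
  rw [nonsingular_iff, cubicCurve_equation_iff]
  simp [cubicCurve, WeierstrassCurve.baseChange, eq_comm]

theorem cubicCurve_negY (x y : L) :
    (WeierstrassCurve.baseChange (cubicCurve F) L).toAffine.negY x y = -y := by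
  simp [negY, cubicCurve, WeierstrassCurve.baseChange]

/-- The slope enters through the equation it satisfies and not as a quotient, so that explicit
slopes can be supplied and verified by polynomial identities. The doubling formula below has the
same form. -/
theorem cubicCurve_add {x₁ y₁ x₂ y₂ x₃ y₃ : L} (ℓ : L)
    {h₁ : (WeierstrassCurve.baseChange (cubicCurve F) L).toAffine.Nonsingular x₁ y₁}
    {h₂ : (WeierstrassCurve.baseChange (cubicCurve F) L).toAffine.Nonsingular x₂ y₂}
    {h₃ : (WeierstrassCurve.baseChange (cubicCurve F) L).toAffine.Nonsingular x₃ y₃}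
    (hx : x₁ ≠ x₂) (hℓ : ℓ * (x₁ - x₂) = y₁ - y₂)
    (hx₃ : x₃ = ℓ ^ 2 - algebraMap K L (F.coeff 2) - x₁ - x₂) (hy₃ : y₃ = -(ℓ * (x₃ - x₁) + y₁)) :
    (Point.some x₁ y₁ h₁ + Point.some x₂ y₂ h₂ : Pts (cubicCurve F) L) = Point.some x₃ y₃ h₃ := by
  have hs : (WeierstrassCurve.baseChange (cubicCurve F) L).toAffine.slope x₁ x₂ y₁ y₂ = ℓ := by
    rw [slope_of_X_ne hx, div_eq_iff (sub_ne_zero.mpr hx), hℓ]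
  have hX : (WeierstrassCurve.baseChange (cubicCurve F) L).toAffine.addX x₁ x₂ ℓ = x₃ := by
    rw [hx₃]; simp [addX, cubicCurve, WeierstrassCurve.baseChange]
  have hY : (WeierstrassCurve.baseChange (cubicCurve F) L).toAffine.addY x₁ x₂ y₁ ℓ = y₃ := by
    rw [addY, cubicCurve_negY, negAddY, hX, hy₃]
  rw [Point.add_of_X_ne hx]
  simp only [hs, hX, hY]

theorem cubicCurve_double {x₁ y₁ x₃ y₃ : L} (ℓ : L)
    {h₁ : (WeierstrassCurve.baseChange (cubicCurve F) L).toAffine.Nonsingular x₁ y₁}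
    {h₃ : (WeierstrassCurve.baseChange (cubicCurve F) L).toAffine.Nonsingular x₃ y₃}
    (hy : 2 * y₁ ≠ 0) (hℓ : ℓ * (2 * y₁) =
      3 * x₁ ^ 2 + 2 * algebraMap K L (F.coeff 2) * x₁ + algebraMap K L (F.coeff 1))
    (hx₃ : x₃ = ℓ ^ 2 - algebraMap K L (F.coeff 2) - 2 * x₁) (hy₃ : y₃ = -(ℓ * (x₃ - x₁) + y₁)) :
    (2 • Point.some x₁ y₁ h₁ : Pts (cubicCurve F) L) = Point.some x₃ y₃ h₃ := by
  have hy' : y₁ ≠ (WeierstrassCurve.baseChange (cubicCurve F) L).toAffine.negY x₁ y₁ := by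
    rw [cubicCurve_negY]; intro h; apply hy; linear_combination h
  have hs : (WeierstrassCurve.baseChange (cubicCurve F) L).toAffine.slope x₁ x₁ y₁ y₁ = ℓ := by
    rw [slope_of_Y_ne rfl hy', div_eq_iff (sub_ne_zero.mpr hy'), cubicCurve_negY]
    have : ℓ * (y₁ - -y₁) = ℓ * (2 * y₁) := by ring
    rw [this, hℓ]; simp [cubicCurve, WeierstrassCurve.baseChange]
  have hX : (WeierstrassCurve.baseChange (cubicCurve F) L).toAffine.addX x₁ x₁ ℓ = x₃ := by
    rw [hx₃]; simp [addX, cubicCurve, WeierstrassCurve.baseChange]; ring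
  have hY : (WeierstrassCurve.baseChange (cubicCurve F) L).toAffine.addY x₁ x₁ y₁ ℓ = y₃ := by
    rw [addY, cubicCurve_negY, negAddY, hX, hy₃]
  rw [two_nsmul, Point.add_self_of_Y_ne hy']
  simp only [hs, hX, hY]

theorem two_nsmul_some_eq_zero_iff [NeZero (2 : L)] {x y : L}
    {h : (WeierstrassCurve.baseChange (cubicCurve F) L).toAffine.Nonsingular x y} :
    (2 • Point.some x y h : Pts (cubicCurve F) L) = 0 ↔ y = 0 := by
  rw [two_nsmul, add_eq_zero_iff_eq_neg, Point.neg_some, Point.some.injEq, cubicCurve_negY]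
  constructor
  · rintro ⟨-, h⟩
    have : 2 * y = 0 := by linear_combination h
    simpa [NeZero.ne (2 : L)] using this
  · rintro rfl; simp

end CurvePoints

section WeilPairing

open scoped Classical

open WeierstrassCurve.Affine

/-! ### The Weil pairing -/

variable {K : Type*} [Field K] [CharZero K] {F : K[X]} [hF : IsSquarefreeCubic F]

/-- Where y = 0, x is a root and F'(x) is a product of differences of distinct roots; elsewhere y ≠
-y in characteristic zero. -/
theorem cubicCurve_nonsingular_of_equation {x y : AlgebraicClosure K}
    (h : y ^ 2 = ∏ φ : Emb F, (x - φ.rt)) :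
    (WeierstrassCurve.baseChange (cubicCurve F) (AlgebraicClosure K)).toAffine.Nonsingular x y := by
  rw [cubicCurve_nonsingular_iff, ← aeval_cubic, eval_eq_prod_emb]
  refine ⟨h, ?_⟩
  by_cases hy : y = 0
  · left
    rw [hy, zero_pow two_ne_zero, eq_comm, Finset.prod_eq_zero_iff] at h
    obtain ⟨φ₁, -, h1⟩ := h
    obtain ⟨φ₂, φ₃, ht⟩ := exists_triple_of φ₁
    rw [ht.coeff.1, ht.coeff.2.1]
    have : 3 * x ^ 2 + 2 * -(φ₁.rt + φ₂.rt + φ₃.rt) * x +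
        (φ₁.rt * φ₂.rt + φ₁.rt * φ₃.rt + φ₂.rt * φ₃.rt) = (φ₁.rt - φ₂.rt) * (φ₁.rt - φ₃.rt) := by
      rw [sub_eq_zero.mp h1]; ring
    rw [this]
    exact mul_ne_zero (sub_ne_zero.mpr (Emb.rt_injective.ne ht.ne₁₂))
      (sub_ne_zero.mpr (Emb.rt_injective.ne ht.ne₁₃))
  · right
    intro h
    exact hy (by linear_combination h / 2)

theorem cubicCurve_eq_prod {x y : AlgebraicClosure K}
    (h : (WeierstrassCurve.baseChange (cubicCurve F) (AlgebraicClosure K)).toAffine.Nonsingular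
      x y) : y ^ 2 = ∏ φ : Emb F, (x - φ.rt) := by
  rw [← eval_eq_prod_emb, aeval_cubic]
  exact (cubicCurve_equation_iff x y).mp h.1

/-- The `2`-torsion point attached to an embedding. -/
noncomputable def torsionPoint (φ : Emb F) : Pts (cubicCurve F) (AlgebraicClosure K) :=
  Point.some φ.rt 0 <| cubicCurve_nonsingular_of_equation <| by
    rw [Finset.prod_eq_zero (Finset.mem_univ φ) (sub_self _)]; ring

theorem two_nsmul_torsionPoint (φ : Emb F) : 2 • torsionPoint φ = 0 :=
  two_nsmul_some_eq_zero_iff.mpr rfl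

theorem eq_torsionPoint_of_two_nsmul {S : Pts (cubicCurve F) (AlgebraicClosure K)}
    (h : 2 • S = 0) : S = 0 ∨ ∃ φ, S = torsionPoint φ := by
  rcases S with _ | ⟨x, y, hxy⟩
  · exact Or.inl rfl
  · right
    obtain rfl := two_nsmul_some_eq_zero_iff.mp h
    have := cubicCurve_eq_prod hxy
    rw [zero_pow two_ne_zero, eq_comm, Finset.prod_eq_zero_iff] at this
    obtain ⟨φ, -, h1⟩ := this
    obtain rfl := sub_eq_zero.mp h1
    exact ⟨φ, rfl⟩

theorem weilPairing_zero (φ : Emb F) :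
    weilPairing F (0 : Pts (cubicCurve F) (AlgebraicClosure K)) φ = 1 := rfl

theorem weilPairing_torsionPoint (ψ φ : Emb F) :
    weilPairing F (torsionPoint ψ) φ = if ψ = φ then 1 else -1 := by
  have : (ψ.rt = φ.rt) = (ψ = φ) := by rw [Emb.rt_injective.eq_iff]
  simp only [weilPairing, torsionPoint]
  exact if_congr (iff_of_eq this) rfl rfl

theorem weilPairing_neg (S : Pts (cubicCurve F) (AlgebraicClosure K)) (φ : Emb F) :
    weilPairing F (-S) φ = weilPairing F S φ := by
  rcases S with _ | ⟨x, y, h⟩ <;> rfl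

theorem weilPairing_eq_or (S : Pts (cubicCurve F) (AlgebraicClosure K)) (φ : Emb F) :
    weilPairing F S φ = 1 ∨ weilPairing F S φ = -1 := by
  rcases S with _ | ⟨x, y, h⟩
  · exact Or.inl rfl
  · simp only [weilPairing]
    split_ifs <;> simp

theorem weilPairing_mul_self (S : Pts (cubicCurve F) (AlgebraicClosure K)) (φ : Emb F) :
    weilPairing F S φ * weilPairing F S φ = 1 := by
  rcases weilPairing_eq_or S φ with h | h <;> rw [h] <;> ring

/-- The line through the two points is y = 0, which meets the curve again at the third root. -/
theorem torsionPoint_add {φ₁ φ₂ φ₃ : Emb F} (h : IsTriple φ₁ φ₂ φ₃) :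
    torsionPoint φ₁ + torsionPoint φ₂ = torsionPoint φ₃ := by
  refine cubicCurve_add 0 (Emb.rt_injective.ne h.ne₁₂) (by ring) ?_ (by ring)
  rw [h.coeff.1]; ring

theorem weilPairing_add {S S' : Pts (cubicCurve F) (AlgebraicClosure K)} (h : 2 • S = 0)
    (h' : 2 • S' = 0) (φ : Emb F) :
    weilPairing F (S + S') φ = weilPairing F S φ * weilPairing F S' φ := by
  rcases eq_torsionPoint_of_two_nsmul h with rfl | ⟨ψ, rfl⟩
  · rw [zero_add, weilPairing_zero, one_mul]
  rcases eq_torsionPoint_of_two_nsmul h' with rfl | ⟨χ, rfl⟩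
  · rw [add_zero, weilPairing_zero, mul_one]
  by_cases hne : ψ = χ
  · subst hne
    rw [← two_nsmul, h, weilPairing_mul_self, weilPairing_zero]
  · obtain ⟨ω, ht⟩ := exists_triple_of_ne hne
    rw [torsionPoint_add ht]
    simp only [weilPairing_torsionPoint]
    have h1 := ht.ne₁₂
    have h2 := ht.ne₁₃
    have h3 := ht.ne₂₃
    rcases ht.cases φ with rfl | rfl | rfl
    · simp [h1.symm, h2.symm]
    · simp [h1, h3.symm]
    · simp [h2, h3]

/-- Nondegeneracy: by bilinearity S + S' pairs trivially with everything, whereas `torsionPoint ψ`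
pairs to -1 with each embedding other than ψ. -/
theorem weilPairing_injective {S S' : Pts (cubicCurve F) (AlgebraicClosure K)} (h : 2 • S = 0)
    (h' : 2 • S' = 0) (he : ∀ φ : Emb F, weilPairing F S φ = weilPairing F S' φ) : S = S' := by
  have hz : ∀ ψ : Emb F, ∃ φ, weilPairing F (torsionPoint ψ) φ ≠ 1 := fun ψ => by
    obtain ⟨χ, ω, ht⟩ := exists_triple_of ψ
    refine ⟨χ, ?_⟩
    rw [weilPairing_torsionPoint, if_neg ht.ne₁₂]
    norm_num
  have : S + S' = 0 := by
    rcases eq_torsionPoint_of_two_nsmul (S := S + S') (by rw [nsmul_add, h, h', add_zero]) with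
      h0 | ⟨ψ, hψ⟩
    · exact h0
    · obtain ⟨φ, hφ⟩ := hz ψ
      rw [← hψ, weilPairing_add h h', he, weilPairing_mul_self] at hφ
      exact absurd rfl hφ
  rw [add_eq_zero_iff_eq_neg.mp this, neg_eq_iff_add_eq_zero, ← two_nsmul, h']

/-- Three signs with product 1, not all trivial, contain exactly one 1; its position names the
torsion point. -/
theorem weilPairing_surjective (ε : Emb F → AlgebraicClosure K) (h1 : ∀ φ, ε φ ^ 2 = 1)
    (h2 : ∏ φ, ε φ = 1) : ∃ S : Pts (cubicCurve F) (AlgebraicClosure K),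
      2 • S = 0 ∧ ∀ φ : Emb F, weilPairing F S φ = ε φ := by
  by_cases h : ∀ φ, ε φ = 1
  · exact ⟨0, nsmul_zero 2, fun φ => by rw [h, weilPairing_zero]⟩
  push Not at h
  obtain ⟨ψ, hψ⟩ := h
  have hψ' : ε ψ = -1 := (sq_eq_one_iff.mp (h1 ψ)).resolve_left hψ
  obtain ⟨χ, ω, ht⟩ := exists_triple_of ψ
  rw [ht.prod, hψ'] at h2
  rcases sq_eq_one_iff.mp (h1 χ) with hχ | hχ
  · refine ⟨torsionPoint χ, two_nsmul_torsionPoint χ, fun φ => ?_⟩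
    rw [weilPairing_torsionPoint]
    rw [hχ] at h2
    have hω : ε ω = -1 := by linear_combination -h2
    rcases ht.cases φ with rfl | rfl | rfl
    · rw [if_neg ht.ne₁₂.symm, hψ']
    · rw [if_pos rfl, hχ]
    · rw [if_neg ht.ne₂₃, hω]
  · refine ⟨torsionPoint ω, two_nsmul_torsionPoint ω, fun φ => ?_⟩
    rw [weilPairing_torsionPoint]
    rw [hχ] at h2
    have hω : ε ω = 1 := by linear_combination h2
    rcases ht.cases φ with rfl | rfl | rfl
    · rw [if_neg ht.ne₁₃.symm, hψ']
    · rw [if_neg ht.ne₂₃.symm, hχ]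
    · rw [if_pos rfl, hω]

theorem prod_weilPairing {S : Pts (cubicCurve F) (AlgebraicClosure K)} (h : 2 • S = 0) :
    ∏ φ : Emb F, weilPairing F S φ = 1 := by
  rcases eq_torsionPoint_of_two_nsmul h with rfl | ⟨ψ, rfl⟩
  · simp [weilPairing_zero]
  · obtain ⟨χ, ω, ht⟩ := exists_triple_of ψ
    rw [ht.prod]
    simp [weilPairing_torsionPoint, ht.ne₁₂, ht.ne₁₃]

/-- The Galois action on points over the algebraic closure. -/
noncomputable abbrev galPt (σ : AlgebraicClosure K ≃ₐ[K] AlgebraicClosure K) :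
    Pts (cubicCurve F) (AlgebraicClosure K) →+ Pts (cubicCurve F) (AlgebraicClosure K) :=
  Point.map (W' := cubicCurve F) (σ : AlgebraicClosure K →ₐ[K] AlgebraicClosure K)

theorem weilPairing_galPt (σ : AlgebraicClosure K ≃ₐ[K] AlgebraicClosure K)
    (S : Pts (cubicCurve F) (AlgebraicClosure K)) (φ : Emb F) :
    weilPairing F (galPt σ S) (Emb.act σ φ) = weilPairing F S φ := by
  rcases S with _ | ⟨x, y, h⟩
  · rfl
  · simp only [weilPairing, galPt, Point.map_some]
    refine if_congr ?_ rfl rfl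
    exact σ.injective.eq_iff

/-- A point fixed by the Galois group is rational. -/
theorem exists_baseChange_eq {Q : Pts (cubicCurve F) (AlgebraicClosure K)}
    (h : ∀ σ, galPt σ Q = Q) :
    ∃ P : Pts (cubicCurve F) K,
      Point.baseChange (W' := cubicCurve F) K (AlgebraicClosure K) P = Q := by
  rcases Q with _ | ⟨x, y, hxy⟩
  · exact ⟨0, rfl⟩
  · have hfix : ∀ σ : AlgebraicClosure K ≃ₐ[K] AlgebraicClosure K, σ x = x ∧ σ y = y := fun σ => by
      have := h σ
      simp only [galPt, Point.map_some, Point.some.injEq] at this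
      exact this
    obtain ⟨x, rfl⟩ := (InfiniteGalois.mem_range_algebraMap_iff_fixed x).mpr fun σ => (hfix σ).1
    obtain ⟨y, rfl⟩ := (InfiniteGalois.mem_range_algebraMap_iff_fixed y).mpr fun σ => (hfix σ).2
    refine ⟨Point.some x y ?_, rfl⟩
    exact (baseChange_nonsingular (cubicCurve F) (f := Algebra.ofId K (AlgebraicClosure K))
      (RingHom.injective _) x y).mp hxy

end WeilPairing

section KummerMap

open scoped Classical

open WeierstrassCurve.Affine

/-! ### The Kummer map -/

variable {K : Type*} [Field K] [CharZero K] {F : K[X]} [hF : IsSquarefreeCubic F]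

variable (F) in
/-- The inclusion `E(K) → E(K̄)`. -/
noncomputable abbrev toClosure : Pts (cubicCurve F) K →+ Pts (cubicCurve F) (AlgebraicClosure K) :=
  Point.baseChange (W' := cubicCurve F) K (AlgebraicClosure K)

theorem toClosure_injective : Function.Injective (toClosure F) :=
  Point.map_injective _

theorem galPt_toClosure (σ : AlgebraicClosure K ≃ₐ[K] AlgebraicClosure K)
    (P : Pts (cubicCurve F) K) : galPt σ (toClosure F P) = toClosure F P := by
  rcases P with _ | ⟨x, y, h⟩
  · rfl
  · have : ∀ z : K, σ (Algebra.ofId K (AlgebraicClosure K) z) =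
        Algebra.ofId K (AlgebraicClosure K) z := fun z => σ.commutes z
    simp only [toClosure, galPt, Point.baseChange, Point.map_some, Point.some.injEq]
    exact ⟨this x, this y⟩

theorem kummerCocycle_eq (Q : Pts (cubicCurve F) (AlgebraicClosure K))
    (σ : AlgebraicClosure K ≃ₐ[K] AlgebraicClosure K) :
    kummerCocycle Q σ = galPt σ Q - Q := rfl

theorem two_nsmul_kummerCocycle {Q : Pts (cubicCurve F) (AlgebraicClosure K)}
    {P : Pts (cubicCurve F) K} (h : 2 • Q = toClosure F P)
    (σ : AlgebraicClosure K ≃ₐ[K] AlgebraicClosure K) : 2 • kummerCocycle Q σ = 0 := by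
  rw [kummerCocycle_eq, nsmul_sub, ← map_nsmul, h, galPt_toClosure, sub_self]

theorem IsKummerValue.add {P P' : Pts (cubicCurve F) K} {a a' : ModSquares (AdjoinRoot F)}
    (h : IsKummerValue F P a) (h' : IsKummerValue F P' a') :
    IsKummerValue F (P + P') (a * a') := by
  obtain ⟨Q, hQ, α, rfl, β, hβ, hc⟩ := h
  obtain ⟨Q', hQ', α', rfl, β', hβ', hc'⟩ := h'
  refine ⟨Q + Q', by rw [nsmul_add, hQ, hQ', map_add], α * α', rfl, fun φ => β φ * β' φ,
    fun φ => by rw [mul_pow, hβ, hβ', Units.val_mul, map_mul], fun σ φ => ?_⟩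
  have : kummerCocycle (Q + Q') σ = kummerCocycle Q σ + kummerCocycle Q' σ := by
    simp only [kummerCocycle_eq, map_add]; abel
  rw [this, weilPairing_add (two_nsmul_kummerCocycle hQ σ) (two_nsmul_kummerCocycle hQ' σ),
    map_mul, hc, hc']
  ring

theorem IsKummerValue.neg {P : Pts (cubicCurve F) K} {a : ModSquares (AdjoinRoot F)}
    (h : IsKummerValue F P a) : IsKummerValue F (-P) a := by
  obtain ⟨Q, hQ, α, rfl, β, hβ, hc⟩ := h
  refine ⟨-Q, by rw [smul_neg, hQ, map_neg], α, rfl, β, hβ, fun σ φ => ?_⟩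
  have : kummerCocycle (-Q) σ = -kummerCocycle Q σ := by
    simp only [kummerCocycle_eq, map_neg]; abel
  rw [this, weilPairing_neg, hc]

theorem modSquares_mul_self {M : Type*} [CommMonoid M] (a : ModSquares M) : a * a = 1 := by
  induction a using QuotientGroup.induction_on with
  | H u => exact (QuotientGroup.eq_one_iff (u * u)).mpr ⟨u, by simp [sq]⟩

theorem modSquares_coe_eq_one_iff {M : Type*} [CommMonoid M] (u : Mˣ) :
    (u : ModSquares M) = 1 ↔ ∃ w : Mˣ, w ^ 2 = u :=
  QuotientGroup.eq_one_iff u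

/-- A half Q of 0 is itself 2-torsion, so its cocycle is a coboundary: multiplying β by the pairing
with Q gives an equivariant square root of α, which descends to the algebra. -/
theorem IsKummerValue.eq_one {a : ModSquares (AdjoinRoot F)} (h : IsKummerValue F 0 a) :
    a = 1 := by
  obtain ⟨Q, hQ, α, rfl, β, hβ, hc⟩ := h
  have hQ0 : 2 • Q = 0 := by rw [hQ]; exact map_zero (toClosure F)
  have hne : ∀ φ, β φ ≠ 0 := fun φ h0 => by
    have := hβ φ
    rw [h0, zero_pow two_ne_zero] at this
    exact (α.isUnit.map φ).ne_zero this.symm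
  obtain ⟨w, hw⟩ := Emb.descent_units (fun φ : Emb F => weilPairing F Q φ * β φ)
    (fun σ φ => by
      have h1 : galPt σ Q = kummerCocycle Q σ + Q := by rw [kummerCocycle_eq]; abel
      have h2 := weilPairing_add (two_nsmul_kummerCocycle hQ σ) hQ0 (Emb.act σ φ)
      rw [← h1] at h2
      rw [weilPairing_galPt] at h2
      have h3 : σ (weilPairing F Q φ) = weilPairing F Q φ := by
        rcases weilPairing_eq_or Q φ with h | h <;> simp [h]
      have h4 : σ (β φ) = weilPairing F (kummerCocycle Q σ) (Emb.act σ φ) * β (Emb.act σ φ) :=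
        hc σ φ
      rw [map_mul, h3, h4, h2]
      linear_combination (weilPairing F Q (Emb.act σ φ) * β (Emb.act σ φ)) *
        weilPairing_mul_self (kummerCocycle Q σ) (Emb.act σ φ))
    (fun φ => mul_ne_zero (fun h => by
      have := weilPairing_mul_self Q φ
      rw [h] at this; norm_num at this) (hne φ))
  rw [modSquares_coe_eq_one_iff]
  refine ⟨w, Units.ext (Emb.ext_elem fun φ => ?_)⟩
  rw [Units.val_pow_eq_pow_val, map_pow, hw, mul_pow, hβ, sq, weilPairing_mul_self, one_mul]

theorem IsKummerValue.unique {P : Pts (cubicCurve F) K} {a a' : ModSquares (AdjoinRoot F)}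
    (h : IsKummerValue F P a) (h' : IsKummerValue F P a') : a = a' := by
  have := h.add h'.neg
  rw [add_neg_cancel] at this
  rw [← mul_one a, ← modSquares_mul_self a', ← mul_assoc, this.eq_one, one_mul]

theorem isKummerValue_zero : IsKummerValue F 0 1 := by
  refine ⟨0, by rw [nsmul_zero]; exact (map_zero (toClosure F)).symm, 1, rfl, fun _ => 1,
    fun φ => by simp, fun σ φ => ?_⟩
  rw [kummerCocycle_eq, map_zero, sub_zero, weilPairing_zero, map_one, one_mul]

/-- A point with trivial Kummer class is divisible by `2`. -/
theorem IsKummerValue.exists_two_nsmul {P : Pts (cubicCurve F) K} (h : IsKummerValue F P 1) :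
    ∃ R, 2 • R = P := by
  obtain ⟨Q, hQ, α, hα, β, hβ, hc⟩ := h
  obtain ⟨w, hw⟩ := (modSquares_coe_eq_one_iff α).mp hα
  have hw0 : ∀ φ : Emb F, φ (w : AdjoinRoot F) ≠ 0 := fun φ => (w.isUnit.map φ).ne_zero
  have hsq : ∀ φ : Emb F, (β φ / φ (w : AdjoinRoot F)) ^ 2 = 1 := fun φ => by
    rw [div_pow, hβ, ← hw, Units.val_pow_eq_pow_val, map_pow, div_self (pow_ne_zero 2 (hw0 φ))]
  -- The number of embeddings is odd, so a global sign s can correct the product of the quotients to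
  -- 1, as surjectivity of the pairing requires.
  obtain ⟨s, hs, hS⟩ : ∃ s : AlgebraicClosure K, (s = 1 ∨ s = -1) ∧
      ∏ φ : Emb F, s * (β φ / φ (w : AdjoinRoot F)) = 1 := by
    have h1 : (∏ φ : Emb F, β φ / φ (w : AdjoinRoot F)) ^ 2 = 1 := by
      rw [← Finset.prod_pow]; exact Finset.prod_eq_one fun φ _ => hsq φ
    rcases sq_eq_one_iff.mp h1 with h | h
    · exact ⟨1, Or.inl rfl, by simpa using h⟩
    · refine ⟨-1, Or.inr rfl, ?_⟩
      rw [Finset.prod_mul_distrib, h, Finset.prod_const, Finset.card_univ, card_emb]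
      norm_num
  have hs2 : s ^ 2 = 1 := by rcases hs with rfl | rfl <;> norm_num
  obtain ⟨S, hS2, hSε⟩ := weilPairing_surjective (fun φ : Emb F => s * (β φ / φ (w : AdjoinRoot F)))
    (fun φ => by rw [mul_pow, hs2, hsq, one_mul]) hS
  -- The coboundary of S is the Kummer cocycle of Q, so Q - S is a rational half of P.
  have hfix : ∀ σ, galPt σ (Q - S) = Q - S := fun σ => by
    have key : galPt σ S = kummerCocycle Q σ + S := by
      refine weilPairing_injective (by rw [← map_nsmul, hS2, map_zero])
        (by rw [nsmul_add, hS2, two_nsmul_kummerCocycle hQ, add_zero]) fun φ => ?_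
      obtain ⟨ψ, rfl⟩ := (Emb.actEquiv σ).surjective φ
      change weilPairing F (galPt σ S) (Emb.act σ ψ) = weilPairing F _ (Emb.act σ ψ)
      rw [weilPairing_add (two_nsmul_kummerCocycle hQ σ) hS2, weilPairing_galPt]
      have h3 : σ (weilPairing F S ψ) = weilPairing F S ψ := by
        rcases weilPairing_eq_or S ψ with h | h <;> simp [h]
      have h4 : σ (β ψ) = weilPairing F (kummerCocycle Q σ) (Emb.act σ ψ) * β (Emb.act σ ψ) :=
        hc σ ψ
      have h5 : σ s = s := by rcases hs with rfl | rfl <;> simp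
      rw [← h3, hSε, hSε, map_mul, map_div₀, h4, h5, Emb.act_apply]
      ring
    rw [map_sub, key, kummerCocycle_eq]; abel
  obtain ⟨R, hR⟩ := exists_baseChange_eq hfix
  refine ⟨R, toClosure_injective ?_⟩
  rw [map_nsmul, ← hQ]
  change 2 • Point.baseChange (W' := cubicCurve F) K (AlgebraicClosure K) R = _
  rw [hR, nsmul_sub, hS2, sub_zero]

/-- The Kummer classes have square norm. -/
theorem IsKummerValue.mem_squareNorm {P : Pts (cubicCurve F) K} {a : ModSquares (AdjoinRoot F)}
    (h : IsKummerValue F P a) : a ∈ squareNorm F := by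
  obtain ⟨Q, hQ, α, rfl, β, hβ, hc⟩ := h
  -- The product of the β φ squares to the norm of α, and it is rational because the pairings of a
  -- 2-torsion point multiply to 1.
  obtain ⟨n, hn⟩ := (InfiniteGalois.mem_range_algebraMap_iff_fixed (k := K) (∏ φ, β φ)).mpr
    fun σ => by
      rw [map_prod, ← Equiv.prod_comp (Emb.actEquiv σ) β]
      have : ∀ φ : Emb F, σ (β φ) = weilPairing F (kummerCocycle Q σ) (Emb.actEquiv σ φ) *
        β (Emb.actEquiv σ φ) := hc σ
      simp only [this]
      rw [Finset.prod_mul_distrib, Equiv.prod_comp (Emb.actEquiv σ)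
        (fun φ => weilPairing F (kummerCocycle Q σ) φ),
        prod_weilPairing (two_nsmul_kummerCocycle hQ σ), one_mul]
  have hn2 : n ^ 2 = Algebra.norm K (α : AdjoinRoot F) := by
    apply (algebraMap K (AlgebraicClosure K)).injective
    rw [map_pow, hn, Emb.norm_eq_prod, ← Finset.prod_pow]
    exact Finset.prod_congr rfl fun φ _ => hβ φ
  have hu : IsUnit n := by
    rw [← isUnit_pow_iff two_ne_zero, hn2]; exact α.isUnit.map _
  change ModSquares.map _ (α : ModSquares (AdjoinRoot F)) = 1
  refine (modSquares_coe_eq_one_iff _).mpr ⟨hu.unit, Units.ext ?_⟩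
  simpa using hn2

/-! ### Halving points -/

/-- Halving a point `(x, y)` given square roots of the `x - φ(T)` with product `y`: only the sum `s`
of these square roots enters the coordinates. -/
theorem half_nonsingular {x y : AlgebraicClosure K} {r : Emb F → AlgebraicClosure K}
    (hr : ∀ φ, r φ ^ 2 = x - φ.rt) (hy : ∏ φ, r φ = y) {X Y : AlgebraicClosure K}
    (hX : X = ((∑ φ, r φ) ^ 2 - x - algebraMap K _ (F.coeff 2)) / 2)
    (hY : Y = (∑ φ, r φ) * (X - x) - y) :
    (WeierstrassCurve.baseChange (cubicCurve F) (AlgebraicClosure K)).toAffine.Nonsingular X Y := by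
  obtain ⟨φ₁, φ₂, φ₃, ht⟩ := exists_triple F
  apply cubicCurve_nonsingular_of_equation
  rw [ht.sum] at hX hY
  rw [ht.coeff.1] at hX
  rw [ht.prod] at hy ⊢
  have h1 := hr φ₁
  have h2 := hr φ₂
  have h3 := hr φ₃
  have e1 : φ₁.rt = x - r φ₁ ^ 2 := by rw [h1]; ring
  have e2 : φ₂.rt = x - r φ₂ ^ 2 := by rw [h2]; ring
  have e3 : φ₃.rt = x - r φ₃ ^ 2 := by rw [h3]; ring
  rw [e1, e2, e3] at hX ⊢
  have hX' : X = x + r φ₁ * r φ₂ + r φ₁ * r φ₃ + r φ₂ * r φ₃ := by rw [hX]; ring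
  rw [hY, ← hy, hX']
  ring

/-- In terms of the three roots, X = x + r₁r₂ + r₁r₃ + r₂r₃ and Y = (r₁ + r₂)(r₁ + r₃)(r₂ + r₃),
with tangent slope r₁ + r₂ + r₃. No sum of two roots vanishes, as their squares differ. -/
theorem two_nsmul_half {x y : AlgebraicClosure K} {r : Emb F → AlgebraicClosure K}
    (hr : ∀ φ, r φ ^ 2 = x - φ.rt) (hy : ∏ φ, r φ = y) {X Y : AlgebraicClosure K}
    (hX : X = ((∑ φ, r φ) ^ 2 - x - algebraMap K _ (F.coeff 2)) / 2)
    (hY : Y = (∑ φ, r φ) * (X - x) - y)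
    {hxy : (WeierstrassCurve.baseChange (cubicCurve F) (AlgebraicClosure K)).toAffine.Nonsingular
      x y} :
    (2 • Point.some X Y (half_nonsingular hr hy hX hY) :
      Pts (cubicCurve F) (AlgebraicClosure K)) = Point.some x y hxy := by
  obtain ⟨φ₁, φ₂, φ₃, ht⟩ := exists_triple F
  have hr' := hr
  have hadd : ∀ {φ ψ : Emb F}, φ ≠ ψ → r φ + r ψ ≠ 0 := fun {φ ψ} hne h0 => by
    apply Emb.rt_injective.ne hne
    have : r φ ^ 2 = r ψ ^ 2 := by rw [eq_neg_of_add_eq_zero_left h0]; ring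
    rw [hr, hr] at this
    linear_combination -this
  have hX1 := hX
  rw [ht.sum, ht.coeff.1] at hX1
  have hY1 := hY
  rw [ht.sum] at hY1
  have hy1 := hy
  rw [ht.prod] at hy1
  have e1 : φ₁.rt = x - r φ₁ ^ 2 := by rw [hr]; ring
  have e2 : φ₂.rt = x - r φ₂ ^ 2 := by rw [hr]; ring
  have e3 : φ₃.rt = x - r φ₃ ^ 2 := by rw [hr]; ring
  rw [e1, e2, e3] at hX1
  have hX' : X = x + r φ₁ * r φ₂ + r φ₁ * r φ₃ + r φ₂ * r φ₃ := by rw [hX1]; ring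
  have hY' : Y = (r φ₁ + r φ₂) * (r φ₁ + r φ₃) * (r φ₂ + r φ₃) := by rw [hY1, ← hy1, hX']; ring
  refine cubicCurve_double (r φ₁ + r φ₂ + r φ₃) ?_ ?_ ?_ ?_
  · rw [hY']
    exact mul_ne_zero two_ne_zero (mul_ne_zero (mul_ne_zero (hadd ht.ne₁₂) (hadd ht.ne₁₃))
      (hadd ht.ne₂₃))
  · rw [ht.coeff.1, ht.coeff.2.1, e1, e2, e3, hY', hX']; ring
  · rw [ht.coeff.1, e1, e2, e3, hX']; ring
  · rw [hY1]; ring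

/-- Pairing with the torsion point at φ₁ negates r₂ and r₃. The chord from the half to that torsion
point has slope r₂ + r₃, and it leads to the half built from the new signs. -/
theorem half_add_torsionPoint {x y : AlgebraicClosure K} {r : Emb F → AlgebraicClosure K}
    (hr : ∀ φ, r φ ^ 2 = x - φ.rt) (hy : ∏ φ, r φ = y) {X Y : AlgebraicClosure K}
    (hX : X = ((∑ φ, r φ) ^ 2 - x - algebraMap K _ (F.coeff 2)) / 2)
    (hY : Y = (∑ φ, r φ) * (X - x) - y)
    {r' : Emb F → AlgebraicClosure K} (hr' : ∀ φ, r' φ ^ 2 = x - φ.rt) (hy' : ∏ φ, r' φ = y)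
    {X' Y' : AlgebraicClosure K}
    (hX' : X' = ((∑ φ, r' φ) ^ 2 - x - algebraMap K _ (F.coeff 2)) / 2)
    (hY' : Y' = (∑ φ, r' φ) * (X' - x) - y)
    {S : Pts (cubicCurve F) (AlgebraicClosure K)} (hS : 2 • S = 0)
    (hrr : ∀ φ, r' φ = weilPairing F S φ * r φ) :
    (Point.some X Y (half_nonsingular hr hy hX hY) + S : Pts (cubicCurve F) (AlgebraicClosure K)) =
      Point.some X' Y' (half_nonsingular hr' hy' hX' hY') := by
  rcases eq_torsionPoint_of_two_nsmul hS with rfl | ⟨φ₁, rfl⟩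
  · simp only [weilPairing_zero, one_mul] at hrr
    obtain rfl : r' = r := funext hrr
    subst hX' hY' hX hY
    rw [add_zero]
  · obtain ⟨φ₂, φ₃, ht⟩ := exists_triple_of φ₁
    have hadd : ∀ {φ ψ : Emb F}, φ ≠ ψ → r φ + r ψ ≠ 0 := fun {φ ψ} hne h0 => by
      apply Emb.rt_injective.ne hne
      have : r φ ^ 2 = r ψ ^ 2 := by rw [eq_neg_of_add_eq_zero_left h0]; ring
      rw [hr, hr] at this
      linear_combination -this
    have h1 : r' φ₁ = r φ₁ := by rw [hrr, weilPairing_torsionPoint, if_pos rfl, one_mul]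
    have h2 : r' φ₂ = -r φ₂ := by rw [hrr, weilPairing_torsionPoint, if_neg ht.ne₁₂]; ring
    have h3 : r' φ₃ = -r φ₃ := by rw [hrr, weilPairing_torsionPoint, if_neg ht.ne₁₃]; ring
    have e1 : φ₁.rt = x - r φ₁ ^ 2 := by rw [hr]; ring
    have e2 : φ₂.rt = x - r φ₂ ^ 2 := by rw [hr]; ring
    have e3 : φ₃.rt = x - r φ₃ ^ 2 := by rw [hr]; ring
    have hXe : X = x + r φ₁ * r φ₂ + r φ₁ * r φ₃ + r φ₂ * r φ₃ := by
      rw [hX, ht.sum, ht.coeff.1, e1, e2, e3]; ring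
    have hXe' : X' = x - r φ₁ * r φ₂ - r φ₁ * r φ₃ + r φ₂ * r φ₃ := by
      rw [hX', ht.sum, ht.coeff.1, e1, e2, e3, h1, h2, h3]; ring
    have hYe : Y = (r φ₁ + r φ₂) * (r φ₁ + r φ₃) * (r φ₂ + r φ₃) := by
      rw [hY, ht.sum, ← hy, ht.prod, hXe]; ring
    have hYe' : Y' = (r φ₁ - r φ₂) * (r φ₁ - r φ₃) * (-r φ₂ - r φ₃) := by
      rw [hY', ht.sum, ← hy', ht.prod, hXe', h1, h2, h3]; ring
    refine cubicCurve_add (r φ₂ + r φ₃) ?_ ?_ ?_ ?_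
    · rw [← sub_ne_zero]
      have : X - φ₁.rt = (r φ₁ + r φ₂) * (r φ₁ + r φ₃) := by rw [hXe, e1]; ring
      rw [this]
      exact mul_ne_zero (hadd ht.ne₁₂) (hadd ht.ne₁₃)
    · rw [hYe, hXe, e1]; ring
    · rw [hXe', hXe, ht.coeff.1, e1, e2, e3]; ring
    · rw [hXe', hXe, hYe, hYe']; ring

/-- Any choice of square roots has product y or -y; negating all three exchanges the two cases. -/
theorem exists_sqrt_family {x y : AlgebraicClosure K} (h : y ^ 2 = ∏ φ : Emb F, (x - φ.rt)) :
    ∃ r : Emb F → AlgebraicClosure K, (∀ φ, r φ ^ 2 = x - φ.rt) ∧ ∏ φ, r φ = y := by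
  choose r hr using fun φ : Emb F => IsAlgClosed.exists_pow_nat_eq (x - φ.rt) two_pos
  have h1 : (∏ φ, r φ) ^ 2 = y ^ 2 := by
    rw [← Finset.prod_pow, h]; exact Finset.prod_congr rfl fun φ _ => hr φ
  rcases sq_eq_sq_iff_eq_or_eq_neg.mp h1 with h | h
  · exact ⟨r, hr, h⟩
  · refine ⟨fun φ => -r φ, fun φ => by rw [neg_sq, hr], ?_⟩
    rw [Finset.prod_neg, h, Finset.card_univ, card_emb]; ring

theorem eval_derivative_of_eq_rt {φ₁ φ₂ φ₃ : Emb F} (ht : IsTriple φ₁ φ₂ φ₃) :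
    aeval φ₁.rt (derivative F) = (φ₁.rt - φ₂.rt) * (φ₁.rt - φ₃.rt) := by
  rw [← eval_map_algebraMap, ← derivative_map, map_eq_prod_emb, ht.prod]
  simp [derivative_mul]

/-- The Kummer class of a point `(x, y)` is the class of `x - T`, modified at the factor where this
vanishes. -/
theorem isKummerValue_some {x y : K}
    (h : (WeierstrassCurve.baseChange (cubicCurve F) K).toAffine.Nonsingular x y)
    {α : (AdjoinRoot F)ˣ}
    (hα : ∀ φ : Emb F, algebraMap K _ x ≠ φ.rt →
      φ (α : AdjoinRoot F) = algebraMap K _ x - φ.rt)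
    (hα' : ∀ φ : Emb F, algebraMap K _ x = φ.rt →
      φ (α : AdjoinRoot F) = aeval φ.rt (derivative F)) :
    IsKummerValue F (Point.some x y h) (α : ModSquares (AdjoinRoot F)) := by
  have hP : ∃ h', toClosure F (Point.some x y h) =
      Point.some (algebraMap K (AlgebraicClosure K) x) (algebraMap K (AlgebraicClosure K) y) h' :=
    ⟨_, rfl⟩
  obtain ⟨h', hP⟩ := hP
  obtain ⟨r, hr, hry⟩ := exists_sqrt_family (cubicCurve_eq_prod h')
  have hr0 : ∀ φ, r φ = 0 ↔ algebraMap K _ x = φ.rt := fun φ => by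
    rw [← sub_eq_zero (b := φ.rt), ← hr, sq_eq_zero_iff]
  -- Where x - φ(T) vanishes, α takes the value F'(x), the product of the two other factors, whose
  -- square root is the product of the two other r ψ.
  set β : Emb F → AlgebraicClosure K := fun φ =>
    if r φ = 0 then ∏ ψ ∈ Finset.univ.erase φ, r ψ else r φ with hβdef
  have herase : ∀ {φ₁ φ₂ φ₃ : Emb F}, IsTriple φ₁ φ₂ φ₃ →
      ∏ ψ ∈ Finset.univ.erase φ₁, r ψ = r φ₂ * r φ₃ := fun {φ₁ φ₂ φ₃} ht => by
    have : (Finset.univ.erase φ₁ : Finset (Emb F)) = insert φ₂ {φ₃} := by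
      ext φ
      have h1 := ht.ne₁₂; have h2 := ht.ne₁₃
      rcases ht.cases φ with rfl | rfl | rfl <;> simp [h1, h2, h1.symm, h2.symm]
    rw [this, Finset.prod_insert (by simp [ht.ne₂₃]), Finset.prod_singleton]
  have hβ : ∀ φ, β φ ^ 2 = φ (α : AdjoinRoot F) := fun φ => by
    by_cases h0 : r φ = 0
    · obtain ⟨φ₂, φ₃, ht⟩ := exists_triple_of φ
      have hx := (hr0 φ).mp h0
      simp only [hβdef, if_pos h0]
      rw [herase ht, hα' φ hx, eval_derivative_of_eq_rt ht, mul_pow, hr, hr, hx]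
    · simp only [hβdef, if_neg h0]
      rw [hr, hα φ (mt (hr0 φ).mpr h0)]
  have hβ0 : ∀ φ, β φ ≠ 0 := fun φ h0 => by
    have := hβ φ
    rw [h0, zero_pow two_ne_zero] at this
    exact (α.isUnit.map φ).ne_zero this.symm
  -- This product is y, or F'(x) when some r φ vanishes. Its rationality makes the signs ε below
  -- multiply to 1.
  have hprod : ∃ c : K, ∏ φ, β φ = algebraMap K _ c := by
    by_cases hz : ∃ φ, r φ = 0
    · obtain ⟨φ, h0⟩ := hz
      obtain ⟨φ₂, φ₃, ht⟩ := exists_triple_of φ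
      have hx := (hr0 φ).mp h0
      have hne : ∀ ψ, φ ≠ ψ → r ψ ≠ 0 := fun ψ hψ h => hψ (Emb.rt_injective (by
        rw [← hx, (hr0 ψ).mp h]))
      refine ⟨(derivative F).eval x, ?_⟩
      rw [ht.prod]
      simp only [hβdef, if_pos h0, if_neg (hne _ ht.ne₁₂), if_neg (hne _ ht.ne₁₃)]
      rw [herase ht, ← coe_aeval_eq_eval, ← aeval_algebraMap_apply, hx,
        eval_derivative_of_eq_rt ht, ← hx, ← hr, ← hr]
      ring
    · push Not at hz
      refine ⟨y, ?_⟩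
      rw [← hry]
      exact Finset.prod_congr rfl fun φ _ => by simp only [hβdef, if_neg (hz φ)]
  refine ⟨Point.some _ _ (half_nonsingular hr hry rfl rfl), ?_, α, rfl, β, hβ, fun σ φ => ?_⟩
  · exact (two_nsmul_half hr hry rfl rfl (hxy := h')).trans hP.symm
  -- The signs by which σ fails to permute β define S in E[2]. Multiplying r by the pairing with S
  -- gives the σ-conjugate family of roots, so that σ(Q) = Q + S.
  set ε : Emb F → AlgebraicClosure K := fun ψ =>
    σ (β ((Emb.actEquiv σ).symm ψ)) / β ψ with hε
  have hεact : ∀ φ, ε (Emb.act σ φ) = σ (β φ) / β (Emb.act σ φ) := fun φ => by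
    simp only [hε]
    rw [show (Emb.actEquiv σ).symm (Emb.act σ φ) = φ from (Emb.actEquiv σ).symm_apply_apply φ]
  have hε1 : ∀ ψ, ε ψ ^ 2 = 1 := fun ψ => by
    obtain ⟨φ, rfl⟩ := (Emb.actEquiv σ).surjective ψ
    change ε (Emb.act σ φ) ^ 2 = 1
    rw [hεact, div_pow, ← map_pow, hβ, hβ, Emb.act_apply, div_self]
    exact (map_ne_zero σ).mpr (α.isUnit.map φ).ne_zero
  have hε2 : ∏ ψ, ε ψ = 1 := by
    obtain ⟨c, hc⟩ := hprod
    simp only [hε]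
    rw [Finset.prod_div_distrib, Equiv.prod_comp (Emb.actEquiv σ).symm (fun φ => σ (β φ)),
      ← map_prod, hc, σ.commutes, div_self]
    rw [← hc]
    exact Finset.prod_ne_zero_iff.mpr fun φ _ => hβ0 φ
  obtain ⟨S, hS, hSε⟩ := weilPairing_surjective ε hε1 hε2
  have hr' : ∀ φ : Emb F, (weilPairing F S φ * r φ) ^ 2 = algebraMap K _ x - φ.rt := fun φ => by
    rw [mul_pow, sq (weilPairing F S φ), weilPairing_mul_self, one_mul, hr]
  have hry' : ∏ φ : Emb F, weilPairing F S φ * r φ = algebraMap K _ y := by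
    rw [Finset.prod_mul_distrib, prod_weilPairing hS, one_mul, hry]
  have hact : ∀ φ : Emb F, weilPairing F S (Emb.act σ φ) * r (Emb.act σ φ) = σ (r φ) := fun φ => by
    have hiff : r (Emb.act σ φ) = 0 ↔ r φ = 0 := by
      rw [hr0, hr0, Emb.rt, Emb.act_apply]
      conv_lhs => rw [← σ.commutes x]
      exact σ.injective.eq_iff
    -- A vanishing root carries no sign, so the value of the pairing there does not matter;
    -- elsewhere β and r agree.
    by_cases h0 : r φ = 0
    · rw [h0, hiff.mpr h0, mul_zero, map_zero]
    · have h1 : β φ = r φ := by simp only [hβdef, if_neg h0]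
      have h2 : β (Emb.act σ φ) = r (Emb.act σ φ) := by
        simp only [hβdef, if_neg (mt hiff.mp h0)]
      rw [hSε, hεact, h1, h2, div_mul_cancel₀ _ (mt hiff.mp h0)]
  have hsum : ∑ φ : Emb F, weilPairing F S φ * r φ = σ (∑ φ, r φ) := by
    rw [← Equiv.sum_comp (Emb.actEquiv σ), map_sum]
    exact Finset.sum_congr rfl fun φ _ => hact φ
  have hgal : galPt σ (Point.some _ _ (half_nonsingular hr hry rfl rfl)) =
      Point.some _ _ (half_nonsingular hr hry rfl rfl) + S := by
    rw [half_add_torsionPoint hr hry rfl rfl hr' hry' rfl rfl hS fun φ => rfl]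
    simp only [galPt, Point.map_some, Point.some.injEq, hsum]
    have h2 : σ 2 = 2 := map_ofNat σ 2
    constructor <;> simp [h2]
  rw [kummerCocycle_eq, hgal, add_sub_cancel_left]
  change σ (β φ) = weilPairing F S (Emb.act σ φ) * β (Emb.act σ φ)
  rw [hSε, hεact, div_mul_cancel₀ _ (hβ0 _)]

/-- The element representing the Kummer class of `(x, y)`. -/
theorem exists_kummer_unit (x : K) : ∃ α : (AdjoinRoot F)ˣ,
    (∀ φ : Emb F, algebraMap K _ x ≠ φ.rt → φ (α : AdjoinRoot F) = algebraMap K _ x - φ.rt) ∧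
    ∀ φ : Emb F, algebraMap K _ x = φ.rt →
      φ (α : AdjoinRoot F) = aeval φ.rt (derivative F) := by
  obtain ⟨α, hα⟩ := Emb.descent_units (fun φ : Emb F => if algebraMap K _ x = φ.rt then
      aeval φ.rt (derivative F) else algebraMap K _ x - φ.rt)
    (fun σ φ => by
      have h1 : σ (algebraMap K _ x) = algebraMap K _ x := σ.commutes x
      have hiff : algebraMap K _ x = (Emb.act σ φ).rt ↔ algebraMap K _ x = φ.rt := by
        rw [Emb.rt, Emb.act_apply]
        conv_lhs => rw [← h1]
        exact σ.injective.eq_iff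
      by_cases h : algebraMap K _ x = φ.rt
      · rw [if_pos h, if_pos (hiff.mpr h), ← h, ← hiff.mpr h, aeval_algebraMap_apply, σ.commutes]
      · rw [if_neg h, if_neg (mt hiff.mp h), map_sub, h1]; rfl)
    (fun φ => by
      split_ifs with h
      · obtain ⟨φ₂, φ₃, ht⟩ := exists_triple_of φ
        rw [eval_derivative_of_eq_rt ht]
        exact mul_ne_zero (sub_ne_zero.mpr (Emb.rt_injective.ne ht.ne₁₂))
          (sub_ne_zero.mpr (Emb.rt_injective.ne ht.ne₁₃))
      · exact sub_ne_zero.mpr h)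
  exact ⟨α, fun φ h => by rw [hα, if_neg h], fun φ h => by rw [hα, if_pos h]⟩

theorem exists_isKummerValue (P : Pts (cubicCurve F) K) : ∃ a, IsKummerValue F P a := by
  rcases P with _ | ⟨x, y, h⟩
  · exact ⟨1, isKummerValue_zero⟩
  · obtain ⟨α, h1, h2⟩ := exists_kummer_unit (F := F) x
    exact ⟨_, isKummerValue_some h h1 h2⟩

variable (F) in
/-- The Kummer map as a homomorphism. -/
noncomputable def kummerHom : Multiplicative (Pts (cubicCurve F) K) →* ModSquares (AdjoinRoot F) :=
  MonoidHom.mk' (fun P => (exists_isKummerValue P.toAdd).choose) fun P Q =>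
    (exists_isKummerValue (P * Q).toAdd).choose_spec.unique
      ((exists_isKummerValue P.toAdd).choose_spec.add (exists_isKummerValue Q.toAdd).choose_spec)

theorem isKummerValue_kummerHom (P : Pts (cubicCurve F) K) :
    IsKummerValue F P (kummerHom F (Multiplicative.ofAdd P)) :=
  (exists_isKummerValue P).choose_spec

theorem kummerHom_eq_iff {P : Pts (cubicCurve F) K} {a : ModSquares (AdjoinRoot F)} :
    kummerHom F (Multiplicative.ofAdd P) = a ↔ IsKummerValue F P a :=
  ⟨fun h => h ▸ isKummerValue_kummerHom P, fun h => (isKummerValue_kummerHom P).unique h⟩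

theorem kummerImage_eq_range : kummerImage F = (kummerHom F).range := by
  ext a
  constructor
  · rintro ⟨P, hP⟩
    exact ⟨Multiplicative.ofAdd P, kummerHom_eq_iff.mpr hP⟩
  · rintro ⟨P, rfl⟩
    exact ⟨P.toAdd, isKummerValue_kummerHom P.toAdd⟩

end KummerMap

/-! ### Counting in abelian groups with a finite index subgroup -/

section Counting

variable {G M : Type*} [CommGroup G] [CommGroup M]

theorem finiteIndex_of_finite_colouring {J : Type*} [Finite J] (f : G → J) (H : Subgroup G)
    (h : ∀ g g', f g = f g' → g / g' ∈ H) : H.FiniteIndex := by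
  have : Finite (G ⧸ H) := by
    refine Finite.of_injective (fun a : G ⧸ H => f a.out) fun a b hab => ?_
    have h1 := h _ _ hab.symm
    rw [← Quotient.out_eq' a, ← Quotient.out_eq' b]
    refine QuotientGroup.eq.mpr ?_
    rwa [mul_comm, ← div_eq_mul_inv]
  exact Subgroup.finiteIndex_of_finite_quotient

theorem card_range_mul_card_ker (f : G →* M) :
    Nat.card f.range * Nat.card f.ker = Nat.card G := by
  rw [Subgroup.card_eq_card_quotient_mul_card_subgroup f.ker,
    Nat.card_congr (QuotientGroup.quotientKerEquivRange f).toEquiv]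

/-- On the finite group G/H, the kernel of the induced map contains the squares, so its image is at
most as large as the 2-torsion of G/H. That torsion lifts to G: if g² lies in H, dividing g by a
square root of g² taken in H corrects it. -/
theorem card_range_le_card_two_torsion (f : G →* M) (hM : ∀ m : M, m * m = 1) (H : Subgroup G)
    [H.FiniteIndex] (hH : ∀ h ∈ H, ∃ w ∈ H, w ^ 2 = h) [Finite {g : G // g ^ 2 = 1}] :
    Finite f.range ∧ Nat.card f.range ≤ Nat.card {g : G // g ^ 2 = 1} := by
  have hker : H ≤ f.ker := fun h hh => by
    obtain ⟨w, -, rfl⟩ := hH h hh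
    rw [MonoidHom.mem_ker, map_pow, sq, hM]
  let fb : G ⧸ H →* M := QuotientGroup.lift H f hker
  let s : G ⧸ H →* G ⧸ H := powMonoidHom 2
  have hr : f.range = fb.range := by
    ext m
    constructor
    · rintro ⟨g, rfl⟩; exact ⟨(g : G ⧸ H), rfl⟩
    · rintro ⟨a, rfl⟩
      induction a using QuotientGroup.induction_on with
      | H g => exact ⟨g, rfl⟩
  have hle : s.range ≤ fb.ker := by
    rintro _ ⟨a, rfl⟩
    rw [MonoidHom.mem_ker]
    change fb (a ^ 2) = 1
    rw [map_pow, sq, hM]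
  have h1 := card_range_mul_card_ker fb
  have h2 := card_range_mul_card_ker s
  have h3 : Nat.card s.range ≤ Nat.card fb.ker := Nat.card_mono (Set.toFinite _) hle
  have h4 : 0 < Nat.card fb.ker := Nat.card_pos
  have hsurj : Function.Surjective (fun g : {g : G // g ^ 2 = 1} =>
      (⟨(g.1 : G ⧸ H), by
        rw [MonoidHom.mem_ker]
        change ((g.1 : G ⧸ H)) ^ 2 = 1
        rw [← QuotientGroup.mk_pow, g.2, QuotientGroup.mk_one]⟩ : s.ker)) := by
    rintro ⟨a, ha⟩
    induction a using QuotientGroup.induction_on with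
    | H g =>
      have hg : g ^ 2 ∈ H := (QuotientGroup.eq_one_iff _).mp ha
      obtain ⟨w, hw, hwg⟩ := hH _ hg
      refine ⟨⟨g / w, by rw [div_pow, hwg, div_self']⟩, Subtype.ext ?_⟩
      change ((g / w : G) : G ⧸ H) = g
      rw [QuotientGroup.mk_div, (QuotientGroup.eq_one_iff w).mpr hw, div_one]
  have h5 : Nat.card s.ker ≤ Nat.card {g : G // g ^ 2 = 1} := Nat.card_le_card_of_surjective _ hsurj
  have hfin : Finite fb.range := Finite.of_surjective _ fb.rangeRestrict_surjective
  rw [hr]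
  refine ⟨hfin, le_trans ?_ h5⟩
  by_contra hlt
  push Not at hlt
  have h6 : 0 < Nat.card s.ker := Nat.card_pos
  have : Nat.card s.range * Nat.card s.ker < Nat.card fb.range * Nat.card fb.ker := by
    rw [mul_comm]
    exact Nat.mul_lt_mul_of_lt_of_le hlt h3 h4
  omega

/-- The reverse count: now the kernel on G/H consists of squares, so the image is at least as large
as the 2-torsion of G/H, into which that of G injects because H has none. -/
theorem card_two_torsion_le_card_range (f : G →* M) (H : Subgroup G) [H.FiniteIndex]
    (hH : H ≤ f.ker) (hf : ∀ g ∈ f.ker, ∃ w, w ^ 2 = g) (hH2 : ∀ h ∈ H, h ^ 2 = 1 → h = 1) :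
    Finite {g : G // g ^ 2 = 1} ∧ Nat.card {g : G // g ^ 2 = 1} ≤ Nat.card f.range := by
  let fb : G ⧸ H →* M := QuotientGroup.lift H f hH
  let s : G ⧸ H →* G ⧸ H := powMonoidHom 2
  have hr : f.range = fb.range := by
    ext m
    constructor
    · rintro ⟨g, rfl⟩; exact ⟨(g : G ⧸ H), rfl⟩
    · rintro ⟨a, rfl⟩
      induction a using QuotientGroup.induction_on with
      | H g => exact ⟨g, rfl⟩
  have hle : fb.ker ≤ s.range := by
    intro a ha
    induction a using QuotientGroup.induction_on with
    | H g =>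
      obtain ⟨w, rfl⟩ := hf g ha
      exact ⟨(w : G ⧸ H), rfl⟩
  have h1 := card_range_mul_card_ker fb
  have h2 := card_range_mul_card_ker s
  have h3 : Nat.card fb.ker ≤ Nat.card s.range := Nat.card_mono (Set.toFinite _) hle
  have h4 : 0 < Nat.card s.range := Nat.card_pos
  have hinj : Function.Injective (fun g : {g : G // g ^ 2 = 1} =>
      (⟨(g.1 : G ⧸ H), by
        rw [MonoidHom.mem_ker]
        change ((g.1 : G ⧸ H)) ^ 2 = 1
        rw [← QuotientGroup.mk_pow, g.2, QuotientGroup.mk_one]⟩ : s.ker)) := by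
    rintro ⟨a, ha⟩ ⟨b, hb⟩ hab
    have h : ((a : G ⧸ H)) = b := congrArg Subtype.val hab
    have h' := hH2 _ (QuotientGroup.eq.mp h) (by rw [mul_pow, inv_pow, ha, hb, inv_one, one_mul])
    exact Subtype.ext (inv_mul_eq_one.mp h')
  have hfin := Finite.of_injective _ hinj
  have h5 : Nat.card {g : G // g ^ 2 = 1} ≤ Nat.card s.ker := Nat.card_le_card_of_injective _ hinj
  rw [hr]
  refine ⟨hfin, h5.trans ?_⟩
  by_contra hlt
  push Not at hlt
  have : Nat.card fb.range * Nat.card fb.ker < Nat.card s.range * Nat.card s.ker := by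
    rw [mul_comm (Nat.card s.range)]
    exact Nat.mul_lt_mul_of_lt_of_le hlt h3 h4
  omega

end Counting

/-! ### Local absolute values -/

/-- A Galois invariant nonarchimedean absolute value on the algebraic closure of `K`, of odd residue
characteristic and for which bounded subsets of `K` are totally bounded. -/
structure IsLocalAbs {K : Type*} [Field K] (v : AbsoluteValue (AlgebraicClosure K) ℝ) : Prop where
  nonarch : ∀ a b, v (a + b) ≤ max (v a) (v b)
  gal : ∀ (σ : AlgebraicClosure K ≃ₐ[K] AlgebraicClosure K) a, v (σ a) = v a
  two : v 2 = 1
  colouring : ∀ M ε : ℝ, 0 < ε → ∃ (n : ℕ) (q : K → Fin n), ∀ x y,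
    v (algebraMap K _ x) ≤ M → v (algebraMap K _ y) ≤ M → q x = q y →
      v (algebraMap K _ x - algebraMap K _ y) < ε

section LocalAbs

variable {K : Type*} [Field K] {v : AbsoluteValue (AlgebraicClosure K) ℝ}

namespace IsLocalAbs

variable (hv : IsLocalAbs v)

include hv

theorem sub_le (a b : AlgebraicClosure K) : v (a - b) ≤ max (v a) (v b) := by
  rw [sub_eq_add_neg, ← v.map_neg b]; exact hv.nonarch _ _

theorem add_lt {a b : AlgebraicClosure K} {c : ℝ} (ha : v a < c) (hb : v b < c) : v (a + b) < c :=
  (hv.nonarch a b).trans_lt (max_lt ha hb)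

theorem add_le {a b : AlgebraicClosure K} {c : ℝ} (ha : v a ≤ c) (hb : v b ≤ c) : v (a + b) ≤ c :=
  (hv.nonarch a b).trans (max_le ha hb)

theorem sub_lt {a b : AlgebraicClosure K} {c : ℝ} (ha : v a < c) (hb : v b < c) : v (a - b) < c :=
  (hv.sub_le a b).trans_lt (max_lt ha hb)

/-- The larger term dominates. -/
theorem eq_of_sub_lt {a b : AlgebraicClosure K} (h : v (a - b) < v b) : v a = v b := by
  refine le_antisymm ?_ ?_
  · have := hv.nonarch (a - b) b
    rwa [sub_add_cancel, max_eq_right h.le] at this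
  · by_contra hlt
    push Not at hlt
    have := hv.sub_le a (a - b)
    rw [sub_sub_cancel] at this
    exact absurd this (not_le.mpr (max_lt hlt h))

theorem eq_one_of_sub_one_lt {a : AlgebraicClosure K} (h : v (a - 1) < 1) : v a = 1 := by
  rw [← v.map_one]; exact hv.eq_of_sub_lt (by rwa [v.map_one])

/-- If a = -b, then 2 is a sum of two elements of absolute value below 1, contrary to odd residue
characteristic. -/
theorem eq_of_sq_eq {a b : AlgebraicClosure K} (ha : v (a - 1) < 1) (hb : v (b - 1) < 1)
    (h : a ^ 2 = b ^ 2) : a = b := by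
  rcases sq_eq_sq_iff_eq_or_eq_neg.mp h with h | h
  · exact h
  · exfalso
    have h1 : v ((-(a - 1)) - (b - 1)) < 1 := hv.sub_lt (by rwa [v.map_neg]) hb
    rw [show -(a - 1) - (b - 1) = 2 by rw [h]; ring, hv.two] at h1
    exact lt_irrefl _ h1

/-- For a root b, the product (b - 1)(-b - 1) = -(a - 1) is small, so b or -b is close to 1. -/
theorem exists_sqrt {a : AlgebraicClosure K} (ha : v (a - 1) < 1) : ∃ b, b ^ 2 = a ∧ v (b - 1) < 1 := by
  obtain ⟨b, hb⟩ := IsAlgClosed.exists_pow_nat_eq a two_pos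
  by_cases h : v (b - 1) < 1
  · exact ⟨b, hb, h⟩
  · refine ⟨-b, by rw [neg_sq, hb], ?_⟩
    by_contra h'
    push Not at h h'
    have : v ((b - 1) * (-b - 1)) < 1 := by
      rw [show (b - 1) * (-b - 1) = -(b ^ 2 - 1) by ring, v.map_neg, hb]; exact ha
    rw [v.map_mul] at this
    nlinarith

end IsLocalAbs

variable [CharZero K] {F : K[X]} [hF : IsSquarefreeCubic F]

namespace IsLocalAbs

variable (hv : IsLocalAbs v)

include hv

/-- Elements close to `1` in the cubic algebra are squares. -/
theorem exists_sqrt_alg {a : AdjoinRoot F} (ha : ∀ φ : Emb F, v (φ a - 1) < 1) :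
    ∃ b : AdjoinRoot F, b ^ 2 = a ∧ ∀ φ : Emb F, v (φ b - 1) < 1 := by
  choose g hg hg1 using fun φ => hv.exists_sqrt (ha φ)
  -- The square root close to 1 is unique, hence compatible with the Galois action.
  obtain ⟨b, hb⟩ := Emb.descent g fun σ φ => hv.eq_of_sq_eq
    (by rw [← map_one σ, ← map_sub, hv.gal]; exact hg1 φ) (hg1 _)
    (by rw [← map_pow, hg, hg]; rfl)
  exact ⟨b, Emb.ext_elem fun φ => by rw [map_pow, hb, hg], fun φ => by rw [hb]; exact hg1 φ⟩

theorem prod_sub_one_lt (g : Emb F → AlgebraicClosure K) (h : ∀ φ, v (g φ - 1) < 1) :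
    v (∏ φ, g φ - 1) < 1 := by
  obtain ⟨φ₁, φ₂, φ₃, ht⟩ := exists_triple F
  have hmul : ∀ {a b}, v (a - 1) < 1 → v (b - 1) < 1 → v (a * b - 1) < 1 := fun {a b} ha hb => by
    rw [show a * b - 1 = a * (b - 1) + (a - 1) by ring]
    refine hv.add_lt ?_ ha
    rwa [v.map_mul, hv.eq_one_of_sub_one_lt ha, one_mul]
  rw [ht.prod]
  exact hmul (hmul (h _) (h _)) (h _)

end IsLocalAbs

/-! ### Units of absolute value one -/

variable (v F)

/-- The units of the cubic algebra all of whose conjugates have absolute value `1`. -/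
noncomputable def absUnits : Subgroup (AdjoinRoot F)ˣ where
  carrier := {u | ∀ φ : Emb F, v (φ (u : AdjoinRoot F)) = 1}
  mul_mem' ha hb φ := by rw [Units.val_mul, map_mul, map_mul, ha φ, hb φ, one_mul]
  one_mem' φ := by simp
  inv_mem' {a} ha φ := by
    have : φ (a : AdjoinRoot F) * φ ((a⁻¹ : (AdjoinRoot F)ˣ) : AdjoinRoot F) = 1 := by
      rw [← map_mul, Units.mul_inv, map_one]
    have h := congrArg v this
    rwa [map_mul, ha φ, one_mul, map_one] at h

/-- The units of absolute value and norm `1`. -/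
noncomputable def normOneUnits : Subgroup (AdjoinRoot F)ˣ :=
  absUnits v F ⊓ (Units.map (Algebra.norm K : AdjoinRoot F →* K)).ker

/-- The classes modulo squares of units of absolute value `1` with square norm. -/
noncomputable def absUnitClasses : Subgroup (ModSquares (AdjoinRoot F)) :=
  (absUnits v F).map (QuotientGroup.mk' _) ⊓ squareNorm F

/-- The map from units of norm `1` to classes. -/
noncomputable def normOneToClasses : normOneUnits v F →* ModSquares (AdjoinRoot F) :=
  (QuotientGroup.mk' _).comp (normOneUnits v F).subtype

variable {v F}

theorem mem_squareNorm_iff (u : (AdjoinRoot F)ˣ) : (u : ModSquares (AdjoinRoot F)) ∈ squareNorm F ↔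
    ∃ c : Kˣ, (c : K) ^ 2 = Algebra.norm K (u : AdjoinRoot F) := by
  change ((Units.map (Algebra.norm K : AdjoinRoot F →* K) u : Kˣ) : ModSquares K) = 1 ↔ _
  rw [modSquares_coe_eq_one_iff]
  refine exists_congr fun c => ?_
  rw [Units.ext_iff]; simp

theorem norm_algebraMap_cubic (c : K) : Algebra.norm K (algebraMap K (AdjoinRoot F) c) = c ^ 3 := by
  apply (algebraMap K (AlgebraicClosure K)).injective
  rw [Emb.norm_eq_prod, Finset.prod_congr rfl fun φ _ => AlgHom.commutes φ c, Finset.prod_const,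
    Finset.card_univ, card_emb, map_pow]

/-- Every class of units with square norm contains a unit of norm `1`. -/
theorem cube_div_norm {u : (AdjoinRoot F)ˣ} {c : Kˣ}
    (hc : (c : K) ^ 2 = Algebra.norm K (u : AdjoinRoot F)) :
    let w := u ^ 3 / (Units.map (algebraMap K (AdjoinRoot F) : K →* AdjoinRoot F) c) ^ 2
    (w : ModSquares (AdjoinRoot F)) = u ∧
    Units.map (Algebra.norm K : AdjoinRoot F →* K) w = 1 := by
  intro w
  set d := Units.map (algebraMap K (AdjoinRoot F) : K →* AdjoinRoot F) c with hd
  constructor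
  -- Here w⁻¹u = (d / u)². For the norm, N(d) = c³ because the algebra has degree three.
  · refine (QuotientGroup.eq.mpr ⟨d / u, ?_⟩)
    simp only [w, powMonoidHom_apply]
    rw [div_pow, inv_div, div_mul_eq_mul_div, pow_succ u 2, mul_div_mul_right_eq_div]
  · have h1 : Units.map (Algebra.norm K : AdjoinRoot F →* K) u = c ^ 2 :=
      Units.ext (by simpa using hc.symm)
    have h2 : Units.map (Algebra.norm K : AdjoinRoot F →* K) d = c ^ 3 :=
      Units.ext (by simpa [hd] using norm_algebraMap_cubic (F := F) (c : K))
    rw [_root_.map_div, map_pow, map_pow, h1, h2, ← pow_mul, ← pow_mul, div_self']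

/-- The representative u³/c² keeps absolute value 1, since c² = N(u) gives |c| = 1. -/
theorem absUnitClasses_le_range : absUnitClasses v F ≤ (normOneToClasses v F).range := by
  rintro _ ⟨⟨u, hu, rfl⟩, hsq⟩
  obtain ⟨c, hc⟩ := (mem_squareNorm_iff u).mp hsq
  obtain ⟨h1, h2⟩ := cube_div_norm hc
  refine ⟨⟨_, Subgroup.mem_inf.mpr ⟨?_, h2⟩⟩, h1⟩
  refine div_mem (pow_mem hu 3) (pow_mem (fun φ => ?_) 2)
  have h3 : v (algebraMap K _ (c : K)) ^ 2 = 1 := by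
    rw [← map_pow, ← map_pow, hc, Emb.norm_eq_prod, map_prod]
    exact Finset.prod_eq_one fun φ _ => hu φ
  have h4 : v (algebraMap K _ (c : K)) = 1 := by
    rcases sq_eq_one_iff.mp h3 with h | h
    · exact h
    · linarith [v.nonneg (algebraMap K _ (c : K))]
  exact (congrArg v (AlgHom.commutes φ (c : K))).trans h4

variable (v F) in
/-- The units of norm `1` close to `1`. -/
noncomputable def nearOne (hv : IsLocalAbs v) : Subgroup (normOneUnits v F) where
  carrier := {u | ∀ φ : Emb F, v (φ (u : (AdjoinRoot F)ˣ) - 1) < 1}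
  mul_mem' {a b} ha hb φ := by
    have h1 : v (φ (a : (AdjoinRoot F)ˣ)) = 1 := a.2.1 φ
    rw [show φ (((a * b : normOneUnits v F) : (AdjoinRoot F)ˣ) : AdjoinRoot F) - 1 =
      φ (a : (AdjoinRoot F)ˣ) * (φ (b : (AdjoinRoot F)ˣ) - 1) + (φ (a : (AdjoinRoot F)ˣ) - 1) by
        simp; ring]
    refine hv.add_lt ?_ (ha φ)
    rw [v.map_mul, h1, one_mul]; exact hb φ
  one_mem' φ := by simp
  inv_mem' {a} ha φ := by
    have h1 : v (φ ((a⁻¹ : normOneUnits v F) : (AdjoinRoot F)ˣ)) = 1 := (a⁻¹).2.1 φ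
    have h2 : φ ((a : (AdjoinRoot F)ˣ) : AdjoinRoot F) *
        φ (((a⁻¹ : normOneUnits v F) : (AdjoinRoot F)ˣ) : AdjoinRoot F) = 1 := by
      rw [← map_mul]; simp
    rw [show φ (((a⁻¹ : normOneUnits v F) : (AdjoinRoot F)ˣ) : AdjoinRoot F) - 1 =
      -(φ ((a⁻¹ : normOneUnits v F) : (AdjoinRoot F)ˣ) * (φ (a : (AdjoinRoot F)ˣ) - 1)) by
        linear_combination h2, v.map_neg, v.map_mul, h1, one_mul]
    exact ha φ

/-! ### Units of norm 1 near 1: square roots and finite index. -/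

theorem norm_normOneUnits (u : normOneUnits v F) :
    Algebra.norm K ((u : (AdjoinRoot F)ˣ) : AdjoinRoot F) = 1 :=
  congrArg Units.val (MonoidHom.mem_ker.mp u.2.2)

/-- The square root close to 1 has a norm which is close to 1 and squares to 1, hence equals 1. -/
theorem nearOne_exists_sqrt (hv : IsLocalAbs v) {u : normOneUnits v F} (hu : u ∈ nearOne v F hv) :
    ∃ w ∈ nearOne v F hv, w ^ 2 = u := by
  obtain ⟨b, hb, hb1⟩ := hv.exists_sqrt_alg (a := ((u : (AdjoinRoot F)ˣ) : AdjoinRoot F)) hu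
  have hbu : IsUnit b := by
    rw [← isUnit_pow_iff two_ne_zero, hb]; exact Units.isUnit _
  have hun := norm_normOneUnits u
  have hN : Algebra.norm K b = 1 := by
    apply (algebraMap K (AlgebraicClosure K)).injective
    refine hv.eq_of_sq_eq ?_ (by simp) ?_
    · rw [Emb.norm_eq_prod]; exact hv.prod_sub_one_lt _ hb1
    · rw [← map_pow, ← map_pow, ← map_pow, hb, hun, one_pow]
  refine ⟨⟨hbu.unit, fun φ => hv.eq_one_of_sub_one_lt (hb1 φ), ?_⟩, hb1, ?_⟩
  · exact MonoidHom.mem_ker.mpr (Units.ext hN)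
  · exact Subtype.ext (Units.ext hb)

/-- The power traces of an element lie in `K`. -/
theorem exists_powerTrace (a : AdjoinRoot F) (j : ℕ) :
    ∃ t : K, algebraMap K (AlgebraicClosure K) t = ∑ φ : Emb F, φ a * φ.rt ^ j := by
  refine (InfiniteGalois.mem_range_algebraMap_iff_fixed (k := K) _).mpr fun σ => ?_
  rw [map_sum, ← Equiv.sum_comp (Emb.actEquiv σ) (fun φ : Emb F => φ a * φ.rt ^ j)]
  exact Finset.sum_congr rfl fun φ _ => by rw [map_mul, map_pow]; rfl

variable (F) in
/-- The embeddings are linear combinations of the power traces. -/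
theorem exists_coeff_powerTrace : ∃ w : Emb F → ℕ → AlgebraicClosure K, ∀ (φ : Emb F)
    (a : AdjoinRoot F), φ a = ∑ j ∈ Finset.range 3, w φ j * ∑ ψ : Emb F, ψ a * ψ.rt ^ j := by
  classical
  have hinj : Set.InjOn (fun φ : Emb F => φ.rt) (Finset.univ : Finset (Emb F)) :=
    Emb.rt_injective.injOn
  -- The Lagrange basis polynomial of φ is 1 at its root and 0 at the others; its coefficients are
  -- the weights.
  refine ⟨fun φ j => (Lagrange.basis Finset.univ (fun φ : Emb F => φ.rt) φ).coeff j, fun φ a => ?_⟩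
  have hd : (Lagrange.basis Finset.univ (fun φ : Emb F => φ.rt) φ).natDegree < 3 := by
    have := Lagrange.degree_basis hinj (Finset.mem_univ φ)
    rw [Finset.card_univ, card_emb] at this
    rw [natDegree_eq_of_degree_eq_some this]; norm_num
  simp only [Finset.mul_sum]
  rw [Finset.sum_comm]
  have : ∀ ψ : Emb F, ∑ j ∈ Finset.range 3,
      (Lagrange.basis Finset.univ (fun φ : Emb F => φ.rt) φ).coeff j * (ψ a * ψ.rt ^ j) =
      ψ a * (Lagrange.basis Finset.univ (fun φ : Emb F => φ.rt) φ).eval ψ.rt := fun ψ => by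
    rw [eval_eq_sum_range' hd, Finset.mul_sum]
    exact Finset.sum_congr rfl fun j _ => by ring
  simp only [this]
  rw [Finset.sum_eq_single φ]
  · rw [Lagrange.eval_basis_self hinj (Finset.mem_univ φ), mul_one]
  · intro ψ _ hne
    rw [Lagrange.eval_basis_of_ne (v := fun φ : Emb F => φ.rt) hne.symm (Finset.mem_univ ψ), mul_zero]
  · intro h; exact absurd (Finset.mem_univ φ) h

/-- Total boundedness is available only in K, so units are coloured through their three power
traces. Close traces give close values at every embedding, and the quotient of two such units is
near 1. -/
theorem nearOne_finiteIndex (hv : IsLocalAbs v) : (nearOne v F hv).FiniteIndex := by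
  obtain ⟨w, hw⟩ := exists_coeff_powerTrace F
  choose t ht using exists_powerTrace (F := F)
  -- M bounds the traces of units of absolute value 1. W exceeds the total weight at each embedding;
  -- its summand 1 keeps it positive and the final inequality strict.
  set M : ℝ := ∑ j ∈ Finset.range 3, ∑ φ : Emb F, v φ.rt ^ j with hM
  set W : ℝ := 1 + ∑ φ : Emb F, ∑ j ∈ Finset.range 3, v (w φ j) with hW
  have hWpos : 0 < W := by
    have : 0 ≤ ∑ φ : Emb F, ∑ j ∈ Finset.range 3, v (w φ j) :=
      Finset.sum_nonneg fun φ _ => Finset.sum_nonneg fun j _ => v.nonneg _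
    linarith
  obtain ⟨n, q, hq⟩ := hv.colouring M W⁻¹ (inv_pos.mpr hWpos)
  refine finiteIndex_of_finite_colouring (G := normOneUnits v F) (J := Fin 3 → Fin n)
    (fun u j => q (t ((u : (AdjoinRoot F)ˣ) : AdjoinRoot F) j)) (nearOne v F hv) fun g g' hgg => ?_
  have hb : ∀ (u : normOneUnits v F) (j : ℕ), j ∈ Finset.range 3 →
      v (algebraMap K _ (t ((u : (AdjoinRoot F)ˣ) : AdjoinRoot F) j)) ≤ M := fun u j hj => by
    rw [ht]
    refine (v.sum_le _ _).trans ?_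
    refine le_trans ?_ (Finset.single_le_sum (f := fun j => ∑ φ : Emb F, v φ.rt ^ j)
      (fun j _ => Finset.sum_nonneg fun φ _ => pow_nonneg (v.nonneg _) _) hj)
    refine Finset.sum_le_sum fun φ _ => ?_
    have : v (φ ((u : (AdjoinRoot F)ˣ) : AdjoinRoot F)) = 1 := u.2.1 φ
    rw [v.map_mul, this, one_mul, map_pow]
  have hclose : ∀ φ : Emb F, v (φ (g : (AdjoinRoot F)ˣ) - φ (g' : (AdjoinRoot F)ˣ)) < 1 := fun φ => by
    rw [hw φ, hw φ, ← Finset.sum_sub_distrib]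
    simp only [← mul_sub, ← ht]
    refine (v.sum_le _ _).trans_lt ?_
    have h1 : ∑ j ∈ Finset.range 3, v (w φ j * (algebraMap K _ (t (g : (AdjoinRoot F)ˣ) j) -
        algebraMap K _ (t (g' : (AdjoinRoot F)ˣ) j))) ≤ ∑ j ∈ Finset.range 3, v (w φ j) * W⁻¹ := by
      refine Finset.sum_le_sum fun j hj => ?_
      rw [v.map_mul]
      refine mul_le_mul_of_nonneg_left (hq _ _ (hb g j hj) (hb g' j hj) ?_).le (v.nonneg _)
      exact congrFun hgg ⟨j, Finset.mem_range.mp hj⟩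
    refine h1.trans_lt ?_
    rw [← Finset.sum_mul, ← div_eq_mul_inv, div_lt_one hWpos]
    have := Finset.single_le_sum (f := fun φ : Emb F => ∑ j ∈ Finset.range 3, v (w φ j))
      (fun φ _ => Finset.sum_nonneg fun j _ => v.nonneg _) (Finset.mem_univ φ)
    linarith
  intro φ
  have h1 : v (φ ((g'⁻¹ : normOneUnits v F) : (AdjoinRoot F)ˣ)) = 1 := (g'⁻¹).2.1 φ
  have h2 : φ ((g' : (AdjoinRoot F)ˣ) : AdjoinRoot F) *
      φ (((g'⁻¹ : normOneUnits v F) : (AdjoinRoot F)ˣ) : AdjoinRoot F) = 1 := by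
    rw [← map_mul]; simp
  have h3 : φ (((g / g' : normOneUnits v F) : (AdjoinRoot F)ˣ) : AdjoinRoot F) =
      φ (g : (AdjoinRoot F)ˣ) * φ ((g'⁻¹ : normOneUnits v F) : (AdjoinRoot F)ˣ) := by
    rw [div_eq_mul_inv, ← map_mul]; rfl
  rw [h3, ← h2, ← sub_mul, v.map_mul, h1, mul_one]
  exact hclose φ

open scoped Classical in
/-- The `2`-torsion units of norm `1` correspond to rational `2`-torsion points. -/
theorem card_two_torsion_units_le [Finite {P : Multiplicative (Pts (cubicCurve F) K) // P ^ 2 = 1}] :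
    Finite {u : normOneUnits v F // u ^ 2 = 1} ∧ Nat.card {u : normOneUnits v F // u ^ 2 = 1} ≤
      Nat.card {P : Multiplicative (Pts (cubicCurve F) K) // P ^ 2 = 1} := by
  have key : ∀ u : {u : normOneUnits v F // u ^ 2 = 1},
      ∃ P : {P : Multiplicative (Pts (cubicCurve F) K) // P ^ 2 = 1}, ∀ φ : Emb F,
        φ ((u.1 : (AdjoinRoot F)ˣ) : AdjoinRoot F) =
          weilPairing F (toClosure F P.1.toAdd) φ := by
    rintro ⟨u, hu2⟩
    have hu2' : ((u : (AdjoinRoot F)ˣ) : AdjoinRoot F) ^ 2 = 1 := by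
      have := congrArg (fun z : normOneUnits v F => ((z : (AdjoinRoot F)ˣ) : AdjoinRoot F)) hu2
      simpa using this
    have hun := norm_normOneUnits u
    -- The values of u are signs whose product is the norm 1, so they are the pairings of a point S;
    -- their equivariance makes S rational.
    obtain ⟨S, hS, hSu⟩ := weilPairing_surjective
      (fun φ : Emb F => φ ((u : (AdjoinRoot F)ˣ) : AdjoinRoot F))
      (fun φ => by rw [← map_pow, hu2', map_one]) (by rw [← Emb.norm_eq_prod, hun, map_one])
    obtain ⟨P, hP⟩ := exists_baseChange_eq (Q := S) fun σ =>
      weilPairing_injective (by rw [← map_nsmul, hS, map_zero]) hS fun φ => by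
        obtain ⟨ψ, rfl⟩ := (Emb.actEquiv σ).surjective φ
        change weilPairing F (galPt σ S) (Emb.act σ ψ) = weilPairing F S (Emb.act σ ψ)
        rw [weilPairing_galPt, hSu (Emb.act σ ψ), Emb.act_apply, ← hSu ψ]
        rcases weilPairing_eq_or S ψ with h | h <;> simp [h]
    refine ⟨⟨Multiplicative.ofAdd P, ?_⟩, fun φ => ?_⟩
    · rw [← ofAdd_nsmul]
      refine congrArg Multiplicative.ofAdd (?_ : 2 • P = 0)
      apply toClosure_injective
      rw [map_nsmul, map_zero]
      exact (congrArg (2 • ·) hP).trans hS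
    · exact (hSu φ).symm.trans (congrArg (fun T => weilPairing F T φ) hP.symm)
  choose f hf using key
  have hinj : Function.Injective f := fun a b hab => by
    refine Subtype.ext (Subtype.ext (Units.ext (Emb.ext_elem fun φ => ?_)))
    rw [hf, hf, hab]
  exact ⟨Finite.of_injective f hinj, Nat.card_le_card_of_injective f hinj⟩

open scoped Classical in
theorem card_absUnitClasses_le (hv : IsLocalAbs v)
    [Finite {P : Multiplicative (Pts (cubicCurve F) K) // P ^ 2 = 1}] :
    Finite (absUnitClasses v F) ∧ Nat.card (absUnitClasses v F) ≤
      Nat.card {P : Multiplicative (Pts (cubicCurve F) K) // P ^ 2 = 1} := by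
  obtain ⟨h1, h2⟩ := card_two_torsion_units_le (v := v) (F := F)
  have := nearOne_finiteIndex (F := F) hv
  obtain ⟨h3, h4⟩ := card_range_le_card_two_torsion (normOneToClasses v F) modSquares_mul_self
    (nearOne v F hv) fun u hu => nearOne_exists_sqrt hv hu
  have h5 := absUnitClasses_le_range (v := v) (F := F)
  exact ⟨Finite.Set.subset _ h5, (Nat.card_mono (Set.toFinite _) h5).trans (h4.trans h2)⟩

end LocalAbs

/-! ### The points with non-integral coordinates -/

/-- The relations compare coefficients of F with those of the square of the line lX + n. If x₃ were
integral and |x₂| ≤ |x₁|, then |l|² ≤ |x₁| and |n|² ≤ |x₁x₂|, whence |ln| < |x₁x₂|; the relation for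
the linear coefficient would then have x₁x₂ as its only term of maximal size. -/
theorem one_lt_abs_third_root {L : Type*} [Field L] {w : AbsoluteValue L ℝ}
    (hw : ∀ a b, w (a + b) ≤ max (w a) (w b)) (hw2 : w 2 ≤ 1) {a₂ a₁ a₀ x₁ x₂ x₃ l n : L}
    (h₂ : w a₂ ≤ 1) (h₁ : w a₁ ≤ 1) (h₀ : w a₀ ≤ 1)
    (e₂ : l ^ 2 = x₁ + x₂ + x₃ + a₂) (e₁ : 2 * (l * n) = a₁ - (x₁ * x₂ + x₁ * x₃ + x₂ * x₃))
    (e₀ : n ^ 2 = a₀ + x₁ * x₂ * x₃) (hx₁ : 1 < w x₁) (hx₂ : 1 < w x₂) : 1 < w x₃ := by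
  have hadd : ∀ {a b c}, w a ≤ c → w b ≤ c → w (a + b) ≤ c := fun ha hb =>
    (hw _ _).trans (max_le ha hb)
  have hsub : ∀ {a b c}, w a ≤ c → w b ≤ c → w (a - b) ≤ c := fun {a b c} ha hb => by
    rw [sub_eq_add_neg]; exact hadd ha (by rwa [w.map_neg])
  wlog hle : w x₂ ≤ w x₁ generalizing x₁ x₂
  · exact this (by rw [e₂]; ring) (by rw [e₁]; ring) (by rw [e₀]; ring) hx₂ hx₁ (not_le.mp hle).le
  by_contra hx₃
  push Not at hx₃
  have hprod : 1 < w x₁ * w x₂ := by nlinarith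
  have hl : w l ^ 2 ≤ w x₁ := by
    rw [← map_pow, e₂]
    exact hadd (hadd (hadd le_rfl hle) (hx₃.trans hx₁.le)) (h₂.trans hx₁.le)
  have hn : w n ^ 2 ≤ w x₁ * w x₂ := by
    rw [← map_pow, e₀]
    refine hadd (h₀.trans hprod.le) ?_
    rw [w.map_mul, w.map_mul]
    exact mul_le_of_le_one_right (by positivity) hx₃
  have hln : w l * w n < w x₁ * w x₂ := by
    refine lt_of_pow_lt_pow_left₀ 2 (by positivity) ?_
    rw [mul_pow, mul_pow]
    have h1 : w l ^ 2 * w n ^ 2 ≤ w x₁ * (w x₁ * w x₂) := by gcongr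
    have h2 : w x₁ * (w x₁ * w x₂) < w x₁ ^ 2 * w x₂ ^ 2 := by
      have : w x₁ * w x₂ * w x₁ * 1 < w x₁ * w x₂ * w x₁ * w x₂ :=
        mul_lt_mul_of_pos_left hx₂ (by positivity)
      nlinarith
    exact h1.trans_lt h2
  have hxx : w x₁ * w x₂ ≤ max (max 1 (w l * w n)) (w x₁) := by
    rw [← w.map_mul, show x₁ * x₂ = a₁ - 2 * (l * n) - (x₁ + x₂) * x₃ by rw [e₁]; ring]
    refine hsub (hsub (h₁.trans (le_max_of_le_left (le_max_left _ _))) ?_) ?_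
    · refine le_max_of_le_left (le_max_of_le_right ?_)
      rw [w.map_mul, w.map_mul]
      exact mul_le_of_le_one_left (by positivity) hw2
    · refine le_max_of_le_right ?_
      rw [w.map_mul]
      exact (mul_le_of_le_one_right (by positivity) hx₃).trans (hadd le_rfl hle)
  rcases le_max_iff.mp hxx with h | h
  · rcases le_max_iff.mp h with h | h <;> linarith
  · nlinarith

/-- The restriction of an absolute value to `K`. -/
noncomputable abbrev baseAbs {K : Type*} [Field K] (v : AbsoluteValue (AlgebraicClosure K) ℝ) :
    AbsoluteValue K ℝ :=
  v.comp (algebraMap K (AlgebraicClosure K)).injective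

theorem baseAbs_apply {K : Type*} [Field K] {v : AbsoluteValue (AlgebraicClosure K) ℝ} (x : K) :
    baseAbs v x = v (algebraMap K _ x) := rfl

section FormalGroup

open scoped Classical

open WeierstrassCurve.Affine

variable {K : Type*} [Field K] [CharZero K] {F : K[X]} [hF : IsSquarefreeCubic F]
  {v : AbsoluteValue (AlgebraicClosure K) ℝ}

theorem IsLocalAbs.base_nonarch (hv : IsLocalAbs v) (a b : K) :
    baseAbs v (a + b) ≤ max (baseAbs v a) (baseAbs v b) := by
  rw [baseAbs_apply, map_add]; exact hv.nonarch _ _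

theorem IsLocalAbs.base_add_le (hv : IsLocalAbs v) {a b : K} {c : ℝ} (ha : baseAbs v a ≤ c)
    (hb : baseAbs v b ≤ c) : baseAbs v (a + b) ≤ c :=
  (hv.base_nonarch a b).trans (max_le ha hb)

theorem IsLocalAbs.base_sub_le (hv : IsLocalAbs v) {a b : K} {c : ℝ} (ha : baseAbs v a ≤ c)
    (hb : baseAbs v b ≤ c) : baseAbs v (a - b) ≤ c := by
  rw [sub_eq_add_neg]; exact hv.base_add_le ha (by rwa [AbsoluteValue.map_neg])

theorem IsLocalAbs.base_two (hv : IsLocalAbs v) : baseAbs v 2 = 1 := by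
  rw [baseAbs_apply, map_ofNat]; exact hv.two

/-- Roots of integral monic cubics are integral. -/
theorem IsLocalAbs.le_one_of_cubic (hv : IsLocalAbs v) {z a b c : AlgebraicClosure K}
    (ha : v a ≤ 1) (hb : v b ≤ 1) (hc : v c ≤ 1) (h : z ^ 3 + a * z ^ 2 + b * z + c = 0) :
    v z ≤ 1 := by
  by_contra hlt
  push Not at hlt
  have h1 : z ^ 3 = -(a * z ^ 2 + b * z + c) := by linear_combination h
  have h2 := congrArg v h1
  rw [v.map_neg, map_pow] at h2
  have h3 : v (a * z ^ 2 + b * z + c) ≤ v z ^ 2 := by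
    refine hv.add_le (hv.add_le ?_ ?_) ?_
    · rw [v.map_mul, map_pow]; exact mul_le_of_le_one_left (by positivity) ha
    · rw [v.map_mul]
      exact (mul_le_of_le_one_left (by positivity) hb).trans (by nlinarith)
    · exact hc.trans (by nlinarith)
  rw [← h2] at h3
  nlinarith [pow_pos (zero_lt_one.trans hlt) 2]

theorem IsLocalAbs.rt_le_one (hv : IsLocalAbs v) (hint : ∀ i, baseAbs v (F.coeff i) ≤ 1)
    (φ : Emb F) : v φ.rt ≤ 1 :=
  hv.le_one_of_cubic (hint 2) (hint 1) (hint 0) ((aeval_cubic (F := F) φ.rt).symm.trans φ.aeval_rt)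

theorem affine_equation {x y : K}
    (h : (WeierstrassCurve.baseChange (cubicCurve F) K).toAffine.Nonsingular x y) :
    y ^ 2 = x ^ 3 + F.coeff 2 * x ^ 2 + F.coeff 1 * x + F.coeff 0 := by
  simpa using (cubicCurve_equation_iff x y).mp h.1

theorem third_root_relations {x₁ y₁ x₂ y₂ : K}
    (h₁ : (WeierstrassCurve.baseChange (cubicCurve F) K).toAffine.Nonsingular x₁ y₁)
    (h₂ : (WeierstrassCurve.baseChange (cubicCurve F) K).toAffine.Nonsingular x₂ y₂)
    (hxy : ¬(x₁ = x₂ ∧ y₁ = (WeierstrassCurve.baseChange (cubicCurve F) K).toAffine.negY x₂ y₂)) :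
    let W := (WeierstrassCurve.baseChange (cubicCurve F) K).toAffine
    let l := W.slope x₁ x₂ y₁ y₂
    let x₃ := W.addX x₁ x₂ l
    let n := y₁ - l * x₁
    l ^ 2 = x₁ + x₂ + x₃ + F.coeff 2 ∧
    2 * (l * n) = F.coeff 1 - (x₁ * x₂ + x₁ * x₃ + x₂ * x₃) ∧
    n ^ 2 = F.coeff 0 + x₁ * x₂ * x₃ := by
  intro W l x₃ n
  have h := W.addPolynomial_slope h₁.1 h₂.1 hxy
  have key : ∀ t : K, (l * t + n) ^ 2 - (t ^ 3 + F.coeff 2 * t ^ 2 + F.coeff 1 * t + F.coeff 0) =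
      -((t - x₁) * (t - x₂) * (t - x₃)) := fun t => by
    have := congrArg (eval t) h
    rw [addPolynomial_eq] at this
    simp only [W, Cubic.toPoly, cubicCurve, WeierstrassCurve.baseChange, WeierstrassCurve.map,
      Algebra.algebraMap_self, RingHom.id_apply, eval_neg, eval_add, eval_sub, eval_mul, eval_C,
      eval_pow, eval_X, map_zero] at this
    simp only [x₃, W, l, n, cubicCurve, WeierstrassCurve.baseChange, WeierstrassCurve.map,
      Algebra.algebraMap_self, RingHom.id_apply, map_zero]
    linear_combination this
  have k0 := key 0
  have k1 := key 1
  have k2 := key (-1)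
  refine ⟨?_, ?_, ?_⟩
  · linear_combination (k1 + k2 - 2 * k0) / 2
  · linear_combination (k1 - k2) / 2
  · linear_combination k0

/-- A point of the formal group: the point at infinity, or a point with non-integral `x`. -/
def IsFormal (v : AbsoluteValue (AlgebraicClosure K) ℝ) : Pts (cubicCurve F) K → Prop
  | .zero => True
  | .some x _ _ => 1 < baseAbs v x

theorem IsFormal.add (hv : IsLocalAbs v) (hint : ∀ i, baseAbs v (F.coeff i) ≤ 1)
    {P Q : Pts (cubicCurve F) K} (hP : IsFormal v P) (hQ : IsFormal v Q) : IsFormal v (P + Q) := by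
  rcases P with _ | ⟨x₁, y₁, h₁⟩
  · change IsFormal v (0 + Q); rwa [zero_add]
  rcases Q with _ | ⟨x₂, y₂, h₂⟩
  · change IsFormal v (_ + 0); rwa [add_zero]
  by_cases hxy : x₁ = x₂ ∧ y₁ = (WeierstrassCurve.baseChange (cubicCurve F) K).toAffine.negY x₂ y₂
  · rw [Point.add_of_Y_eq hxy.1 hxy.2]; trivial
  · rw [Point.add_some hxy]
    obtain ⟨e2, e1, e0⟩ := third_root_relations h₁ h₂ hxy
    exact one_lt_abs_third_root hv.base_nonarch hv.base_two.le (hint 2) (hint 1) (hint 0) e2 e1 e0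
      hP hQ

variable (F) in
/-- The formal group, as a subgroup of `E(K)`. -/
def formalSubgroup (hv : IsLocalAbs v) (hint : ∀ i, baseAbs v (F.coeff i) ≤ 1) :
    AddSubgroup (Pts (cubicCurve F) K) where
  carrier := {P | IsFormal v P}
  add_mem' := IsFormal.add hv hint
  zero_mem' := trivial
  neg_mem' {P} hP := by rcases P with _ | ⟨x, y, h⟩ <;> exact hP

theorem formal_two_torsion (hv : IsLocalAbs v) (hint : ∀ i, baseAbs v (F.coeff i) ≤ 1)
    {P : Pts (cubicCurve F) K} (hP : IsFormal v P) (h2 : 2 • P = 0) : P = 0 := by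
  rcases P with _ | ⟨x, y, h⟩
  · rfl
  · exfalso
    obtain rfl := two_nsmul_some_eq_zero_iff.mp h2
    have h3 : aeval (algebraMap K (AlgebraicClosure K) x) F = 0 := by
      rw [aeval_algebraMap_apply, coe_aeval_eq_eval, eval_eq_sum_range, hF.natDegree_eq]
      have := affine_equation h
      simp only [Finset.sum_range_succ, Finset.sum_range_zero, coeff_three]
      rw [show (0 : K) + F.coeff 0 * x ^ 0 + F.coeff 1 * x ^ 1 + F.coeff 2 * x ^ 2 + 1 * x ^ 3 = 0 by
        linear_combination -this, map_zero]
    rw [eval_eq_prod_emb, Finset.prod_eq_zero_iff] at h3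
    obtain ⟨φ, -, h3⟩ := h3
    have h4 := hv.rt_le_one hint φ
    rw [← sub_eq_zero.mp h3] at h4
    exact absurd hP (not_lt.mpr h4)

/-- Points of the formal group have trivial Kummer class. -/
theorem formal_kummer (hv : IsLocalAbs v) (hint : ∀ i, baseAbs v (F.coeff i) ≤ 1)
    {P : Pts (cubicCurve F) K} (hP : IsFormal v P) : kummerHom F (Multiplicative.ofAdd P) = 1 := by
  rcases P with _ | ⟨x, y, h⟩
  · exact kummerHom_eq_iff.mpr isKummerValue_zero
  have hx1 : 1 < v (algebraMap K _ x) := hP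
  have hx0 : algebraMap K (AlgebraicClosure K) x ≠ 0 := fun h0 => by
    rw [h0, map_zero] at hx1; linarith
  have hxK : x ≠ 0 := fun h0 => hx0 (by rw [h0, map_zero])
  have hne : ∀ φ : Emb F, algebraMap K _ x ≠ φ.rt := fun φ he => by
    have := hv.rt_le_one hint φ
    rw [← he] at this; linarith
  obtain ⟨α, h1, h2⟩ := exists_kummer_unit (F := F) x
  rw [kummerHom_eq_iff.mpr (isKummerValue_some h h1 h2), modSquares_coe_eq_one_iff]
  -- Since x - T = x(1 - T/x) and |T/x| < 1 at each embedding, x - T = x b².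
  obtain ⟨b, hb, -⟩ := hv.exists_sqrt_alg
    (a := 1 - AdjoinRoot.root F * algebraMap K (AdjoinRoot F) x⁻¹) fun φ => by
      rw [map_sub φ, map_one φ, map_mul φ, AlgHom.commutes, sub_sub_cancel_left, v.map_neg, v.map_mul,
        map_inv₀, map_inv₀, ← div_eq_mul_inv, div_lt_one (by linarith)]
      exact (hv.rt_le_one hint φ).trans_lt hx1
  have hφb : ∀ φ : Emb F, algebraMap K _ x * φ b ^ 2 = algebraMap K _ x - φ.rt := fun φ => by
    rw [← map_pow, hb, map_sub, map_one, map_mul, AlgHom.commutes, map_inv₀]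
    field_simp
  -- Taking norms gives y² = x³ N(b)², so the remaining factor x is the square of y / (x N(b)).
  have hN : algebraMap K (AlgebraicClosure K) (x ^ 3 * Algebra.norm K b ^ 2) =
      algebraMap K _ (y ^ 2) := by
    have h3 := (cubicCurve_nonsingular_iff (F := F) (L := AlgebraicClosure K) _ _).mp
      ((baseChange_nonsingular (cubicCurve F) (f := Algebra.ofId K (AlgebraicClosure K))
      (RingHom.injective _) x y).mpr h)
    have h4 : algebraMap K (AlgebraicClosure K) y ^ 2 = ∏ φ : Emb F, (algebraMap K _ x - φ.rt) := by
      rw [← eval_eq_prod_emb, aeval_cubic]; exact h3.1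
    rw [map_pow _ y, h4, ← Finset.prod_congr rfl fun φ _ => hφb φ, Finset.prod_mul_distrib,
      Finset.prod_const, Finset.card_univ, card_emb, map_mul, map_pow, map_pow, Emb.norm_eq_prod,
      Finset.prod_pow]
  have hN' := (algebraMap K (AlgebraicClosure K)).injective hN
  have hNb : Algebra.norm K b ≠ 0 := fun h0 => by
    have h5 := congrArg (algebraMap K (AlgebraicClosure K)) h0
    rw [Emb.norm_eq_prod, map_zero, Finset.prod_eq_zero_iff] at h5
    obtain ⟨φ, -, h5⟩ := h5
    have := hφb φ
    rw [h5] at this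
    exact sub_ne_zero.mpr (hne φ) (by rw [← this]; ring)
  set w : AdjoinRoot F := algebraMap K _ (y / (x * Algebra.norm K b)) * b with hw
  have hw2 : w ^ 2 = (α : AdjoinRoot F) := Emb.ext_elem fun φ => by
    rw [h1 φ (hne φ), ← hφb, hw, mul_pow, map_mul, map_pow, map_pow, AlgHom.commutes, ← map_pow]
    congr 2
    rw [div_pow, ← hN']
    field_simp
  have hwu : IsUnit w := by
    rw [← isUnit_pow_iff two_ne_zero, hw2]; exact α.isUnit
  exact ⟨hwu.unit, Units.ext hw2⟩

end FormalGroup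

section FiniteIndex

open scoped Classical

open WeierstrassCurve.Affine

variable {K : Type*} [Field K] [CharZero K] {F : K[X]} [hF : IsSquarefreeCubic F]
  {v : AbsoluteValue (AlgebraicClosure K) ℝ}

/-! ### The formal group has finite index -/

theorem eq_cubic : F = X ^ 3 + C (F.coeff 2) * X ^ 2 + C (F.coeff 1) * X + C (F.coeff 0) := by
  conv_lhs => rw [F.as_sum_range_C_mul_X_pow, hF.natDegree_eq]
  simp only [Finset.sum_range_succ, Finset.sum_range_zero, coeff_three, map_one]
  ring

theorem eval_cubic (x : K) :
    F.eval x = x ^ 3 + F.coeff 2 * x ^ 2 + F.coeff 1 * x + F.coeff 0 := by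
  conv_lhs => rw [eq_cubic (F := F)]
  simp

theorem eval_derivative_cubic (x : K) :
    (derivative F).eval x = 3 * x ^ 2 + 2 * F.coeff 2 * x + F.coeff 1 := by
  conv_lhs => rw [eq_cubic (F := F)]
  simp
  ring

theorem exists_eval_bound {L : Type*} [Field L] (w : AbsoluteValue L ℝ) (A : L[X]) :
    ∃ c : ℝ, 0 ≤ c ∧ ∀ x, w x ≤ 1 → w (A.eval x) ≤ c := by
  refine ⟨∑ i ∈ Finset.range (A.natDegree + 1), w (A.coeff i),
    Finset.sum_nonneg fun i _ => w.nonneg _, fun x hx => ?_⟩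
  rw [eval_eq_sum_range]
  refine (w.sum_le _ _).trans (Finset.sum_le_sum fun i _ => ?_)
  rw [w.map_mul, map_pow]
  exact mul_le_of_le_one_right (w.nonneg _) (pow_le_one₀ (w.nonneg _) hx)

variable (F) in
/-- `y` and `F'(x)` are not simultaneously small on integral points. -/
theorem exists_gradient_bound (w : AbsoluteValue K ℝ) : ∃ d : ℝ, 0 < d ∧ ∀ x y, w x ≤ 1 →
    w y ≤ 1 → y ^ 2 = F.eval x → d ≤ w y ∨ d ≤ w ((derivative F).eval x) := by
  -- In a Bézout identity AF + BF' = 1, the polynomials A and B are bounded by a and b on integral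
  -- x. If y and F'(x) were both smaller than 1/(a + b + 1), the left side would have absolute value
  -- below 1.
  obtain ⟨A, B, hAB⟩ := (PerfectField.separable_iff_squarefree).mpr hF.squarefree
  obtain ⟨a, ha0, ha⟩ := exists_eval_bound w A
  obtain ⟨b, hb0, hb⟩ := exists_eval_bound w B
  have hc : 0 < a + b + 1 := by linarith
  refine ⟨(a + b + 1)⁻¹, inv_pos.mpr hc, fun x y hx hy hxy => ?_⟩
  by_contra h
  push Not at h
  obtain ⟨h1, h2⟩ := h
  have h3 := congrArg (eval x) hAB
  rw [eval_add, eval_mul, eval_mul, eval_one, ← hxy] at h3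
  have h4 := congrArg w h3
  rw [w.map_one] at h4
  have h5 : w (eval x A * y ^ 2) ≤ a * (a + b + 1)⁻¹ := by
    rw [w.map_mul, map_pow]
    refine mul_le_mul (ha x hx) ?_ (by positivity) ha0
    nlinarith [w.nonneg y]
  have h6 : w (eval x B * eval x (derivative F)) ≤ b * (a + b + 1)⁻¹ := by
    rw [w.map_mul]
    exact mul_le_mul (hb x hx) h2.le (by positivity) hb0
  have h7 := w.add_le (eval x A * y ^ 2) (eval x B * eval x (derivative F))
  rw [h4] at h7
  have h8 : (a + b + 1) * (a + b + 1)⁻¹ = 1 := mul_inv_cancel₀ hc.ne'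
  have h9 := inv_pos.mpr hc
  nlinarith

/-- The slope l for the difference satisfies l(x₁ - x₂) = y₁ + y₂ and l(y₁ - y₂) = D, the divided
difference of F. As y₁ + y₂ is close to 2y₁ and D to F'(x₁), one right side is not small while both
differences are. Thus |l| > 1, and the formula for the third x-coordinate makes it non-integral. -/
theorem isFormal_sub_of_close (hv : IsLocalAbs v) (hint : ∀ i, baseAbs v (F.coeff i) ≤ 1) {d : ℝ}
    {x₁ y₁ x₂ y₂ : K}
    (h₁ : (WeierstrassCurve.baseChange (cubicCurve F) K).toAffine.Nonsingular x₁ y₁)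
    (h₂ : (WeierstrassCurve.baseChange (cubicCurve F) K).toAffine.Nonsingular x₂ y₂)
    (hx₁ : baseAbs v x₁ ≤ 1) (hx₂ : baseAbs v x₂ ≤ 1)
    (hd : d ≤ baseAbs v y₁ ∨ d ≤ baseAbs v ((derivative F).eval x₁))
    (hx : baseAbs v (x₁ - x₂) < d) (hy : baseAbs v (y₁ - y₂) < d) :
    IsFormal v (Point.some x₁ y₁ h₁ - Point.some x₂ y₂ h₂ : Pts (cubicCurve F) K) := by
  rw [sub_eq_add_neg, Point.neg_some]
  have hneg : (WeierstrassCurve.baseChange (cubicCurve F) K).toAffine.negY x₂ y₂ = -y₂ :=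
    cubicCurve_negY x₂ y₂
  by_cases hxy : x₁ = x₂ ∧ y₁ = (WeierstrassCurve.baseChange (cubicCurve F) K).toAffine.negY x₂
      ((WeierstrassCurve.baseChange (cubicCurve F) K).toAffine.negY x₂ y₂)
  · rw [Point.add_of_Y_eq hxy.1 hxy.2]; trivial
  rw [Point.add_some hxy]
  obtain ⟨e2, -, -⟩ := third_root_relations h₁ ((nonsingular_neg x₂ y₂).mpr h₂) hxy
  set l := (WeierstrassCurve.baseChange (cubicCurve F) K).toAffine.slope x₁ x₂ y₁
    ((WeierstrassCurve.baseChange (cubicCurve F) K).toAffine.negY x₂ y₂) with hl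
  set D := x₁ ^ 2 + x₁ * x₂ + x₂ ^ 2 + F.coeff 2 * (x₁ + x₂) + F.coeff 1 with hD
  have q₁ := affine_equation h₁
  have q₂ := affine_equation h₂
  -- In the tangent case the first relation reads 0 = 0 and the second is the slope formula.
  have hrel : l * (x₁ - x₂) = y₁ + y₂ ∧ l * (y₁ - y₂) = D := by
    by_cases hne : x₁ = x₂
    · subst hne
      have hne' : y₁ ≠ y₂ := fun h => hxy ⟨rfl, by rw [negY_negY, h]⟩
      have hyy : y₁ = -y₂ := by
        have : (y₁ - y₂) * (y₁ + y₂) = 0 := by linear_combination q₁ - q₂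
        rcases mul_eq_zero.mp this with h | h
        · exact absurd (sub_eq_zero.mp h) hne'
        · linear_combination h
      refine ⟨by rw [hyy]; ring, ?_⟩
      rw [negY_negY] at hxy
      have hy0 : y₁ ≠ (WeierstrassCurve.baseChange (cubicCurve F) K).toAffine.negY x₁
          ((WeierstrassCurve.baseChange (cubicCurve F) K).toAffine.negY x₁ y₂) := by
        rwa [negY_negY]
      rw [hl, slope_of_Y_ne rfl hy0, cubicCurve_negY, sub_neg_eq_add]
      have h2y : y₁ + y₁ ≠ 0 := fun h => hne' (by linear_combination h - hyy)
      rw [div_mul_eq_mul_div, div_eq_iff h2y, hD]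
      simp only [cubicCurve, WeierstrassCurve.baseChange, WeierstrassCurve.map,
        Algebra.algebraMap_self, RingHom.id_apply, map_zero]
      rw [hyy]; ring
    · have h1 : l * (x₁ - x₂) = y₁ + y₂ := by
        rw [hl, slope_of_X_ne hne, hneg, div_mul_cancel₀ _ (sub_ne_zero.mpr hne), sub_neg_eq_add]
      refine ⟨h1, mul_right_cancel₀ (sub_ne_zero.mpr hne) ?_⟩
      rw [hD]
      linear_combination (y₁ - y₂) * h1 + q₁ - q₂
  have hl1 : 1 < baseAbs v l := by
    by_contra hle
    push Not at hle
    rcases hd with hd | hd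
    · have h3 : baseAbs v (y₁ + y₂) < d := by
        rw [← hrel.1, AbsoluteValue.map_mul]
        exact (mul_le_of_le_one_left (AbsoluteValue.nonneg _ _) hle).trans_lt hx
      have h4 : baseAbs v (2 * y₁) < d := by
        rw [show 2 * y₁ = (y₁ + y₂) + (y₁ - y₂) by ring]
        exact (hv.base_nonarch _ _).trans_lt (max_lt h3 hy)
      rw [AbsoluteValue.map_mul, hv.base_two, one_mul] at h4
      exact absurd hd (not_le.mpr h4)
    · have h3 : baseAbs v D < d := by
        rw [← hrel.2, AbsoluteValue.map_mul]
        exact (mul_le_of_le_one_left (AbsoluteValue.nonneg _ _) hle).trans_lt hy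
      have h4 : baseAbs v ((x₁ - x₂) * (x₂ + 2 * x₁ + F.coeff 2)) < d := by
        rw [AbsoluteValue.map_mul]
        refine (mul_le_of_le_one_right (AbsoluteValue.nonneg _ _) ?_).trans_lt hx
        refine hv.base_add_le (hv.base_add_le hx₂ ?_) (hint 2)
        rw [AbsoluteValue.map_mul, hv.base_two, one_mul]; exact hx₁
      rw [eval_derivative_cubic, show 3 * x₁ ^ 2 + 2 * F.coeff 2 * x₁ + F.coeff 1 =
        D + (x₁ - x₂) * (x₂ + 2 * x₁ + F.coeff 2) by rw [hD]; ring] at hd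
      exact absurd hd (not_le.mpr ((hv.base_nonarch _ _).trans_lt (max_lt h3 h4)))
  change 1 < baseAbs v _
  by_contra hle
  push Not at hle
  have h5 : baseAbs v (l ^ 2) ≤ 1 := by
    rw [e2]
    exact hv.base_add_le (hv.base_add_le (hv.base_add_le hx₁ hx₂) hle) (hint 2)
  rw [map_pow] at h5
  nlinarith

theorem abs_y_le_one (hv : IsLocalAbs v) (hint : ∀ i, baseAbs v (F.coeff i) ≤ 1) {x y : K}
    (h : (WeierstrassCurve.baseChange (cubicCurve F) K).toAffine.Nonsingular x y)
    (hx : baseAbs v x ≤ 1) : baseAbs v y ≤ 1 := by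
  have h1 : baseAbs v y ^ 2 ≤ 1 := by
    rw [← map_pow, affine_equation h]
    refine hv.base_add_le (hv.base_add_le (hv.base_add_le ?_ ?_) ?_) (hint 0)
    · rw [map_pow]; exact pow_le_one₀ (AbsoluteValue.nonneg _ _) hx
    · rw [AbsoluteValue.map_mul, map_pow]
      exact mul_le_one₀ (hint 2) (by positivity) (pow_le_one₀ (AbsoluteValue.nonneg _ _) hx)
    · rw [AbsoluteValue.map_mul]
      exact mul_le_one₀ (hint 1) (AbsoluteValue.nonneg _ _) hx
  exact (sq_le_one_iff₀ (AbsoluteValue.nonneg _ _)).mp h1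

/-- Integral points with equal colours are closer than the gradient bound, so they differ by a
formal point; all formal points share the colour `none`. -/
theorem formalSubgroup_finiteIndex (hv : IsLocalAbs v) (hint : ∀ i, baseAbs v (F.coeff i) ≤ 1) :
    (formalSubgroup F hv hint).toSubgroup.FiniteIndex := by
  obtain ⟨d, hd0, hd⟩ := exists_gradient_bound F (baseAbs v)
  obtain ⟨n, q, hq⟩ := hv.colouring 1 d hd0
  let f : Pts (cubicCurve F) K → Option (Fin n × Fin n) := fun P =>
    match P with
    | .zero => none
    | .some x y _ => if 1 < baseAbs v x then none else some (q x, q y)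
  have hnone : ∀ P, f P = none → IsFormal v P := fun P hP => by
    rcases P with _ | ⟨x, y, h⟩
    · trivial
    · by_contra hlt
      have hlt' : ¬ 1 < baseAbs v x := hlt
      simp only [f, if_neg hlt'] at hP
      cases hP
  refine finiteIndex_of_finite_colouring (G := Multiplicative (Pts (cubicCurve F) K))
    (fun P => f P.toAdd) (formalSubgroup F hv hint).toSubgroup fun P Q hPQ => ?_
  change P.toAdd - Q.toAdd ∈ formalSubgroup F hv hint
  generalize P.toAdd = P at *
  generalize Q.toAdd = Q at *
  change f P = f Q at hPQ
  by_cases hP : f P = none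
  · exact sub_mem (hnone P hP) (hnone Q (hPQ ▸ hP))
  rcases P with _ | ⟨x₁, y₁, h₁⟩
  · exact absurd rfl hP
  rcases Q with _ | ⟨x₂, y₂, h₂⟩
  · exact absurd hPQ hP
  by_cases hx₁ : 1 < baseAbs v x₁
  · simp only [f, if_pos hx₁] at hP; exact absurd trivial hP
  by_cases hx₂ : 1 < baseAbs v x₂
  · rw [hPQ] at hP
    simp only [f, if_pos hx₂] at hP; exact absurd trivial hP
  simp only [f, if_neg hx₁, if_neg hx₂, Option.some.injEq, Prod.mk.injEq] at hPQ
  push Not at hx₁ hx₂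
  have hy₁ := abs_y_le_one hv hint h₁ hx₁
  have hy₂ := abs_y_le_one hv hint h₂ hx₂
  refine isFormal_sub_of_close hv hint h₁ h₂ hx₁ hx₂
    (hd x₁ y₁ hx₁ hy₁ (by rw [eval_cubic]; exact affine_equation h₁)) ?_ ?_
  · rw [baseAbs_apply, map_sub]; exact hq _ _ hx₁ hx₂ hPQ.1
  · rw [baseAbs_apply, map_sub]; exact hq _ _ hy₁ hy₂ hPQ.2

/-- If all Kummer classes are classes of units, they are all the unit classes of square norm. -/
theorem range_kummerHom_eq (hv : IsLocalAbs v) (hint : ∀ i, baseAbs v (F.coeff i) ≤ 1)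
    (h : ∀ P, kummerHom F (Multiplicative.ofAdd P) ∈ (absUnits v F).map (QuotientGroup.mk' _)) :
    (kummerHom F).range = absUnitClasses v F := by
  have := formalSubgroup_finiteIndex hv hint
  obtain ⟨h1, h2⟩ := card_two_torsion_le_card_range (kummerHom F)
    (formalSubgroup F hv hint).toSubgroup
    (fun P hP => formal_kummer hv hint (P := P.toAdd) hP)
    (fun P hP => by
      obtain ⟨R, hR⟩ := ((kummerHom_eq_iff (P := P.toAdd)).mp hP).exists_two_nsmul
      exact ⟨Multiplicative.ofAdd R, by rw [← ofAdd_nsmul, hR, ofAdd_toAdd]⟩)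
    (fun P hP h2 => congrArg Multiplicative.ofAdd
      (formal_two_torsion hv hint (P := P.toAdd) hP (congrArg Multiplicative.toAdd h2)))
  obtain ⟨h3, h4⟩ := card_absUnitClasses_le (F := F) hv
  have hle : (kummerHom F).range ≤ absUnitClasses v F := by
    rintro _ ⟨P, rfl⟩
    exact ⟨h P.toAdd, (isKummerValue_kummerHom P.toAdd).mem_squareNorm⟩
  -- The unit classes number at most #E(K)[2], which is at most the size of the image contained in
  -- them.
  exact Subgroup.eq_of_le_of_card_ge hle (h4.trans h2)

end FiniteIndex

section UnitClasses

open scoped Classical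

open WeierstrassCurve.Affine

variable {K : Type*} [Field K] [CharZero K] {F : K[X]} [hF : IsSquarefreeCubic F]
  {v : AbsoluteValue (AlgebraicClosure K) ℝ}

/-! ### Kummer classes of points with nonsingular reduction -/

theorem mem_absUnits_map {α w : (AdjoinRoot F)ˣ}
    (h : ∀ φ : Emb F, v (φ (α : AdjoinRoot F)) = v (φ (w : AdjoinRoot F)) ^ 2) :
    (α : ModSquares (AdjoinRoot F)) ∈ (absUnits v F).map (QuotientGroup.mk' _) := by
  refine ⟨α * (w⁻¹) ^ 2, fun φ => ?_, ?_⟩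
  · have h1 : φ (w : AdjoinRoot F) * φ ((w⁻¹ : (AdjoinRoot F)ˣ) : AdjoinRoot F) = 1 := by
      rw [← map_mul, Units.mul_inv, map_one]
    rw [Units.val_mul, map_mul, v.map_mul, h, Units.val_pow_eq_pow_val, map_pow, map_pow,
      ← mul_pow, ← v.map_mul, h1, v.map_one, one_pow]
  · exact QuotientGroup.eq.mpr ⟨w, by simp⟩

theorem mem_absUnits_map_of_const {α : (AdjoinRoot F)ˣ} {c : K} (hc : c ≠ 0)
    (h : ∀ φ : Emb F, v (φ (α : AdjoinRoot F)) = v (algebraMap K _ c) ^ 2) :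
    (α : ModSquares (AdjoinRoot F)) ∈ (absUnits v F).map (QuotientGroup.mk' _) := by
  refine mem_absUnits_map (w := Units.map (algebraMap K (AdjoinRoot F) : K →* AdjoinRoot F)
    (Units.mk0 c hc)) fun φ => ?_
  rw [h]
  exact congrArg (fun z => v z ^ 2) (AlgHom.commutes φ c).symm

theorem IsTriple.eval_derivative {φ₁ φ₂ φ₃ : Emb F} (htr : IsTriple φ₁ φ₂ φ₃) (x : K) :
    algebraMap K (AlgebraicClosure K) ((derivative F).eval x) =
      (algebraMap K _ x - φ₂.rt) * (algebraMap K _ x - φ₃.rt) +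
      (algebraMap K _ x - φ₁.rt) * ((algebraMap K _ x - φ₂.rt) + (algebraMap K _ x - φ₃.rt)) := by
  rw [← coe_aeval_eq_eval, ← aeval_algebraMap_apply, ← eval_map_algebraMap,
    ← derivative_map, map_eq_prod_emb, htr.prod]
  simp [derivative_mul]
  ring

theorem abs_y_sq {x y : K}
    (h : (WeierstrassCurve.baseChange (cubicCurve F) K).toAffine.Nonsingular x y) :
    baseAbs v y ^ 2 = ∏ φ : Emb F, v (algebraMap K _ x - φ.rt) := by
  have h3 : algebraMap K (AlgebraicClosure K) (y ^ 2) =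
      ∏ φ : Emb F, (algebraMap K _ x - φ.rt) := by
    rw [← eval_eq_prod_emb, aeval_algebraMap_apply, coe_aeval_eq_eval, eval_cubic,
      affine_equation h]
  rw [← map_prod, ← h3, ← map_pow]; rfl

/-- A point of nonsingular reduction, on the model obtained by `x = u²x' + r`, `y = u³y'`, has the
Kummer class of a unit. -/
theorem kummer_mem_of_nonsingular (hv : IsLocalAbs v) {x y : K}
    (h : (WeierstrassCurve.baseChange (cubicCurve F) K).toAffine.Nonsingular x y) {u r : K}
    (hu : u ≠ 0) (hr : ∀ φ : Emb F, v (φ.rt - algebraMap K _ r) ≤ baseAbs v u ^ 2)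
    (hns : baseAbs v u ^ 2 < baseAbs v (x - r) ∨ baseAbs v y = baseAbs v u ^ 3 ∨
      baseAbs v ((derivative F).eval x) = baseAbs v u ^ 4) :
    kummerHom F (Multiplicative.ofAdd (Point.some x y h)) ∈
      (absUnits v F).map (QuotientGroup.mk' _) := by
  obtain ⟨α, h1, h2⟩ := exists_kummer_unit (F := F) x
  rw [kummerHom_eq_iff.mpr (isKummerValue_some h h1 h2)]
  have hvu : 0 < baseAbs v u := (baseAbs v).pos hu
  have hprod := abs_y_sq (v := v) h
  have hdist : ∀ φ : Emb F, v ((algebraMap K _ x - φ.rt) - algebraMap K _ (x - r)) ≤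
      baseAbs v u ^ 2 := fun φ => by
    rw [map_sub (algebraMap K _), show algebraMap K _ x - φ.rt - (algebraMap K _ x - algebraMap K _ r) =
      -(φ.rt - algebraMap K _ r) by ring, v.map_neg]
    exact hr φ
  -- Far from the roots all three factors have size |x - r|. Then |y|² = |x - r|³, and each factor
  -- has the size of (y / (x - r))².
  by_cases hbig : baseAbs v u ^ 2 < baseAbs v (x - r)
  · have he : ∀ φ : Emb F, v (algebraMap K _ x - φ.rt) = baseAbs v (x - r) := fun φ =>
      hv.eq_of_sub_lt ((hdist φ).trans_lt hbig)
    have hpos : 0 < baseAbs v (x - r) := lt_trans (by positivity) hbig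
    have hy : baseAbs v y ^ 2 = baseAbs v (x - r) ^ 3 := by
      rw [hprod, Finset.prod_congr rfl fun φ _ => he φ, Finset.prod_const, Finset.card_univ, card_emb]
    have hy0 : y ≠ 0 := fun h0 => by
      rw [h0, map_zero, zero_pow two_ne_zero] at hy
      exact (pow_pos hpos 3).ne hy
    have hxr : x - r ≠ 0 := fun h0 => by rw [h0, map_zero] at hpos; exact lt_irrefl _ hpos
    refine mem_absUnits_map_of_const (c := y / (x - r)) (div_ne_zero hy0 hxr) fun φ => ?_
    have hne : algebraMap K _ x ≠ φ.rt := fun h0 => by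
      have := he φ
      rw [h0, sub_self, map_zero] at this
      exact hpos.ne this
    rw [h1 φ hne, he, ← baseAbs_apply, map_div₀, div_pow, hy]
    field_simp
  · have hns' := hns.resolve_left hbig
    push Not at hbig
    have hle : ∀ φ : Emb F, v (algebraMap K _ x - φ.rt) ≤ baseAbs v u ^ 2 := fun φ => by
      have := hv.add_le (hdist φ) (b := algebraMap K _ (x - r)) hbig
      rwa [sub_add_cancel] at this
    set t := baseAbs v u ^ 2 with ht
    have htpos : 0 < t := by positivity
    by_cases hall : ∀ φ : Emb F, v (algebraMap K _ x - φ.rt) = t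
    · refine mem_absUnits_map_of_const (c := u) hu fun φ => ?_
      have hne : algebraMap K _ x ≠ φ.rt := fun h0 => by
        have := hall φ
        rw [h0, sub_self, map_zero] at this
        exact htpos.ne this
      rw [h1 φ hne, hall, ht]; rfl
    · push Not at hall
      obtain ⟨φ₁, hφ₁⟩ := hall
      have hlt : v (algebraMap K _ x - φ₁.rt) < t := lt_of_le_of_ne (hle φ₁) hφ₁
      obtain ⟨φ₂, φ₃, htr⟩ := exists_triple_of φ₁
      rw [htr.prod] at hprod
      have hl2 := hle φ₂
      have hl3 := hle φ₃
      have n1 := v.nonneg (algebraMap K _ x - φ₁.rt)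
      have n2 := v.nonneg (algebraMap K _ x - φ₂.rt)
      have n3 := v.nonneg (algebraMap K _ x - φ₃.rt)
      -- One factor is now smaller than |u|², so |y| < |u|³ and nonsingularity must come from F'(x).
      -- Its exact size forces the other two factors to have size exactly |u|².
      rcases hns' with hy | hF'
      · exfalso
        have h4 : v (algebraMap K _ x - φ₁.rt) * v (algebraMap K _ x - φ₂.rt) *
            v (algebraMap K _ x - φ₃.rt) < t * t * t := by
          calc _ ≤ v (algebraMap K _ x - φ₁.rt) * t * t := by gcongr
            _ < _ := by gcongr
        rw [← hprod, hy] at h4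
        have : (baseAbs v u ^ 3) ^ 2 = t * t * t := by rw [ht]; ring
        linarith
      · have hder := htr.eval_derivative x
        have h23 : v ((algebraMap K _ x - φ₂.rt) * (algebraMap K _ x - φ₃.rt)) = t * t := by
          have h5 : t * t = v (algebraMap K (AlgebraicClosure K) ((derivative F).eval x)) := by
            rw [← baseAbs_apply, hF', ht]; ring
          rw [h5]
          refine hv.eq_of_sub_lt ?_
          rw [← h5, hder, sub_add_cancel_left, v.map_neg, v.map_mul]
          exact (mul_le_mul_of_nonneg_left (hv.add_le hl2 hl3) n1).trans_lt
            (mul_lt_mul_of_pos_right hlt htpos)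
        have h2' : v (algebraMap K _ x - φ₂.rt) = t := by
          rw [v.map_mul] at h23
          nlinarith
        have h3' : v (algebraMap K _ x - φ₃.rt) = t := by
          rw [v.map_mul] at h23
          nlinarith
        -- The small factor has size |y|²/|u|⁴ = |y / u²|². When y = 0 it is replaced in α by F'(x),
        -- of size |u|⁴ = |u²|².
        set c : K := if y = 0 then u ^ 2 else y / u ^ 2 with hc
        have hc0 : c ≠ 0 := by
          rw [hc]; split_ifs with hy0
          · exact pow_ne_zero 2 hu
          · exact div_ne_zero hy0 (pow_ne_zero 2 hu)
        -- The value c at the small factor and u elsewhere is equivariant, because the absolute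
        -- value is Galois invariant.
        obtain ⟨w, hw⟩ := Emb.descent_units (fun φ : Emb F =>
            if v (algebraMap K _ x - φ.rt) < t then algebraMap K (AlgebraicClosure K) c
              else algebraMap K (AlgebraicClosure K) u)
          (fun σ φ => by
            have : v (algebraMap K _ x - (Emb.act σ φ).rt) = v (algebraMap K _ x - φ.rt) := by
              rw [← hv.gal σ (algebraMap K _ x - φ.rt), map_sub σ, σ.commutes]; rfl
            rw [this]
            split_ifs <;> exact σ.commutes _)
          (fun φ => by
            split_ifs
            · exact (_root_.map_ne_zero _).mpr hc0
            · exact (_root_.map_ne_zero _).mpr hu)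
        refine mem_absUnits_map (w := w) fun φ => ?_
        rw [hw]
        by_cases hlt' : v (algebraMap K _ x - φ.rt) < t
        · rw [if_pos hlt']
          obtain rfl : φ = φ₁ := by
            rcases htr.cases φ with h | rfl | rfl
            · exact h
            · exact absurd h2' hlt'.ne
            · exact absurd h3' hlt'.ne
          rw [h2', h3'] at hprod
          by_cases hy0 : y = 0
          · have hx : algebraMap K _ x = φ.rt := by
              rw [hy0, map_zero, zero_pow two_ne_zero, eq_comm, mul_eq_zero, mul_eq_zero] at hprod
              rcases hprod with (h | h) | h
              · exact sub_eq_zero.mp (v.eq_zero.mp h)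
              · exact absurd h htpos.ne'
              · exact absurd h htpos.ne'
            rw [h2 φ hx, ← hx, aeval_algebraMap_apply, coe_aeval_eq_eval, hc, if_pos hy0,
              ← baseAbs_apply, ← baseAbs_apply, hF', map_pow]
            ring
          · have hx : algebraMap K _ x ≠ φ.rt := fun h0 => by
              rw [h0, sub_self, map_zero, zero_mul, zero_mul] at hprod
              exact hy0 ((baseAbs v).eq_zero.mp (sq_eq_zero_iff.mp hprod))
            rw [h1 φ hx, hc, if_neg hy0, ← baseAbs_apply, map_div₀, map_pow, ← ht, div_pow, hprod]
            field_simp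
        · rw [if_neg hlt']
          have heq : v (algebraMap K _ x - φ.rt) = t := le_antisymm (hle φ) (not_lt.mp hlt')
          have hne : algebraMap K _ x ≠ φ.rt := fun h0 => by
            rw [h0, sub_self, map_zero] at heq
            exact htpos.ne heq
          rw [h1 φ hne, heq, ht]; rfl

/-- If the cubic algebra is a field, all classes of square norm are classes of units. -/
theorem squareNorm_le_of_isField (hv : IsLocalAbs v) (hfield : IsField (AdjoinRoot F)) :
    squareNorm F ≤ (absUnits v F).map (QuotientGroup.mk' _) := by
  intro a ha
  induction a using QuotientGroup.induction_on with
  | H a =>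
    obtain ⟨c, hc⟩ := (mem_squareNorm_iff a).mp ha
    obtain ⟨h1, h2⟩ := cube_div_norm hc
    refine ⟨_, ?_, h1⟩
    generalize a ^ 3 / (Units.map (algebraMap K (AdjoinRoot F) : K →* AdjoinRoot F) c) ^ 2 = u at h2
    have hirr : Irreducible F := by
      have := Ideal.Quotient.maximal_of_isField _ hfield
      exact ((Ideal.span_singleton_prime hF.ne_zero).mp this.isPrime).irreducible
    -- All roots are conjugate when F is irreducible, so all embeddings of u have the same absolute
    -- value.
    have heq : ∀ φ ψ : Emb F, v (φ (u : AdjoinRoot F)) = v (ψ (u : AdjoinRoot F)) := fun φ ψ => by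
      have hm : ∀ φ : Emb F, minpoly K φ.rt = F := fun φ =>
        (minpoly.eq_of_irreducible_of_monic hirr φ.aeval_rt hF.monic).symm
      obtain ⟨σ, hσ⟩ := isConjRoot_iff_exists_algEquiv.mp
        (show IsConjRoot K φ.rt ψ.rt from (hm φ).trans (hm ψ).symm)
      obtain rfl : φ = Emb.act σ ψ := Emb.ext_rt hσ.symm
      exact hv.gal σ _
    obtain ⟨φ₀, -, -, -⟩ := exists_triple F
    have hpow : v (φ₀ (u : AdjoinRoot F)) ^ 3 = 1 := by
      have h3 : Algebra.norm K (u : AdjoinRoot F) = 1 := congrArg Units.val h2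
      have h4 := Emb.norm_eq_prod (u : AdjoinRoot F)
      rw [h3, map_one] at h4
      have h5 := congrArg v h4
      rw [map_prod, map_one, Finset.prod_congr rfl fun φ _ => heq φ φ₀, Finset.prod_const,
        Finset.card_univ, card_emb] at h5
      exact h5.symm
    intro φ
    rw [heq φ φ₀]
    exact (pow_eq_one_iff_of_nonneg (v.nonneg _) three_ne_zero).mp hpow

end UnitClasses

section Spectral

/-! ### The absolute value of a finite extension of `ℚ_p` -/

variable (p : ℕ) [Fact p.Prime] (K : Type*) [Field K] [Algebra ℚ_[p] K]
  [FiniteDimensional ℚ_[p] K]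

instance : Algebra.IsAlgebraic ℚ_[p] (AlgebraicClosure K) :=
  Algebra.IsAlgebraic.trans ℚ_[p] K (AlgebraicClosure K)

/-- The spectral norm as an absolute value on the algebraic closure. -/
noncomputable def spectralAbs : AbsoluteValue (AlgebraicClosure K) ℝ where
  toFun := spectralNorm ℚ_[p] (AlgebraicClosure K)
  map_mul' := spectralAlgNorm_mul
  nonneg' := spectralNorm_nonneg
  eq_zero' x := ⟨fun h => eq_zero_of_map_spectralNorm_eq_zero h (Algebra.IsAlgebraic.isAlgebraic x),
    fun h => by rw [h, spectralNorm_zero]⟩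
  add_le' x y := (isNonarchimedean_spectralNorm (K := ℚ_[p]) x y).trans
    (max_le_add_of_nonneg (spectralNorm_nonneg _) (spectralNorm_nonneg _))

theorem spectralAbs_apply (x : AlgebraicClosure K) :
    spectralAbs p K x = spectralNorm ℚ_[p] (AlgebraicClosure K) x := rfl

theorem base_spectralAbs (x : K) : baseAbs (spectralAbs p K) x = spectralNorm ℚ_[p] K x :=
  (spectralNorm.eq_of_tower x).symm

variable [Algebra ℤ_[p] K] [IsScalarTower ℤ_[p] ℚ_[p] K]

theorem spectralAbs_le_one_iff (x : AlgebraicClosure K) :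
    spectralAbs p K x ≤ 1 ↔ IsIntegral ℤ_[p] x := by
  have hx : IsIntegral ℚ_[p] x := Algebra.IsIntegral.isIntegral x
  rw [spectralAbs_apply, spectralNorm, spectralValue_le_one_iff (minpoly.monic hx)]
  constructor
  · intro h
    have hl : minpoly ℚ_[p] x ∈ lifts (algebraMap ℤ_[p] ℚ_[p]) := by
      rw [lifts_iff_coeff_lifts]
      intro n
      exact ⟨⟨_, h n⟩, rfl⟩
    obtain ⟨g, hg, -, hm⟩ := lifts_and_natDegree_eq_and_monic hl (minpoly.monic hx)
    refine ⟨g, hm, ?_⟩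
    have := minpoly.aeval ℚ_[p] x
    rw [← hg, aeval_map_algebraMap] at this
    exact this
  · intro h n
    have hm := minpoly.isIntegrallyClosed_eq_field_fractions ℚ_[p] (AlgebraicClosure K) h
    rw [Algebra.algebraMap_self_apply] at hm
    rw [hm, coeff_map]
    exact PadicInt.norm_le_one _

theorem base_le_one_iff (x : K) : baseAbs (spectralAbs p K) x ≤ 1 ↔ x ∈ Integers p K := by
  rw [base_spectralAbs, mem_integers_iff]

theorem base_integers_le_one (x : Integers p K) :
    baseAbs (spectralAbs p K) (algebraMap (Integers p K) K x) ≤ 1 :=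
  (base_le_one_iff p K _).mpr x.2

theorem isUnit_iff_base_eq_one (x : Integers p K) :
    IsUnit x ↔ baseAbs (spectralAbs p K) (algebraMap (Integers p K) K x) = 1 := by
  rw [base_spectralAbs, isUnit_integers_iff]; rfl

theorem finite_quotient_pow (m : ℕ) :
    Finite (Integers p K ⧸ (Ideal.span {(p : ℤ_[p]) ^ m} • (⊤ : Submodule ℤ_[p] (Integers p K)))) := by
  have h1 : Module.Finite ℤ_[p] (Integers p K) :=
    IsIntegralClosure.finite ℤ_[p] ℚ_[p] K (Integers p K)
  have h2 : Finite (ℤ_[p] ⧸ Ideal.span {(p : ℤ_[p]) ^ m}) := by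
    rw [← PadicInt.ker_toZModPow]
    have : NeZero (p ^ m) := ⟨pow_ne_zero m (Fact.out : p.Prime).ne_zero⟩
    exact Finite.of_injective _ (RingHom.kerLift_injective (PadicInt.toZModPow (p := p) m))
  exact Submodule.finite_quotient_smul _ (Module.finite_def.mp h1)

theorem base_p_pow (m : ℕ) :
    baseAbs (spectralAbs p K) (algebraMap ℚ_[p] K ((p : ℚ_[p]) ^ m)) = ((p : ℝ) ^ m)⁻¹ := by
  rw [base_spectralAbs, spectralNorm_extends, Padic.norm_p_pow, zpow_neg, zpow_natCast]

/-- Multiplication by p^k, with p^k > M, moves the ball into the ring of integers, which is finite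
modulo p^m. Equal residues give |x - y| ≤ p^k / p^m < ε. -/
theorem spectralAbs_colouring (M ε : ℝ) (hε : 0 < ε) : ∃ (n : ℕ) (q : K → Fin n), ∀ x y,
    baseAbs (spectralAbs p K) x ≤ M → baseAbs (spectralAbs p K) y ≤ M → q x = q y →
      baseAbs (spectralAbs p K) (x - y) < ε := by
  classical
  have hp1 : (1 : ℝ) < p := by exact_mod_cast (Fact.out : p.Prime).one_lt
  obtain ⟨k, hk⟩ := pow_unbounded_of_one_lt M hp1
  obtain ⟨m, hm⟩ := pow_unbounded_of_one_lt ((p : ℝ) ^ k / ε) hp1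
  have := finite_quotient_pow p K m
  set J := Integers p K ⧸ (Ideal.span {(p : ℤ_[p]) ^ m} • (⊤ : Submodule ℤ_[p] (Integers p K)))
  obtain ⟨n, ⟨e⟩⟩ := Finite.exists_equiv_fin J
  set P := algebraMap ℚ_[p] K ((p : ℚ_[p]) ^ k) with hP
  have hpk : 0 < (p : ℝ) ^ k := by positivity
  have hmem : ∀ x, baseAbs (spectralAbs p K) x ≤ M → P * x ∈ Integers p K := fun x hx => by
    rw [← base_le_one_iff, AbsoluteValue.map_mul, hP, base_p_pow, inv_mul_le_iff₀ hpk, mul_one]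
    exact hx.trans hk.le
  -- The default 0 is taken only where p^k x is not integral, hence only outside the ball of radius
  -- M.
  refine ⟨n, fun x => e (if h : P * x ∈ Integers p K then Submodule.Quotient.mk ⟨_, h⟩ else 0),
    fun x y hx hy hq => ?_⟩
  have hq' := e.injective hq
  rw [dif_pos (hmem x hx), dif_pos (hmem y hy), Submodule.Quotient.eq,
    Submodule.ideal_span_singleton_smul, Submodule.mem_smul_pointwise_iff_exists] at hq'
  obtain ⟨z, -, hz⟩ := hq'
  have hz' : algebraMap ℚ_[p] K ((p : ℚ_[p]) ^ m) * (z : K) = P * (x - y) := by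
    have := congrArg (fun t : Integers p K => (t : K)) hz
    simp only [AddSubgroupClass.coe_sub, Algebra.smul_def] at this
    rw [mul_sub, ← this]
    simp
  have h1 := congrArg (baseAbs (spectralAbs p K)) hz'
  rw [AbsoluteValue.map_mul, AbsoluteValue.map_mul, hP, base_p_pow, base_p_pow] at h1
  have h2 : baseAbs (spectralAbs p K) (z : K) ≤ 1 := base_integers_le_one p K z
  have hpm : 0 < (p : ℝ) ^ m := by positivity
  have h3 : baseAbs (spectralAbs p K) (x - y) =
      (p : ℝ) ^ k / (p : ℝ) ^ m * baseAbs (spectralAbs p K) (z : K) := by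
    field_simp at h1 ⊢
    linarith
  rw [h3]
  refine (mul_le_of_le_one_right (by positivity) h2).trans_lt ?_
  rw [div_lt_iff₀ hpm]
  rw [div_lt_iff₀ hε] at hm
  linarith

theorem isLocalAbs_spectralAbs
    (hk : 2 < ringChar (IsLocalRing.ResidueField (Integers p K))) :
    IsLocalAbs (spectralAbs p K) where
  nonarch := isNonarchimedean_spectralNorm (K := ℚ_[p]) (L := AlgebraicClosure K)
  gal σ a := (spectralNorm_eq_of_equiv (σ.restrictScalars ℚ_[p]) a).symm
  two := by
    have h1 : IsUnit (2 : Integers p K) := by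
      rw [← IsLocalRing.residue_ne_zero_iff_isUnit]
      intro h0
      rw [map_ofNat] at h0
      have := Nat.le_of_dvd two_pos (ringChar.dvd (R := IsLocalRing.ResidueField (Integers p K))
        (x := 2) (by exact_mod_cast h0))
      omega
    rw [isUnit_iff_base_eq_one, map_ofNat, baseAbs_apply, map_ofNat] at h1
    exact h1
  colouring M ε hε := by
    obtain ⟨n, q, hq⟩ := spectralAbs_colouring p K M ε hε
    refine ⟨n, q, fun x y hx hy hxy => ?_⟩
    rw [← map_sub]
    exact hq x y hx hy hxy

end Spectral

section Integral

variable {p : ℕ} [Fact p.Prime] {K : Type*} [Field K] [CharZero K] [Algebra ℚ_[p] K]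
  [FiniteDimensional ℚ_[p] K] [Algebra ℤ_[p] K] [IsScalarTower ℤ_[p] ℚ_[p] K]
  {F : K[X]} [hF : IsSquarefreeCubic F]

/-! ### Integral elements of the cubic algebra -/

/-- Conversely, the product of monic equations satisfied by the conjugates kills a at every
embedding, hence kills a. -/
theorem mem_algIntegers_iff (a : AdjoinRoot F) :
    a ∈ AlgIntegers (Integers p K) F ↔ ∀ φ : Emb F, spectralAbs p K (φ a) ≤ 1 := by
  constructor
  · intro h φ
    rw [spectralAbs_le_one_iff]
    have h1 : IsIntegral (Integers p K) (φ a) := by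
      have h2 : IsIntegral (Integers p K) a := h
      exact h2.map (φ.restrictScalars (Integers p K))
    exact isIntegral_trans (R := ℤ_[p]) (A := Integers p K) _ h1
  · intro h
    simp only [spectralAbs_le_one_iff] at h
    choose f hf hfa using h
    have h1 : IsIntegral ℤ_[p] a := by
      refine ⟨∏ φ : Emb F, f φ, monic_prod_of_monic _ _ fun φ _ => hf φ, ?_⟩
      change aeval a (∏ φ : Emb F, f φ) = 0
      refine Emb.ext_elem fun φ => ?_
      have h2 : φ (aeval a (∏ φ : Emb F, f φ)) = aeval (φ a) (∏ φ : Emb F, f φ) :=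
        (aeval_algHom_apply (φ.restrictScalars ℤ_[p]) a _).symm
      rw [h2, map_zero, map_prod]
      exact Finset.prod_eq_zero (Finset.mem_univ φ) (hfa φ)
    exact h1.tower_top

theorem map_integralSquareNorm_eq :
    (integralSquareNorm (Integers p K) F).map (integersToAlg (Integers p K) F) =
      absUnitClasses (spectralAbs p K) F := by
  ext a
  constructor
  · rintro ⟨b, hb, rfl⟩
    refine ⟨?_, hb⟩
    induction b using QuotientGroup.induction_on with
    | H u =>
      refine ⟨Units.map ((AlgIntegers (Integers p K) F).val :
        AlgIntegers (Integers p K) F →* AdjoinRoot F) u, fun φ => ?_, rfl⟩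
      have h1 := (mem_algIntegers_iff _).mp (u : AlgIntegers (Integers p K) F).2 φ
      have h2 := (mem_algIntegers_iff _).mp ((u⁻¹ : (AlgIntegers (Integers p K) F)ˣ) :
        AlgIntegers (Integers p K) F).2 φ
      have h3 : φ ((u : AlgIntegers (Integers p K) F) : AdjoinRoot F) *
          φ (((u⁻¹ : (AlgIntegers (Integers p K) F)ˣ) : AlgIntegers (Integers p K) F) :
            AdjoinRoot F) = 1 := by
        rw [← map_mul, ← MulMemClass.coe_mul, Units.mul_inv, OneMemClass.coe_one, map_one]
      have h4 := congrArg (spectralAbs p K) h3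
      rw [AbsoluteValue.map_mul, AbsoluteValue.map_one] at h4
      change spectralAbs p K (φ ((u : AlgIntegers (Integers p K) F) : AdjoinRoot F)) = 1
      nlinarith [(spectralAbs p K).nonneg (φ ((u : AlgIntegers (Integers p K) F) : AdjoinRoot F)),
        (spectralAbs p K).nonneg (φ (((u⁻¹ : (AlgIntegers (Integers p K) F)ˣ) :
          AlgIntegers (Integers p K) F) : AdjoinRoot F))]
  · rintro ⟨⟨u, hu, rfl⟩, hsq⟩
    have h1 : (u : AdjoinRoot F) ∈ AlgIntegers (Integers p K) F :=
      (mem_algIntegers_iff _).mpr fun φ => (hu φ).le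
    have h2 : ((u⁻¹ : (AdjoinRoot F)ˣ) : AdjoinRoot F) ∈ AlgIntegers (Integers p K) F :=
      (mem_algIntegers_iff _).mpr fun φ => (inv_mem hu φ).le
    let u' : (AlgIntegers (Integers p K) F)ˣ :=
      ⟨⟨_, h1⟩, ⟨_, h2⟩, Subtype.ext (by simp), Subtype.ext (by simp)⟩
    have h3 : integersToAlg (Integers p K) F (u' : ModSquares (AlgIntegers (Integers p K) F)) =
        (u : ModSquares (AdjoinRoot F)) := congrArg QuotientGroup.mk (Units.ext rfl)
    refine ⟨(u' : ModSquares (AlgIntegers (Integers p K) F)), ?_, h3⟩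
    change integersToAlg (Integers p K) F _ ∈ squareNorm F
    rw [h3]
    exact hsq

end Integral

section Criteria

open scoped Classical

open WeierstrassCurve WeierstrassCurve.Affine

variable {p : ℕ} [Fact p.Prime] {K : Type*} [Field K] [CharZero K] [Algebra ℚ_[p] K]
  [FiniteDimensional ℚ_[p] K] [Algebra ℤ_[p] K] [IsScalarTower ℤ_[p] ℚ_[p] K]
  {F : K[X]} [hF : IsSquarefreeCubic F]

/-! ### Points of nonsingular reduction -/

theorem base_eq_one_of_residue_ne_zero {z : Integers p K} (h : IsLocalRing.residue _ z ≠ 0) :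
    baseAbs (spectralAbs p K) (z : K) = 1 :=
  (isUnit_iff_base_eq_one p K z).mp ((IsLocalRing.residue_ne_zero_iff_isUnit z).mp h)

/-- As 2 is a unit, the square can be completed on the minimal equation without losing integrality.
This gives Y² = X³ + c₂X² + c₁X + c₀ with X = (x - r)/u² and Y = y/u³, to which the criterion for
factors of x - T applies. -/
theorem kummer_mem_of_hasNonsingularReduction (hv : IsLocalAbs (spectralAbs p K))
    (D : VariableChange K) [IsMinimal (Integers p K) (D • cubicCurve F)]
    {P : Pts (cubicCurve F) K} (hP : HasNonsingularReduction (Integers p K) (cubicCurve F) D P) :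
    kummerHom F (Multiplicative.ofAdd P) ∈
      (absUnits (spectralAbs p K) F).map (QuotientGroup.mk' _) := by
  rcases P with _ | ⟨x, y, h⟩
  · change kummerHom F (Multiplicative.ofAdd 0) ∈ _
    rw [ofAdd_zero, map_one]; exact one_mem _
  set w := baseAbs (spectralAbs p K) with hw
  set M := integralModel (Integers p K) (D • cubicCurve F) with hM
  have hw2 : w 2 = 1 := hv.base_two
  have t2 : ((2 : Integers p K) : K) = 2 := rfl
  have t3 : ((3 : Integers p K) : K) = 3 := rfl
  have hint : ∀ a : Integers p K, w (a : K) ≤ 1 := base_integers_le_one p K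
  obtain ⟨u, hu⟩ : ∃ u : K, u = D.u := ⟨_, rfl⟩
  have hu0 : u ≠ 0 := hu ▸ D.u.ne_zero
  have hui : ((D.u⁻¹ : Kˣ) : K) = u⁻¹ := by rw [hu, Units.val_inv_eq_inv_val]
  have e1 : (M.a₁ : K) = u⁻¹ * (2 * D.s) := by
    have := integralModel_a₁_eq (Integers p K) (D • cubicCurve F)
    rw [variableChange_a₁, hui] at this
    exact this.trans (by simp [cubicCurve])
  have e2 : (M.a₂ : K) = u⁻¹ ^ 2 * (F.coeff 2 + 3 * D.r - D.s ^ 2) := by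
    have := integralModel_a₂_eq (Integers p K) (D • cubicCurve F)
    rw [variableChange_a₂, hui] at this
    exact this.trans (by simp [cubicCurve])
  have e3 : (M.a₃ : K) = u⁻¹ ^ 3 * (2 * D.t) := by
    have := integralModel_a₃_eq (Integers p K) (D • cubicCurve F)
    rw [variableChange_a₃, hui] at this
    exact this.trans (by simp [cubicCurve])
  have e4 : (M.a₄ : K) =
      u⁻¹ ^ 4 * (F.coeff 1 + 2 * D.r * F.coeff 2 + 3 * D.r ^ 2 - 2 * D.s * D.t) := by
    have := integralModel_a₄_eq (Integers p K) (D • cubicCurve F)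
    rw [variableChange_a₄, hui] at this
    exact this.trans (by simp [cubicCurve])
  have e6 : (M.a₆ : K) =
      u⁻¹ ^ 6 * (F.coeff 0 + D.r * F.coeff 1 + D.r ^ 2 * F.coeff 2 + D.r ^ 3 - D.t ^ 2) := by
    have := integralModel_a₆_eq (Integers p K) (D • cubicCurve F)
    rw [variableChange_a₆, hui] at this
    exact this.trans (by simp [cubicCurve])
  -- The numbers h₁ and h₃ are the halves of the minimal a₁ and a₃; they shift y' to Y = y' + h₁x' +
  -- h₃.
  obtain ⟨h1, hh1⟩ : ∃ h1 : Integers p K, (h1 : K) = u⁻¹ * D.s :=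
    ⟨⟨_, (base_le_one_iff p K _).mp (by
      have := hint M.a₁
      rwa [e1, show u⁻¹ * (2 * D.s) = 2 * (u⁻¹ * D.s) by ring, w.map_mul, hw2, one_mul] at this)⟩,
      rfl⟩
  obtain ⟨h3, hh3⟩ : ∃ h3 : Integers p K, (h3 : K) = u⁻¹ ^ 3 * D.t :=
    ⟨⟨_, (base_le_one_iff p K _).mp (by
      have := hint M.a₃
      rwa [e3, show u⁻¹ ^ 3 * (2 * D.t) = 2 * (u⁻¹ ^ 3 * D.t) by ring, w.map_mul, hw2,
        one_mul] at this)⟩, rfl⟩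
  obtain ⟨c2, hc2⟩ : ∃ c2 : Integers p K, c2 = h1 ^ 2 + M.a₂ := ⟨_, rfl⟩
  obtain ⟨c1, hc1⟩ : ∃ c1 : Integers p K, c1 = 2 * h1 * h3 + M.a₄ := ⟨_, rfl⟩
  obtain ⟨c0, hc0⟩ : ∃ c0 : Integers p K, c0 = h3 ^ 2 + M.a₆ := ⟨_, rfl⟩
  have f2 : u ^ 2 * (c2 : K) = F.coeff 2 + 3 * D.r := by
    rw [hc2]; push_cast [t2, t3]; rw [hh1, e2]; field_simp; ring
  have f1 : u ^ 4 * (c1 : K) = F.coeff 1 + 2 * D.r * F.coeff 2 + 3 * D.r ^ 2 := by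
    rw [hc1]; push_cast [t2, t3]; rw [hh1, hh3, e4]; field_simp; ring
  have f0 : u ^ 6 * (c0 : K) =
      F.coeff 0 + D.r * F.coeff 1 + D.r ^ 2 * F.coeff 2 + D.r ^ 3 := by
    rw [hc0]; push_cast [t2, t3]; rw [hh3, e6]; field_simp; ring
  have hwu : 0 < w u := w.pos hu0
  refine kummer_mem_of_nonsingular hv h (u := u) (r := D.r) hu0 (fun φ => ?_) ?_
  · have hu0' : algebraMap K (AlgebraicClosure K) u ≠ 0 := (_root_.map_ne_zero _).mpr hu0
    have hz : spectralAbs p K ((φ.rt - algebraMap K _ D.r) / algebraMap K _ u ^ 2) ≤ 1 := by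
      refine hv.le_one_of_cubic (hint c2) (hint c1) (hint c0) ?_
      have g2 := congrArg (algebraMap K (AlgebraicClosure K)) f2
      have g1 := congrArg (algebraMap K (AlgebraicClosure K)) f1
      have g0 := congrArg (algebraMap K (AlgebraicClosure K)) f0
      have g := (aeval_cubic (F := F) φ.rt).symm.trans φ.aeval_rt
      simp only [map_mul, map_add, map_pow, map_ofNat] at g2 g1 g0
      refine (mul_eq_zero.mp ?_).resolve_left (pow_ne_zero 6 hu0')
      have hX : ∃ X, X = (φ.rt - algebraMap K _ D.r) / algebraMap K _ u ^ 2 := ⟨_, rfl⟩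
      obtain ⟨X, hX⟩ := hX
      have hX' : φ.rt = algebraMap K _ u ^ 2 * X + algebraMap K _ D.r := by
        rw [hX]; field_simp; ring
      change _ * (_ + algebraMap K (AlgebraicClosure K) (c2 : K) * _ +
        algebraMap K (AlgebraicClosure K) (c1 : K) * _ +
        algebraMap K (AlgebraicClosure K) (c0 : K)) = 0
      rw [← hX]
      rw [hX'] at g
      linear_combination g + algebraMap K _ u ^ 4 * X ^ 2 * g2 + algebraMap K _ u ^ 2 * X * g1 + g0
    rw [map_div₀, map_pow, ← baseAbs_apply] at hz
    exact (div_le_one (pow_pos hwu 2)).mp hz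
  · refine or_iff_not_imp_left.mpr fun hbig => ?_
    push Not at hbig
    obtain ⟨a, ha⟩ : ∃ a : Integers p K, (a : K) = (x - D.r) / u ^ 2 :=
      ⟨⟨_, (base_le_one_iff p K _).mp (by
        change w _ ≤ 1
        rw [map_div₀, map_pow]; exact (div_le_one (pow_pos hwu 2)).mpr hbig)⟩, rfl⟩
    have hx : x = u ^ 2 * a + D.r := by rw [ha]; field_simp; ring
    have hYK : (y / u ^ 3) ^ 2 = ((a ^ 3 + c2 * a ^ 2 + c1 * a + c0 : Integers p K) : K) := by
      have h4 := affine_equation h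
      rw [hx] at h4
      rw [div_pow, div_eq_iff (by positivity), h4]
      push_cast [t2, t3]
      linear_combination (-u ^ 4 * (a : K) ^ 2) * f2 - u ^ 2 * (a : K) * f1 - f0
    obtain ⟨Y, hY⟩ : ∃ Y : Integers p K, (Y : K) = y / u ^ 3 :=
      ⟨⟨_, (base_le_one_iff p K _).mp (by
        have := hint (a ^ 3 + c2 * a ^ 2 + c1 * a + c0)
        rw [← hYK, map_pow] at this
        exact (pow_le_one_iff_of_nonneg (w.nonneg _) two_ne_zero).mp this)⟩, rfl⟩
    have hy : y = u ^ 3 * Y := by rw [hY]; field_simp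
    have hYone : w Y = 1 → w y = w u ^ 3 := fun h => by
      rw [hy, w.map_mul, map_pow, h, mul_one]
    have hns := hP a (Y - h1 * a - h3) (by rw [← hu]; exact hx) (by
      rw [← hu, hy]
      change u ^ 3 * (Y : K) = u ^ 3 * ((Y - h1 * a - h3 : Integers p K) : K) +
        u ^ 2 * D.s * (a : K) + D.t
      push_cast [t2, t3]
      rw [hh1, hh3]
      field_simp
      ring)
    have ha1 : M.a₁ = 2 * h1 := Subtype.ext (by push_cast [t2, t3]; rw [e1, hh1]; ring)
    have ha3 : M.a₃ = 2 * h3 := Subtype.ext (by push_cast [t2, t3]; rw [e3, hh3]; ring)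
    rw [Affine.nonsingular_iff] at hns
    rcases hns.2 with hns | hns
    -- In the completed coordinates the x-derivative is 2h₁Y minus that of the cubic, and the
    -- y-derivative is 2Y. If Y is not a unit, the first must be a unit through the cubic's
    -- derivative.
    · have hres : IsLocalRing.residue _ (2 * h1 * Y - (3 * a ^ 2 + 2 * c2 * a + c1)) ≠ 0 := by
        intro h0
        apply hns
        rw [← sub_eq_zero]
        change IsLocalRing.residue _ M.a₁ * _ -
          (3 * _ ^ 2 + 2 * IsLocalRing.residue _ M.a₂ * _ + IsLocalRing.residue _ M.a₄) = 0
        rw [← h0, ha1, hc1, hc2]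
        simp only [map_mul, map_add, map_sub, map_pow, map_ofNat]
        ring
      have hone := base_eq_one_of_residue_ne_zero hres
      by_cases hY1 : w Y = 1
      · exact Or.inl (hYone hY1)
      · right
        have hY2 : w Y < 1 := lt_of_le_of_ne (hint Y) hY1
        have hder : (derivative F).eval x =
            u ^ 4 * ((3 * a ^ 2 + 2 * c2 * a + c1 : Integers p K) : K) := by
          rw [eval_derivative_cubic, hx]
          push_cast [t2, t3]
          linear_combination (-2 * u ^ 2 * (a : K)) * f2 - f1
        have hsmall : w ((2 * h1 * Y : Integers p K) : K) < 1 := by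
          push_cast [t2, t3]
          rw [w.map_mul, w.map_mul, hw2, one_mul]
          exact (mul_le_of_le_one_left (w.nonneg _) (hint h1)).trans_lt hY2
        have hG : w ((3 * a ^ 2 + 2 * c2 * a + c1 : Integers p K) : K) = 1 := by
          refine le_antisymm (hint _) ?_
          by_contra hlt
          push Not at hlt
          have := hv.base_sub_le (le_max_left (w ((2 * h1 * Y : Integers p K) : K))
            (w ((3 * a ^ 2 + 2 * c2 * a + c1 : Integers p K) : K))) (le_max_right _ _)
          rw [← AddSubgroupClass.coe_sub, hone] at this
          exact absurd this (not_le.mpr (max_lt hsmall hlt))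
        rw [hder, w.map_mul, map_pow, hG, mul_one]
    · left
      have hres : IsLocalRing.residue _ (2 * Y) ≠ 0 := by
        intro h0
        apply hns
        rw [← sub_eq_zero]
        change _ - (-_ - IsLocalRing.residue _ M.a₁ * _ - IsLocalRing.residue _ M.a₃) = 0
        rw [← h0, ha1, ha3]
        simp only [map_mul, map_sub, map_ofNat]
        ring
      have hone := base_eq_one_of_residue_ne_zero hres
      push_cast [t2, t3] at hone
      rw [AbsoluteValue.map_mul, hv.base_two, one_mul] at hone
      exact hYone hone

/-- An odd multiple of P has the same class as P, and the multiple by the index lies in the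
nonsingular part. -/
theorem kummer_mem_of_odd_index (hv : IsLocalAbs (spectralAbs p K))
    (D : VariableChange K) [IsMinimal (Integers p K) (D • cubicCurve F)]
    (hodd : Odd (nonsingularPart (Integers p K) (cubicCurve F) D).index)
    (P : Pts (cubicCurve F) K) : kummerHom F (Multiplicative.ofAdd P) ∈
      (absUnits (spectralAbs p K) F).map (QuotientGroup.mk' _) := by
  have h1 := AddSubgroup.nsmul_index_mem (nonsingularPart (Integers p K) (cubicCurve F) D) P
  obtain ⟨n, hn⟩ := hodd
  have h2 : ∀ Q ∈ nonsingularPart (Integers p K) (cubicCurve F) D,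
      kummerHom F (Multiplicative.ofAdd Q) ∈
        (absUnits (spectralAbs p K) F).map (QuotientGroup.mk' _) := by
    intro Q hQ
    induction hQ using AddSubgroup.closure_induction with
    | mem Q hQ => exact kummer_mem_of_hasNonsingularReduction hv D hQ
    | zero => rw [ofAdd_zero, map_one]; exact one_mem _
    | add Q R _ _ hQ hR => rw [ofAdd_add, map_mul]; exact mul_mem hQ hR
    | neg Q _ hQ => rw [ofAdd_neg, map_inv]; exact inv_mem hQ
  have h3 := h2 _ h1
  rwa [ofAdd_nsmul, map_pow, hn, pow_succ, pow_mul, sq, modSquares_mul_self, one_pow,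
    one_mul] at h3

end Criteria

section Monogenic

open scoped Classical

open WeierstrassCurve.Affine

variable {p : ℕ} [Fact p.Prime] {K : Type*} [Field K] [CharZero K] [Algebra ℚ_[p] K]
  [FiniteDimensional ℚ_[p] K] [Algebra ℤ_[p] K] [IsScalarTower ℤ_[p] ℚ_[p] K]
  {F : K[X]} [hF : IsSquarefreeCubic F]

/-! ### The case of a monogenic ring of integers -/

variable (p K) in
theorem exists_uniformizer : ∃ ϖ : K, ϖ ≠ 0 ∧ baseAbs (spectralAbs p K) ϖ < 1 ∧
    ∀ z, baseAbs (spectralAbs p K) z < 1 →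
      baseAbs (spectralAbs p K) z ≤ baseAbs (spectralAbs p K) ϖ := by
  obtain ⟨ϖ, hϖ⟩ := IsDiscreteValuationRing.exists_irreducible (Integers p K)
  refine ⟨ϖ, fun h => hϖ.ne_zero (Subtype.ext h), lt_of_le_of_ne (base_integers_le_one p K ϖ)
    fun h => hϖ.not_isUnit ((isUnit_iff_base_eq_one p K ϖ).mpr h), fun z hz => ?_⟩
  obtain ⟨z, rfl⟩ : ∃ z' : Integers p K, (z' : K) = z :=
    ⟨⟨z, (base_le_one_iff p K z).mp hz.le⟩, rfl⟩
  have h1 : z ∈ IsLocalRing.maximalIdeal (Integers p K) := fun h =>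
    hz.ne ((isUnit_iff_base_eq_one p K z).mp h)
  rw [hϖ.maximalIdeal_eq, Ideal.mem_span_singleton] at h1
  obtain ⟨t, rfl⟩ := h1
  rw [MulMemClass.coe_mul, AbsoluteValue.map_mul]
  exact mul_le_of_le_one_right (AbsoluteValue.nonneg _ _) (base_integers_le_one p K t)

theorem root_basis_unique {c₂ c₁ c₀ d₂ d₁ d₀ : K}
    (h : AdjoinRoot.mk F (C c₂ * X ^ 2 + C c₁ * X + C c₀) =
      AdjoinRoot.mk F (C d₂ * X ^ 2 + C d₁ * X + C d₀)) : c₂ = d₂ := by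
  rw [AdjoinRoot.mk_eq_mk] at h
  have h1 : C c₂ * X ^ 2 + C c₁ * X + C c₀ - (C d₂ * X ^ 2 + C d₁ * X + C d₀) =
      C (c₂ - d₂) * X ^ 2 + C (c₁ - d₁) * X + C (c₀ - d₀) := by
    simp only [map_sub]; ring
  have h2 := eq_zero_of_dvd_of_degree_lt h (by
    rw [h1, degree_eq_natDegree hF.ne_zero, hF.natDegree_eq]
    exact degree_quadratic_lt)
  rw [h1] at h2
  have h3 := congrArg (fun q => coeff q 2) h2
  simp only [coeff_add, coeff_C_mul, coeff_X_pow, coeff_X, coeff_C, coeff_zero] at h3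
  simpa [sub_eq_zero] using h3

/-- Division by a monic integral lift of F keeps the coefficients integral. -/
theorem exists_quadratic_of_mem_adjoin (hint : ∀ i, F.coeff i ∈ Integers p K) {a : AdjoinRoot F}
    (ha : a ∈ Algebra.adjoin (Integers p K) {AdjoinRoot.root F}) :
    ∃ c₂ c₁ c₀ : Integers p K,
      a = AdjoinRoot.mk F (C (c₂ : K) * X ^ 2 + C (c₁ : K) * X + C (c₀ : K)) := by
  rw [Algebra.adjoin_singleton_eq_range_aeval] at ha
  obtain ⟨g, rfl⟩ := ha
  have hl : F ∈ lifts (algebraMap (Integers p K) K) := by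
    rw [lifts_iff_coeff_lifts]
    exact fun n => ⟨⟨_, hint n⟩, rfl⟩
  obtain ⟨G, hG, hdeg, hmonic⟩ := lifts_and_natDegree_eq_and_monic hl hF.monic
  rw [hF.natDegree_eq] at hdeg
  have hroot : aeval (AdjoinRoot.root F) G = 0 := by
    rw [← aeval_map_algebraMap K, hG, AdjoinRoot.aeval_eq, AdjoinRoot.mk_self]
  have hlt : (g %ₘ G).natDegree < 3 := hdeg ▸ natDegree_modByMonic_lt g hmonic fun h => by
    rw [h, natDegree_one] at hdeg; omega
  refine ⟨(g %ₘ G).coeff 2, (g %ₘ G).coeff 1, (g %ₘ G).coeff 0, ?_⟩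
  change aeval (AdjoinRoot.root F) g = _
  have hg : aeval (AdjoinRoot.root F) g = aeval (AdjoinRoot.root F) (g %ₘ G) := by
    conv_lhs => rw [← modByMonic_add_div g G, map_add, map_mul, hroot, zero_mul, add_zero]
  rw [hg, ← aeval_map_algebraMap K, AdjoinRoot.aeval_eq]
  congr 1
  conv_lhs => rw [(g %ₘ G).as_sum_range' 3 hlt]
  simp only [Finset.sum_range_succ, Finset.sum_range_zero, Polynomial.map_add, Polynomial.map_mul,
    Polynomial.map_pow, map_C, map_X, ← C_mul_X_pow_eq_monomial, zero_add, pow_zero, mul_one,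
    pow_one]
  change C (((g %ₘ G).coeff 0 : Integers p K) : K) + C (((g %ₘ G).coeff 1 : Integers p K) : K) * X +
    C (((g %ₘ G).coeff 2 : Integers p K) : K) * X ^ 2 = _
  ring

/-- If the ring of integers is generated by a root, the cubic curve is regular: `y` and `F'(x)`
cannot both be non-units at an integral point. -/
theorem one_le_abs_of_monogenic (hv : IsLocalAbs (spectralAbs p K))
    (hint : ∀ i, F.coeff i ∈ Integers p K)
    (hmono : AlgIntegers (Integers p K) F = Algebra.adjoin (Integers p K) {AdjoinRoot.root F})
    {x y : K} (h : (WeierstrassCurve.baseChange (cubicCurve F) K).toAffine.Nonsingular x y)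
    (hx : baseAbs (spectralAbs p K) x ≤ 1) : 1 ≤ baseAbs (spectralAbs p K) y ∨
      1 ≤ baseAbs (spectralAbs p K) ((derivative F).eval x) := by
  by_contra hcon
  push Not at hcon
  obtain ⟨hy, hd⟩ := hcon
  obtain ⟨ϖ, hϖ0, hϖ1, hϖ⟩ := exists_uniformizer p K
  have hy' := hϖ _ hy
  have hd' := hϖ _ hd
  set v := spectralAbs p K with hvdef
  set ε := baseAbs v ϖ with hε
  have hε0 : 0 < ε := (baseAbs v).pos hϖ0
  -- This is (F(T) - F(x)) / (T - x) divided by ϖ; at φ₁ it equals (x - φ₂(T))(x - φ₃(T)) / ϖ. It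
  -- will be shown integral over the base although its leading coefficient ϖ⁻¹ is not.
  set q : K[X] := C ϖ⁻¹ * X ^ 2 + C (ϖ⁻¹ * (F.coeff 2 + x)) * X +
    C (ϖ⁻¹ * (x ^ 2 + F.coeff 2 * x + F.coeff 1)) with hq
  have hmem : AdjoinRoot.mk F q ∈ AlgIntegers (Integers p K) F := by
    rw [mem_algIntegers_iff]
    intro φ₁
    obtain ⟨φ₂, φ₃, htr⟩ := exists_triple_of φ₁
    obtain ⟨k2, k1, -⟩ := htr.coeff
    have hφ : φ₁ (AdjoinRoot.mk F q) = algebraMap K _ ϖ⁻¹ *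
        ((algebraMap K _ x - φ₂.rt) * (algebraMap K _ x - φ₃.rt)) := by
      rw [← AdjoinRoot.aeval_eq, ← aeval_algHom_apply, hq]
      change aeval φ₁.rt _ = _
      simp only [map_add, map_mul, aeval_C, map_pow, aeval_X, k2, k1]
      ring
    rw [hφ, v.map_mul, ← baseAbs_apply, map_inv₀, inv_mul_le_iff₀ hε0, mul_one]
    have hsq := abs_y_sq (v := v) h
    rw [htr.prod, mul_assoc, ← v.map_mul (algebraMap K _ x - φ₂.rt)] at hsq
    have hle : ∀ φ : Emb F, v (algebraMap K _ x - φ.rt) ≤ 1 := fun φ =>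
      (hv.sub_le _ _).trans (max_le hx
        (hv.rt_le_one (fun i => (base_le_one_iff p K _).mpr (hint i)) φ))
    have hder := htr.eval_derivative x
    set B := (algebraMap K (AlgebraicClosure K) x - φ₂.rt) * (algebraMap K _ x - φ₃.rt)
    by_contra hB
    push Not at hB
    -- The product of this factor with B has size |y|² ≤ ε². So if |B| > ε, the factor is at most ε,
    -- and the formula for F'(x) bounds B by ε after all.
    have hA : v (algebraMap K _ x - φ₁.rt) ≤ ε := by
      by_contra hA
      push Not at hA
      nlinarith [(baseAbs v).nonneg y]
    have hB' : B = algebraMap K _ ((derivative F).eval x) + -((algebraMap K _ x - φ₁.rt) *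
        ((algebraMap K _ x - φ₂.rt) + (algebraMap K _ x - φ₃.rt))) := by
      rw [hder]; ring
    refine absurd hB (not_lt.mpr ?_)
    rw [hB']
    refine hv.add_le hd' ?_
    rw [v.map_neg, v.map_mul]
    exact (mul_le_of_le_one_right (v.nonneg _) (hv.add_le (hle φ₂) (hle φ₃))).trans hA
  rw [hmono] at hmem
  obtain ⟨c₂, c₁, c₀, hc⟩ := exists_quadratic_of_mem_adjoin hint hmem
  have h1 := root_basis_unique hc
  have h2 : ε⁻¹ ≤ 1 := by
    rw [hε, ← map_inv₀, h1]; exact base_integers_le_one p K c₂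
  exact absurd hϖ1 (not_lt.mpr ((inv_le_one₀ hε0).mp h2))

/-- The given equation itself serves as the model, with u = 1 and r = 0; its minimality is not
needed. -/
theorem kummer_mem_of_monogenic (hv : IsLocalAbs (spectralAbs p K))
    (hint : ∀ i, F.coeff i ∈ Integers p K)
    (hmono : AlgIntegers (Integers p K) F = Algebra.adjoin (Integers p K) {AdjoinRoot.root F})
    (P : Pts (cubicCurve F) K) : kummerHom F (Multiplicative.ofAdd P) ∈
      (absUnits (spectralAbs p K) F).map (QuotientGroup.mk' _) := by
  rcases P with _ | ⟨x, y, h⟩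
  · change kummerHom F (Multiplicative.ofAdd 0) ∈ _
    rw [ofAdd_zero, map_one]; exact one_mem _
  have hint' : ∀ i, baseAbs (spectralAbs p K) (F.coeff i) ≤ 1 := fun i =>
    (base_le_one_iff p K _).mpr (hint i)
  refine kummer_mem_of_nonsingular hv h (u := 1) (r := 0) one_ne_zero (fun φ => ?_) ?_
  · rw [map_zero, sub_zero, map_one, one_pow]
    exact hv.rt_le_one hint' φ
  · simp only [map_one, one_pow, sub_zero]
    refine or_iff_not_imp_left.mpr fun hx => ?_
    push Not at hx
    refine (one_le_abs_of_monogenic hv hint hmono h hx).imp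
      (le_antisymm (abs_y_le_one hv hint' h hx)) (le_antisymm ?_)
    have h2 := hv.base_two.le
    have h3 : baseAbs (spectralAbs p K) 3 ≤ 1 := base_integers_le_one p K 3
    rw [eval_derivative_cubic]
    refine hv.base_add_le (hv.base_add_le ?_ ?_) (hint' 1)
    · rw [AbsoluteValue.map_mul, map_pow]
      exact mul_le_one₀ h3 (by positivity) (pow_le_one₀ (AbsoluteValue.nonneg _ _) hx)
    · rw [AbsoluteValue.map_mul, AbsoluteValue.map_mul]
      exact mul_le_one₀ (mul_le_one₀ h2 (AbsoluteValue.nonneg _ _) (hint' 2))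
        (AbsoluteValue.nonneg _ _) hx

end Monogenic

end LocalKummer

/-! ### The image of the Kummer map and the unit classes. -/

theorem mainTheorem7 (p : ℕ) [Fact p.Prime] (K : Type*) [Field K] [Algebra ℚ_[p] K]
    [FiniteDimensional ℚ_[p] K] [Algebra ℤ_[p] K] [IsScalarTower ℤ_[p] ℚ_[p] K]
    (F : Polynomial K) (hF : LocalKummer.Dagger p K F)
    (hk : 2 < ringChar (IsLocalRing.ResidueField (LocalKummer.Integers p K))) :
    LocalKummer.kummerImage F =
      ((LocalKummer.integralSquareNorm (LocalKummer.Integers p K) F).map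
        (LocalKummer.integersToAlg (LocalKummer.Integers p K) F) :
          Set (LocalKummer.ModSquares (AdjoinRoot F))) := by
  have : LocalKummer.IsSquarefreeCubic F := ⟨hF.monic, hF.natDegree_eq, hF.squarefree⟩
  have : CharZero K := charZero_of_injective_algebraMap (algebraMap ℚ_[p] K).injective
  have hv := LocalKummer.isLocalAbs_spectralAbs p K hk
  rw [LocalKummer.kummerImage_eq_range, LocalKummer.map_integralSquareNorm_eq,
    LocalKummer.range_kummerHom_eq hv fun i =>
      (LocalKummer.base_le_one_iff p K _).mpr (hF.integral i)]
  intro P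
  rcases hF.condition with h | h | ⟨-, D, hD, hodd⟩ | ⟨h, -⟩
  · exact LocalKummer.squareNorm_le_of_isField hv h
      (LocalKummer.isKummerValue_kummerHom P).mem_squareNorm
  · exact LocalKummer.kummer_mem_of_monogenic hv hF.integral h P
  · exact LocalKummer.kummer_mem_of_odd_index hv D hodd P
  -- Condition (iv) requires residue characteristic 2.
  · omega
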